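/- Let $n\ge 4$. A metric $d$ on $\{1,\dots,n\}$ is a symmetric non-negative real $n\times n$ matrix with zero diagonal satisfying the triangle inequality. Put $P_d=\{x\in\mathbb{R}^n : x_i+x_j\ge d(i,j)\text{ for all } i,j\}$ (including $i=j$); let the tight span $T_d$ be the complex of bounded faces of $P_d$, and call $d$ generic if $P_d$ is simple, i.e. each vertex of $P_d$ lies in exactly $n$ facets. Let $\Delta_{n,2}=\operatorname{conv}\{e_i+e_j : 1\le i<j\le n\}$ be the second hypersimplex and $\Delta^d$ its regular subdivision induced by $d$: its cells are the polytopes $\operatorname{conv}\{e_i+e_j : \{i,j\}\in E(\Gamma)\}$, where $\Gamma$ runs over the graphs on $\{1,\dots,n\}$ for which there is $\lambda\in\mathbb{R}^n$ with $\lambda_i+\lambda_j=d(i,j)$ if $\{i,j\}$ is an edge of $\Gamma$ and $\lambda_i+\lambda_j>d(i,j)$ if it is a non-edge ($i\neq j$). Let $f_k(T_d)$ be the number of $k$-dimensional faces of $T_d$, and $f_k(\operatorname{int}\Delta^d)$ the number of $k$-dimensional cells of $\Delta^d$ not contained in the boundary of $\Delta_{n,2}$. (a) If $d$ is a generic metric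 on $n$ points such that $T_d$ has dimension $\lceil n/3\rceil$, then $$f_{\lceil n/3\rceil}(T_d)=f_{\lfloor 2n/3\rfloor-1}(\operatorname{int}\Delta^d)\ \ge\ \begin{cases} n\cdot 3^{k-2}+3^k & \text{if } n=3k,\\ 3^{k-1} & \text{if } n=3k+1,\\ 5\cdot 3^{k-1} & \text{if } n=3k+2.\end{cases}$$ (b) These bounds are attained. Let $\Gamma_{\min}^n$ be the graph on $\{1,\dots,n\}$ in which distinct $i,j$ are adjacent if and only if $\lfloor (i-1)/3\rfloor=\lfloor (j-1)/3\rfloor$ and, in case $n\equiv 2 \pmod 3$, also $i,j<n$. Let $d_{\min}^n$ be the symmetric matrix with zero diagonal and, for $i<j$, $d_{\min}^n(i,j)=2$ if $\{i,j\}\in E(\Gamma_{\min}^n)$ and $d_{\min}^n(i,j)=1+\frac{1}{n^2+in+j}$ otherwise. Then $d_{\min}^n$ is a generic metric, $\dim T_{d_{\min}^n}=\lceil n/3\rceil$, and $f_{\lceil n/3\rceil}(T_{d_{\min}^n})$ equals the right-hand side of the inequality in (a). -/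

import Mathlib

namespace TightSpan

/-- A face of a convex polyhedron `P ⊆ ℝⁿ`: a nonempty set of the form
`{x ∈ P | l x is maximal on P}` for a linear functional `l` (so `P` is a face of itself). -/
def IsFace {n : ℕ} (P F : Set (Fin n → ℝ)) : Prop :=
  F.Nonempty ∧ IsExposed ℝ P F

/-- The dimension of (the affine hull of) a nonempty set. -/
noncomputable def faceDim {n : ℕ} (F : Set (Fin n → ℝ)) : ℕ :=
  Module.finrank ℝ (vectorSpan ℝ F)

/-- A facet is a face of codimension one. -/
def IsFacet {n : ℕ} (P F : Set (Fin n → ℝ)) : Prop :=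
  IsFace P F ∧ faceDim F + 1 = faceDim P

/-- A polyhedron is simple if each vertex is contained in exactly `dim P` facets. -/
def IsSimplePolyhedron {n : ℕ} (P : Set (Fin n → ℝ)) : Prop :=
  ∀ v : Fin n → ℝ, IsFace P {v} → {F | IsFacet P F ∧ v ∈ F}.ncard = faceDim P

/-- `fVec C k` is the number of `k`-dimensional members of a family `C` of polytopes
(an entry of the `f`-vector). -/
noncomputable def fVec {n : ℕ} (C : Set (Set (Fin n → ℝ))) (k : ℕ) : ℕ :=
  {F ∈ C | faceDim F = k}.ncard

/-- The family `C` of polytopes has dimension `m`: the largest dimension of a member is `m`. -/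
def HasDim {n : ℕ} (C : Set (Set (Fin n → ℝ))) (m : ℕ) : Prop :=
  IsGreatest (faceDim '' C) m

/-- A metric on the `n` points `Fin n`. -/
structure IsMetric {n : ℕ} (d : Fin n → Fin n → ℝ) : Prop where
  diag : ∀ i, d i i = 0
  symm : ∀ i j, d i j = d j i
  nonneg : ∀ i j, 0 ≤ d i j
  triangle : ∀ i j k, d i k ≤ d i j + d j k

/-- The polyhedron `P_d` (the case `i = j` is included). -/
def polyhedron {n : ℕ} (d : Fin n → Fin n → ℝ) : Set (Fin n → ℝ) :=
  {x | ∀ i j, d i j ≤ x i + x j}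

/-- The metric `d` is generic if the polyhedron `P_d` is simple. -/
def IsGeneric {n : ℕ} (d : Fin n → Fin n → ℝ) : Prop :=
  IsSimplePolyhedron (polyhedron d)

/-- The tight span `T_d`: the complex of bounded faces of `P_d`. -/
def tightSpan {n : ℕ} (d : Fin n → Fin n → ℝ) : Set (Set (Fin n → ℝ)) :=
  {F | IsFace (polyhedron d) F ∧ Bornology.IsBounded F}

/-- The convex hull of the points `e_i + e_j` over the edges `{i, j}` of a graph `Γ`. -/
noncomputable def edgePolytope {n : ℕ} (Γ : SimpleGraph (Fin n)) : Set (Fin n → ℝ) :=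
  convexHull ℝ {x | ∃ i j, Γ.Adj i j ∧ x = Pi.single i 1 + Pi.single j 1}

/-- The second hypersimplex `Δ_{n,2}`. -/
noncomputable def hypersimplex (n : ℕ) : Set (Fin n → ℝ) :=
  edgePolytope (⊤ : SimpleGraph (Fin n))

/-- `Γ` represents a cell of `Δ^d`: it admits a height function `h` with
`h i + h j = d i j` on the edges of `Γ` and `h i + h j > d i j` on the non-edges. -/
def IsCellGraph {n : ℕ} (d : Fin n → Fin n → ℝ) (Γ : SimpleGraph (Fin n)) : Prop :=
  ∃ h : Fin n → ℝ, ∀ i j, i ≠ j →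
    (Γ.Adj i j → h i + h j = d i j) ∧ (¬ Γ.Adj i j → d i j < h i + h j)

/-- The regular subdivision `Δ^d` of the second hypersimplex induced by `d`, as the set of
its nonempty cells. -/
def hypersimplexSubdivision {n : ℕ} (d : Fin n → Fin n → ℝ) : Set (Set (Fin n → ℝ)) :=
  {C | C.Nonempty ∧ ∃ Γ : SimpleGraph (Fin n), IsCellGraph d Γ ∧ C = edgePolytope Γ}

/-- The interior cells of `Δ^d`: those not contained in the boundary of the hypersimplex,
that is, in none of its proper faces. -/
def interiorCells {n : ℕ} (d : Fin n → Fin n → ℝ) : Set (Set (Fin n → ℝ)) :=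
  {C ∈ hypersimplexSubdivision d |
    ∀ F, IsFace (hypersimplex n) F → F ≠ hypersimplex n → ¬ C ⊆ F}

open Classical in
/-- The metric `d_Γ` of a graph `Γ`.  The point `i : Fin n` stands for the label `i + 1` in
`{1, …, n}`; for labels `a < b`, the value is `2` on edges and `1 + 1 / (n² + a n + b)` on
non-edges. -/
noncomputable def graphMetric {n : ℕ} (Γ : SimpleGraph (Fin n)) (i j : Fin n) : ℝ :=
  if i = j then 0
  else if Γ.Adj i j then 2
  else 1 + 1 / ((n : ℝ) ^ 2 + (((min i j : Fin n) : ℕ) + 1 : ℝ) * n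
    + (((max i j : Fin n) : ℕ) + 1 : ℝ))

/-- The graph consisting of the `⌊n/3⌋` triangles `{1,2,3}, {4,5,6}, …` and `n mod 3`
isolated vertices (labels are `i + 1` for `i : Fin n`). -/
def graphMin (n : ℕ) : SimpleGraph (Fin n) where
  Adj i j := i ≠ j ∧ (i : ℕ) / 3 = (j : ℕ) / 3 ∧
    (n % 3 = 2 → (i : ℕ) + 1 < n ∧ (j : ℕ) + 1 < n)
  symm := ⟨fun _ _ h => ⟨h.1.symm, h.2.1.symm, fun hn => (h.2.2 hn).symm⟩⟩
  loopless := ⟨fun _ h => h.1 rfl⟩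

/-- The metric `d_min` on `n` points. -/
noncomputable def dMin (n : ℕ) : Fin n → Fin n → ℝ :=
  graphMetric (graphMin n)

end TightSpan

/-! A face of `P_d` is determined by the set of pairs `{i,j}` (loops allowed) whose inequality is
tight at a point of its relative interior. Positive dimension and genericity force all distances
between distinct points to be positive (`IsMetric.pos_of_generic`), so every pair defines a facet,
and simplicity makes the functionals `x_i + x_j` of the tight pairs at any point linearly
independent (`IsMetric.free_tight`). Hence a face has dimension `n` minus its number of tight pairs,
every subset of a tight set is again a tight set (`exists_tight_eq`), and a face is bounded iff its
pairs cover all points (`IsMetric.covers_iff`). Faces of `T_d` of dimension `m` are therefore the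
covering tight sets with `n - m` pairs, `coverFaces d m`. For `m ≥ 2` the same sets are the edge
sets of the interior cells of dimension `n - m - 1` (`IsMetric.fVec_interiorCells`).

Lower bound. At a point of `P_d` with minimal coordinate sum, Hall's theorem gives a permutation `σ`
all of whose pairs `{i, σ i}` are tight, and genericity excludes fixed points. Taking alternate
edges along each cycle, with a two-edge path centred at a chosen point of each odd cycle, gives an
edge cover with `(n + #odd cycles) / 2` pairs. Since `dim T_d = ⌈n/3⌉`, no covering tight set is
smaller than `n - ⌈n/3⌉`. As odd cycles have at least three points, this and parity determine the
number of odd cycles: `k`, `k - 1`, `k` for `n = 3k, 3k+1, 3k+2`. The choices of centres give the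
product of the odd cycle lengths as a first count. Further covers come from sliding
(`IsMetric.exists_slide`): lowering the coordinate of `u` and raising the rest of its cycle makes a
pair `{u,t}` tight with `t` in another cycle. If that cycle is a triangle with centre `t`, its path
is replaced by `{u,t}` and the edge opposite `t` (`exchange`). `IsMetric.exchange_bound` counts
these: `3^(k-2)` for each of the `n` points when `n = 3k`, and `3^(k-1)` for each point of the
remaining 2-cycle when `n = 3k+2` and all odd cycles are triangles. If some odd cycle has at least
five points, the product alone gives `5 * 3^(k-1)`.

Sharpness. For `d_min`, genericity says that no point of `P_d` has more than `n` tight pairs. If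
some coordinate is at most `1/16`, the tight pairs are counted triangle by triangle
(`card_tight_le_of_small`). Otherwise the tight pairs between different triangles pairwise cross or
meet, by the strict inequalities `eps_monge` and `eps_nested`, and the thrackle bound applies
(`card_tight_le_of_large`). The covering tight sets of minimal size are then classified
(`structure_dMin`): each triangle carries a two-edge path, except possibly one, which is the first
triangle avoiding some point `z` and is attached to `z` in one forced way. Counting these gives
upper bounds equal to the general lower bounds. -/

namespace TightSpan

/-! ### Polyhedra given by finitely many inequalities: faces, vertices, simplicity. -/

open Filter Topology

/-- The polyhedron cut out by the inequalities `D p ≤ L p x`. -/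
def halfspaces {n : ℕ} {ι : Type*} (L : ι → Module.Dual ℝ (Fin n → ℝ)) (D : ι → ℝ) :
    Set (Fin n → ℝ) :=
  {x | ∀ p, D p ≤ L p x}

open Classical in
/-- The inequalities that hold with equality at `x`. -/
noncomputable def active {n : ℕ} {ι : Type*} [Fintype ι] (L : ι → Module.Dual ℝ (Fin n → ℝ))
    (D : ι → ℝ) (x : Fin n → ℝ) : Finset ι :=
  {p | L p x = D p}

/-- The smallest face containing `x`. -/
def minFace {n : ℕ} {ι : Type*} [Fintype ι] (L : ι → Module.Dual ℝ (Fin n → ℝ))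
    (D : ι → ℝ) (x : Fin n → ℝ) : Set (Fin n → ℝ) :=
  {y ∈ halfspaces L D | active L D x ⊆ active L D y}

/-- The functionals indexed by `S` are linearly independent: they take arbitrary values. -/
def Free {n : ℕ} {ι : Type*} (L : ι → Module.Dual ℝ (Fin n → ℝ)) (S : Finset ι) : Prop :=
  ∀ g : ι → ℝ, ∃ w, ∀ p ∈ S, L p w = g p

/-- The functionals indexed by `S` span the dual space: they have no common zero but `0`. -/
def Spans {n : ℕ} {ι : Type*} (L : ι → Module.Dual ℝ (Fin n → ℝ)) (S : Finset ι) : Prop :=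
  ∀ w, (∀ p ∈ S, L p w = 0) → w = 0

section Functionals

variable {n : ℕ} {ι : Type*} {L : ι → Module.Dual ℝ (Fin n → ℝ)}

lemma Free.mono {S T : Finset ι} (h : Free L T) (hST : S ⊆ T) : Free L S := fun g =>
  let ⟨w, hw⟩ := h g
  ⟨w, fun p hp => hw p (hST hp)⟩

/-- The common kernel of the functionals indexed by `S`. -/
def commonKer (L : ι → Module.Dual ℝ (Fin n → ℝ)) (S : Finset ι) : Submodule ℝ (Fin n → ℝ) :=
  LinearMap.ker (LinearMap.pi fun p : S => L p)

lemma mem_commonKer {S : Finset ι} {w : Fin n → ℝ} :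
    w ∈ commonKer L S ↔ ∀ p ∈ S, L p w = 0 := by
  simp [commonKer, funext_iff]

lemma Free.finrank_commonKer {S : Finset ι} (h : Free L S) :
    Module.finrank ℝ (commonKer L S) + S.card = n := by
  classical
  have hs : Function.Surjective (LinearMap.pi fun p : S => L p) := fun g => by
    obtain ⟨w, hw⟩ := h fun p => if hp : p ∈ S then g ⟨p, hp⟩ else 0
    exact ⟨w, funext fun p => by simp [hw p p.2]⟩
  have h1 := LinearMap.finrank_range_add_finrank_ker (LinearMap.pi fun p : S => L p)
  rw [LinearMap.range_eq_top.2 hs, finrank_top] at h1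
  simp only [Module.finrank_fintype_fun_eq_card, Fintype.card_coe, Fintype.card_fin] at h1
  rw [commonKer]
  omega

lemma Spans.card_le {S : Finset ι} (h : Spans L S) : n ≤ S.card := by
  have hi : Function.Injective (LinearMap.pi fun p : S => L p) := by
    rw [← LinearMap.ker_eq_bot, eq_bot_iff]
    intro w hw
    exact h w (mem_commonKer.1 hw)
  have := LinearMap.finrank_le_finrank_of_injective hi
  simpa using this

lemma Spans.free {S : Finset ι} (h : Spans L S) (hc : S.card ≤ n) : Free L S := by
  have hi : Function.Injective (LinearMap.pi fun p : S => L p) := by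
    rw [← LinearMap.ker_eq_bot, eq_bot_iff]
    intro w hw
    exact h w (mem_commonKer.1 hw)
  have hcard : S.card = n := le_antisymm hc h.card_le
  have hs := (LinearMap.injective_iff_surjective_of_finrank_eq_finrank (by simp [hcard])).1 hi
  intro g
  obtain ⟨w, hw⟩ := hs fun p => g p
  exact ⟨w, fun p hp => congrFun hw ⟨p, hp⟩⟩

end Functionals

section Polyhedra

variable {n : ℕ} {ι : Type*} [Fintype ι] {L : ι → Module.Dual ℝ (Fin n → ℝ)} {D : ι → ℝ}

lemma mem_active {x : Fin n → ℝ} {p : ι} : p ∈ active L D x ↔ L p x = D p := by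
  simp [active]

/-- Inactive inequalities survive a small step by continuity, active ones by the sign of `L p w`;
there are finitely many, so one step size serves all. -/
lemma eventually_move {x w : Fin n → ℝ} (hx : x ∈ halfspaces L D)
    (hw : ∀ p ∈ active L D x, 0 ≤ L p w) :
    ∀ᶠ t in 𝓝[>] (0 : ℝ), x + t • w ∈ halfspaces L D ∧
      ∀ p, p ∈ active L D (x + t • w) ↔ p ∈ active L D x ∧ L p w = 0 := by
  have key : ∀ p, ∀ᶠ t in 𝓝[>] (0 : ℝ), D p ≤ L p (x + t • w) ∧
      (p ∈ active L D (x + t • w) ↔ p ∈ active L D x ∧ L p w = 0) := by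
    intro p
    simp only [mem_active, map_add, map_smul, smul_eq_mul]
    by_cases hp : L p x = D p
    · filter_upwards [self_mem_nhdsWithin] with t ht
      have h0 := hw p (mem_active.2 hp)
      have ht : 0 < t := ht
      refine ⟨by nlinarith [mul_nonneg ht.le h0], ?_⟩
      simp only [hp, true_and, add_eq_left, mul_eq_zero, ht.ne', false_or]
    · have hlt : D p < L p x := lt_of_le_of_ne (hx p) (Ne.symm hp)
      have hc : Tendsto (fun t : ℝ => L p x + t * L p w) (𝓝[>] 0) (𝓝 (L p x + 0 * L p w)) :=
        (Continuous.tendsto (by fun_prop) _).mono_left nhdsWithin_le_nhds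
      have hev := hc.eventually (lt_mem_nhds (a := D p) (by simpa using hlt))
      filter_upwards [hev] with t ht
      exact ⟨ht.le, by simp [hp, ht.ne']⟩
  have := eventually_all.2 key
  filter_upwards [this] with t ht
  exact ⟨fun p => (ht p).1, fun p => (ht p).2⟩

lemma exists_move {x w : Fin n → ℝ} (hx : x ∈ halfspaces L D)
    (hw : ∀ p ∈ active L D x, 0 ≤ L p w) :
    ∃ t : ℝ, 0 < t ∧ x + t • w ∈ halfspaces L D ∧
      ∀ p, p ∈ active L D (x + t • w) ↔ p ∈ active L D x ∧ L p w = 0 := by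
  obtain ⟨t, h1, h2⟩ := ((eventually_move hx hw).and self_mem_nhdsWithin).exists
  exact ⟨t, h2, h1⟩

/-- Independence provides a direction that keeps the inequalities in `S` tight and loosens the other
active ones. -/
lemma exists_active_eq {x : Fin n → ℝ} (hx : x ∈ halfspaces L D) (hfree : Free L (active L D x))
    {S : Finset ι} (hS : S ⊆ active L D x) : ∃ y ∈ halfspaces L D, active L D y = S := by
  classical
  obtain ⟨w, hw⟩ := hfree fun p => if p ∈ S then 0 else 1
  obtain ⟨t, -, h1, h2⟩ := exists_move hx (w := w) fun p hp => by
    rw [hw p hp]; split_ifs <;> norm_num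
  refine ⟨_, h1, Finset.ext fun p => ?_⟩
  rw [h2]
  constructor
  · rintro ⟨hp, h⟩
    by_contra hpS
    rw [hw p hp, if_neg hpS] at h
    norm_num at h
  · intro hp
    exact ⟨hS hp, by rw [hw p (hS hp), if_pos hp]⟩

lemma mem_minFace_self {x : Fin n → ℝ} (hx : x ∈ halfspaces L D) : x ∈ minFace L D x :=
  ⟨hx, subset_rfl⟩

lemma isFace_minFace {x : Fin n → ℝ} (hx : x ∈ halfspaces L D) :
    IsFace (halfspaces L D) (minFace L D x) := by
  refine ⟨⟨x, mem_minFace_self hx⟩, fun _ => ?_⟩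
  -- The sum of the active functionals attains its minimum exactly where each of them does.
  refine ⟨LinearMap.toContinuousLinearMap (-∑ p ∈ active L D x, L p), ?_⟩
  have key : ∀ y ∈ halfspaces L D, ∑ p ∈ active L D x, D p ≤ ∑ p ∈ active L D x, L p y :=
    fun y hy => Finset.sum_le_sum fun p _ => hy p
  have hxs : ∑ p ∈ active L D x, L p x = ∑ p ∈ active L D x, D p :=
    Finset.sum_congr rfl fun p hp => mem_active.1 hp
  ext y
  simp only [minFace, Set.mem_ofPred_eq, LinearMap.coe_toContinuousLinearMap', LinearMap.neg_apply,
    LinearMap.sum_apply, neg_le_neg_iff]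
  refine and_congr_right fun hy => ⟨fun h z hz => ?_, fun h p hp => ?_⟩
  · rw [Finset.sum_congr rfl fun p hp => mem_active.1 (h hp)]
    exact key z hz
  · have h1 := h x hx
    rw [hxs] at h1
    have h2 := le_antisymm (key y hy) h1
    exact mem_active.2 (((Finset.sum_eq_sum_iff_of_le fun p _ => hy p).1 h2 p hp).symm)

lemma IsFace.eq_minFace {F : Set (Fin n → ℝ)} (hF : IsFace (halfspaces L D) F) :
    ∃ x ∈ halfspaces L D, F = minFace L D x := by
  obtain ⟨hne, hexp⟩ := hF
  obtain ⟨l, hl⟩ := hexp hne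
  -- A point of `F` with fewest active inequalities serves as a relative interior point; the
  -- midpoint with any other `y ∈ F` shows that `y` has the same inequalities active.
  obtain ⟨x, hxF, hmin⟩ : ∃ x ∈ F, ∀ y ∈ F, (active L D x).card ≤ (active L D y).card := by
    obtain ⟨x, hx, h⟩ := WellFounded.has_min (measure fun y : Fin n → ℝ =>
      (active L D y).card).wf F hne
    exact ⟨x, hx, fun y hy => not_lt.1 (h y hy)⟩
  have hxF' := hxF
  rw [hl] at hxF'
  obtain ⟨hxP, hxmax⟩ := hxF'
  refine ⟨x, hxP, Set.Subset.antisymm ?_ ?_⟩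
  · intro y hy
    have hy' := hy
    rw [hl] at hy'
    obtain ⟨hyP, hymax⟩ := hy'
    refine ⟨hyP, ?_⟩
    set z : Fin n → ℝ := (1 / 2 : ℝ) • x + (1 / 2 : ℝ) • y with hz
    have hLz : ∀ p, L p z = (L p x + L p y) / 2 := fun p => by
      simp only [hz, map_add, map_smul, smul_eq_mul]; ring
    have hlz : l z = (l x + l y) / 2 := by
      simp only [hz, map_add, map_smul, smul_eq_mul]; ring
    have hzF : z ∈ F := by
      rw [hl]
      refine ⟨fun p => ?_, fun u hu => ?_⟩
      · have := hxP p; have := hyP p; rw [hLz]; linarith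
      · have := hxmax u hu; have := hymax u hu; rw [hlz]; linarith
    have hsub : ∀ p ∈ active L D z, p ∈ active L D x ∧ p ∈ active L D y := fun p hp => by
      rw [mem_active, hLz] at hp
      have := hxP p; have := hyP p
      exact ⟨mem_active.2 (by linarith), mem_active.2 (by linarith)⟩
    have heq : active L D z = active L D x :=
      Finset.eq_of_subset_of_card_le (fun p hp => (hsub p hp).1) (hmin z hzF)
    intro p hp
    rw [← heq] at hp
    exact (hsub p hp).2
  · rintro y ⟨hyP, hy⟩
    rw [hl]
    -- Extending the segment from `y` beyond `x` stays in the polyhedron, so maximality of `l` at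
    -- `x` gives `l x ≤ l y`.
    obtain ⟨t, ht, h1, -⟩ := exists_move hxP (w := x - y) fun p hp => by
      rw [map_sub, mem_active.1 hp, mem_active.1 (hy hp), sub_self]
    have h2 := hxmax _ h1
    simp only [map_add, map_smul, map_sub, smul_eq_mul] at h2
    have h3 : l x ≤ l y := by nlinarith
    exact ⟨hyP, fun u hu => (hxmax u hu).trans h3⟩

lemma minFace_eq_iff {x y : Fin n → ℝ} (hx : x ∈ halfspaces L D) (hy : y ∈ halfspaces L D) :
    minFace L D x = minFace L D y ↔ active L D x = active L D y := by
  refine ⟨fun h => ?_, fun h => by simp only [minFace, h]⟩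
  have h1 : x ∈ minFace L D y := h ▸ mem_minFace_self hx
  have h2 : y ∈ minFace L D x := h ▸ mem_minFace_self hy
  exact Finset.Subset.antisymm h2.2 h1.2

lemma vectorSpan_minFace {x : Fin n → ℝ} (hx : x ∈ halfspaces L D) :
    vectorSpan ℝ (minFace L D x) = commonKer L (active L D x) := by
  apply le_antisymm
  · rw [vectorSpan_def, Submodule.span_le]
    rintro _ ⟨y, hy, z, hz, rfl⟩
    refine mem_commonKer.2 fun p hp => ?_
    have h1 := mem_active.1 (hy.2 hp)
    have h2 := mem_active.1 (hz.2 hp)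
    simp [h1, h2]
  · intro w hw
    rw [mem_commonKer] at hw
    obtain ⟨t, ht, h1, h2⟩ := exists_move hx (w := w) fun p hp => (hw p hp).ge
    have h3 : x + t • w ∈ minFace L D x := ⟨h1, fun p hp => (h2 p).2 ⟨hp, hw p hp⟩⟩
    have h4 := vsub_mem_vectorSpan ℝ h3 (mem_minFace_self hx)
    have h5 : w = t⁻¹ • ((x + t • w) -ᵥ x) := by
      simp [smul_smul, ht.ne']
    rw [h5]
    exact Submodule.smul_mem _ _ h4

lemma faceDim_minFace {x : Fin n → ℝ} (hx : x ∈ halfspaces L D) (h : Free L (active L D x)) :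
    faceDim (minFace L D x) + (active L D x).card = n := by
  rw [faceDim, vectorSpan_minFace hx]
  exact h.finrank_commonKer

/-- A point of the minimal face with a maximal number of active inequalities works: if they did not
span, one could move along a common zero `w` of the active functionals until a further inequality
becomes tight. -/
lemma exists_vertex (hspan : Spans L Finset.univ) {x : Fin n → ℝ} (hx : x ∈ halfspaces L D) :
    ∃ v ∈ halfspaces L D, active L D x ⊆ active L D v ∧ Spans L (active L D v) := by
  obtain ⟨v, ⟨hvP, hxv⟩, hmax⟩ : ∃ v ∈ minFace L D x, ∀ y ∈ minFace L D x,
      (active L D y).card ≤ (active L D v).card := by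
    obtain ⟨v, hv, h⟩ := WellFounded.has_min (measure fun y : Fin n → ℝ =>
      Fintype.card ι - (active L D y).card).wf _ ⟨x, mem_minFace_self hx⟩
    refine ⟨v, hv, fun y hy => ?_⟩
    have h1 := h y hy
    have h2 := (active L D y).card_le_univ
    have h3 := (active L D v).card_le_univ
    change ¬ (Fintype.card ι - (active L D y).card < Fintype.card ι - (active L D v).card) at h1
    omega
  refine ⟨v, hvP, hxv, ?_⟩
  by_contra hns
  simp only [Spans, not_forall] at hns
  obtain ⟨w, hw, hw0⟩ := hns
  obtain ⟨w, hw, p₀, hp₀⟩ : ∃ w, (∀ p ∈ active L D v, L p w = 0) ∧ ∃ p, L p w < 0 := by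
    obtain ⟨p, hp⟩ : ∃ p, L p w ≠ 0 := by
      by_contra! h
      exact hw0 (hspan w fun p _ => h p)
    rcases lt_or_gt_of_ne hp with h | h
    · exact ⟨w, hw, p, h⟩
    · exact ⟨-w, fun p hp => by simp [hw p hp], p, by simpa using h⟩
  classical
  -- Ratio test: `q` is the first inequality met in direction `w`.
  obtain ⟨q, hq, hqmin⟩ := Finset.exists_min_image (Finset.univ.filter fun p => L p w < 0)
    (fun p => (L p v - D p) / (-L p w)) ⟨p₀, by simpa using hp₀⟩
  simp only [Finset.mem_filter, Finset.mem_univ, true_and] at hq hqmin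
  set t := (L q v - D q) / (-L q w) with ht
  have ht0 : 0 ≤ t := div_nonneg (sub_nonneg.2 (hvP q)) (by linarith)
  have hyP : v + t • w ∈ halfspaces L D := by
    intro p
    rw [map_add, map_smul, smul_eq_mul]
    rcases lt_or_ge (L p w) 0 with h | h
    · have := hqmin p h
      rw [le_div_iff₀ (by linarith)] at this
      linarith
    · have := hvP p
      have := mul_nonneg ht0 h
      linarith
  have hsub : active L D v ⊆ active L D (v + t • w) := fun p hp => by
    rw [mem_active, map_add, map_smul, hw p hp, mem_active.1 hp]; simp
  have hqa : q ∈ active L D (v + t • w) := by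
    rw [mem_active, map_add, map_smul, smul_eq_mul, ht]
    have : -L q w ≠ 0 := by linarith
    have h2 : L q w ≠ 0 := by linarith
    field_simp
    ring
  have hle := hmax _ ⟨hyP, hxv.trans hsub⟩
  have hEq := Finset.eq_of_subset_of_card_le hsub hle
  rw [← hEq] at hqa
  have := hw q hqa
  linarith

lemma isFace_singleton_iff {v : Fin n → ℝ} :
    IsFace (halfspaces L D) {v} ↔ v ∈ halfspaces L D ∧ Spans L (active L D v) := by
  constructor
  · intro h
    obtain ⟨x, hx, hxe⟩ := h.eq_minFace
    have hxv : x = v := by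
      have := mem_minFace_self hx
      rw [← hxe] at this
      exact this
    subst hxv
    refine ⟨hx, fun w hw => ?_⟩
    have h1 := vectorSpan_minFace hx
    rw [← hxe, vectorSpan_singleton] at h1
    have : w ∈ commonKer L (active L D x) := mem_commonKer.2 hw
    rw [← h1] at this
    simpa using this
  · rintro ⟨hv, hs⟩
    convert isFace_minFace hv using 1
    refine Set.Subset.antisymm (by rintro _ rfl; exact mem_minFace_self hv) ?_
    rintro y ⟨-, hy⟩
    have := hs (y - v) fun p hp => by
      rw [map_sub, mem_active.1 hp, mem_active.1 (hy hp), sub_self]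
    exact sub_eq_zero.1 this

lemma faceDim_halfspaces {x : Fin n → ℝ} (hx : x ∈ halfspaces L D) (h : active L D x = ∅) :
    faceDim (halfspaces L D) = n := by
  have h1 : minFace L D x = halfspaces L D := by simp [minFace, h]
  have h2 := faceDim_minFace hx (by intro g; exact ⟨0, by simp [h]⟩)
  rw [h1, h] at h2
  simpa using h2

lemma isFacet_minFace {x₀ x : Fin n → ℝ} (hx₀ : x₀ ∈ halfspaces L D) (h₀ : active L D x₀ = ∅)
    (hx : x ∈ halfspaces L D) {p : ι} (h : active L D x = {p}) (hp : L p ≠ 0) :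
    IsFacet (halfspaces L D) (minFace L D x) := by
  refine ⟨isFace_minFace hx, ?_⟩
  rw [faceDim_halfspaces hx₀ h₀]
  have := faceDim_minFace hx (by
    intro g
    obtain ⟨w, hw⟩ : ∃ w, L p w ≠ 0 := by
      by_contra! h
      exact hp (LinearMap.ext h)
    refine ⟨(g p / L p w) • w, fun q hq => ?_⟩
    rw [h, Finset.mem_singleton] at hq
    subst hq
    simp [hw])
  rwa [h, Finset.card_singleton] at this

/-- At a vertex of a simple polyhedron the number of facet-defining active inequalities is at
most the dimension. -/
lemma IsSimplePolyhedron.card_le (hn : 0 < n) (hsimple : IsSimplePolyhedron (halfspaces L D))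
    {x₀ : Fin n → ℝ} (hx₀ : x₀ ∈ halfspaces L D) (h₀ : active L D x₀ = ∅)
    {v : Fin n → ℝ} (hv : v ∈ halfspaces L D) (hspan : Spans L (active L D v))
    {S : Finset ι} (hS : S ⊆ active L D v) (hL : ∀ p ∈ S, L p ≠ 0)
    (hfacet : ∀ p ∈ S, ∃ x ∈ halfspaces L D, active L D x = {p}) : S.card ≤ n := by
  have h1 := hsimple v (isFace_singleton_iff.2 ⟨hv, hspan⟩)
  rw [faceDim_halfspaces hx₀ h₀] at h1
  choose! f hfP hf using hfacet
  have hfin : {F | IsFacet (halfspaces L D) F ∧ v ∈ F}.Finite :=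
    Set.finite_of_ncard_pos (by omega)
  rw [← h1, ← Set.ncard_coe_finset]
  refine Set.ncard_le_ncard_of_injOn (fun p => minFace L D (f p)) (fun p hp => ?_) ?_ hfin
  · refine ⟨isFacet_minFace hx₀ h₀ (hfP p hp) (hf p hp) (hL p hp), hv, ?_⟩
    rw [hf p hp, Finset.singleton_subset_iff]
    exact hS hp
  · intro p hp q hq hpq
    have := (minFace_eq_iff (hfP p hp) (hfP q hq)).1 hpq
    rw [hf p hp, hf q hq] at this
    simpa using this

/-- At a vertex the active functionals span, so if there are at most `n` they form a basis. Each can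
then be made the only active one, so the facets through the vertex correspond to the active
inequalities. -/
lemma isSimplePolyhedron_of_card_le {x₀ : Fin n → ℝ} (hx₀ : x₀ ∈ halfspaces L D)
    (h₀ : active L D x₀ = ∅)
    (h : ∀ v ∈ halfspaces L D, Spans L (active L D v) → (active L D v).card ≤ n) :
    IsSimplePolyhedron (halfspaces L D) := by
  intro v hface
  obtain ⟨hv, hspan⟩ := isFace_singleton_iff.1 hface
  have hfree := hspan.free (h v hv hspan)
  rw [faceDim_halfspaces hx₀ h₀]
  have hcard : (active L D v).card = n := le_antisymm (h v hv hspan) hspan.card_le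
  have hex : ∀ p ∈ active L D v, ∃ x ∈ halfspaces L D, active L D x = {p} := fun p hp =>
    exists_active_eq hv hfree (by simpa using hp)
  choose! f hfP hf using hex
  have himage : {F | IsFacet (halfspaces L D) F ∧ v ∈ F} =
      (fun p => minFace L D (f p)) '' (active L D v : Set ι) := by
    ext F
    simp only [Set.mem_ofPred_eq, Set.mem_image]
    constructor
    · rintro ⟨⟨hF, hdim⟩, hvF⟩
      obtain ⟨x, hx, rfl⟩ := hF.eq_minFace
      have h1 := faceDim_minFace hx (hfree.mono hvF.2)
      rw [faceDim_halfspaces hx₀ h₀] at hdim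
      obtain ⟨p, hp⟩ := Finset.card_eq_one.1 (show (active L D x).card = 1 by omega)
      have hpv : p ∈ active L D v := hvF.2 (by simp [hp])
      exact ⟨p, hpv, (minFace_eq_iff (hfP p hpv) hx).2 (by rw [hf p hpv, hp])⟩
    · rintro ⟨p, hp, rfl⟩
      refine ⟨isFacet_minFace hx₀ h₀ (hfP p hp) (hf p hp) ?_, hv, ?_⟩
      · intro h0
        obtain ⟨w, hw⟩ := hfree fun _ => 1
        have := hw p hp
        simp [h0] at this
      · rw [hf p hp, Finset.singleton_subset_iff]; exact hp
  rw [himage, Set.InjOn.ncard_image, Set.ncard_coe_finset, hcard]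
  intro p hp q hq hpq
  have := (minFace_eq_iff (hfP p hp) (hfP q hq)).1 hpq
  rw [hf p hp, hf q hq] at this
  simpa using this

end Polyhedra

end TightSpan

/-! ### Tight pairs of a metric and the faces of the tight span. -/

namespace TightSpan

open Filter Topology

/-- The functional `x ↦ x i + x j` of an unordered pair `s(i, j)`. -/
def pairSum {n : ℕ} : Sym2 (Fin n) → Module.Dual ℝ (Fin n → ℝ) :=
  Sym2.lift ⟨fun i j => LinearMap.proj i + LinearMap.proj j, fun _ _ => add_comm _ _⟩

/-- The value of `d` on unordered pairs. -/
noncomputable def pairDist {n : ℕ} (d : Fin n → Fin n → ℝ) : Sym2 (Fin n) → ℝ :=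
  Sym2.lift ⟨fun i j => max (d i j) (d j i), fun _ _ => max_comm _ _⟩

/-- The pairs `s(i, j)` with `x i + x j = d i j`. -/
noncomputable def tight {n : ℕ} (d : Fin n → Fin n → ℝ) (x : Fin n → ℝ) : Finset (Sym2 (Fin n)) :=
  active pairSum (pairDist d) x

/-- A set of pairs covers the points if each point lies in one of the pairs. -/
def Covers {n : ℕ} (S : Finset (Sym2 (Fin n))) : Prop :=
  ∀ i, ∃ p ∈ S, i ∈ p

/-- The covering sets of `n - k` pairs which are the tight pairs of a point of `P_d`. -/
def coverFaces {n : ℕ} (d : Fin n → Fin n → ℝ) (k : ℕ) : Set (Finset (Sym2 (Fin n))) :=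
  {S | Covers S ∧ S.card + k = n ∧ ∃ x ∈ polyhedron d, tight d x = S}

section Metric

variable {n : ℕ} {d : Fin n → Fin n → ℝ}

@[simp] lemma pairSum_mk (i j : Fin n) (x : Fin n → ℝ) : pairSum s(i, j) x = x i + x j := rfl

lemma pairDist_mk (i j : Fin n) : pairDist d s(i, j) = max (d i j) (d j i) := rfl

lemma polyhedron_eq_halfspaces : polyhedron d = halfspaces pairSum (pairDist d) := by
  ext x
  simp only [polyhedron, halfspaces, Set.mem_ofPred_eq]
  constructor
  · intro h p
    induction p using Sym2.ind with
    | _ i j => exact max_le (h i j) (by rw [pairSum_mk, add_comm]; exact h j i)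
  · intro h i j
    exact (le_max_left _ _).trans (h s(i, j))

lemma IsMetric.mem_tight (hd : IsMetric d) {x : Fin n → ℝ} {i j : Fin n} :
    s(i, j) ∈ tight d x ↔ x i + x j = d i j := by
  rw [tight, mem_active, pairDist_mk, hd.symm j i, max_self, pairSum_mk]

lemma IsMetric.polyhedron_nonneg (hd : IsMetric d) {x : Fin n → ℝ} (hx : x ∈ polyhedron d)
    (i : Fin n) : 0 ≤ x i := by
  have := hx i i
  rw [hd.diag] at this
  linarith

lemma IsMetric.mem_polyhedron_self (hd : IsMetric d) (i : Fin n) : d i ∈ polyhedron d :=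
  fun j k => (hd.triangle j i k).trans_eq (by rw [hd.symm j i])

lemma spans_univ : Spans (pairSum (n := n)) Finset.univ := by
  intro w hw
  ext i
  have := hw s(i, i) (Finset.mem_univ _)
  simpa using this

lemma exists_gt_dist (d : Fin n → Fin n → ℝ) : ∃ C : ℝ, 0 < C ∧ ∀ i j, d i j < C := by
  obtain ⟨C, hC⟩ := (Set.finite_range fun p : Fin n × Fin n => d p.1 p.2).bddAbove
  refine ⟨max C 0 + 1, by positivity, fun i j => ?_⟩
  have := hC ⟨(i, j), rfl⟩
  have h2 := le_max_left C 0
  simp only at this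
  linarith

lemma IsMetric.exists_tight_eq_empty (hd : IsMetric d) : ∃ x ∈ polyhedron d, tight d x = ∅ := by
  obtain ⟨C, hC, h⟩ := exists_gt_dist d
  refine ⟨fun _ => C, fun i j => by have := h i j; linarith, Finset.eq_empty_of_forall_notMem ?_⟩
  intro p
  induction p using Sym2.ind with
  | _ i j => rw [hd.mem_tight]; have := h i j; intro; linarith

/-- These pairs define facets: the witness is `d i j / 2` at `i` and `j` and a large constant
elsewhere. For distinct points at distance zero it would also make the loops tight. -/
lemma IsMetric.exists_tight_eq_singleton (hd : IsMetric d) (i j : Fin n)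
    (hij : i = j ∨ 0 < d i j) : ∃ x ∈ polyhedron d, tight d x = {s(i, j)} := by
  obtain ⟨C, hC, h⟩ := exists_gt_dist d
  have hdij : 0 ≤ d i j := hd.nonneg i j
  have key : ∀ a b, (s(a, b) = s(i, j) ∧ (if a = i ∨ a = j then d i j / 2 else C) +
        (if b = i ∨ b = j then d i j / 2 else C) = d a b) ∨
      (s(a, b) ≠ s(i, j) ∧ d a b < (if a = i ∨ a = j then d i j / 2 else C) +
        (if b = i ∨ b = j then d i j / 2 else C)) := by
    intro a b
    have hab := h a b
    have hsymm := hd.symm i j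
    have h1 := hd.diag i
    have h2 := hd.diag j
    by_cases ha : a = i ∨ a = j
    · by_cases hb : b = i ∨ b = j
      · rw [if_pos ha, if_pos hb]
        rcases ha with rfl | rfl <;> rcases hb with rfl | rfl
        · rcases hij with rfl | hij
          · left; exact ⟨rfl, by linarith⟩
          · right
            refine ⟨fun he => ?_, by linarith⟩
            simp only [Sym2.eq_iff] at he
            have : b = j := by tauto
            subst this; linarith
        · left; exact ⟨rfl, by linarith⟩
        · left; exact ⟨Sym2.eq_swap, by linarith⟩
        · rcases hij with rfl | hij
          · left; exact ⟨rfl, by linarith⟩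
          · right
            refine ⟨fun he => ?_, by linarith⟩
            simp only [Sym2.eq_iff] at he
            have : b = i := by tauto
            subst this; linarith
      · right
        rw [if_pos ha, if_neg hb]
        refine ⟨fun he => hb ?_, by linarith⟩
        simp only [Sym2.eq_iff] at he; tauto
    · right
      rw [if_neg ha]
      refine ⟨fun he => ha ?_, by split_ifs <;> linarith⟩
      simp only [Sym2.eq_iff] at he; tauto
  refine ⟨fun a => if a = i ∨ a = j then d i j / 2 else C, fun a b => ?_, Finset.ext fun p => ?_⟩
  · rcases key a b with h | h
    · exact h.2.ge
    · exact h.2.le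
  · induction p using Sym2.ind with
    | _ a b =>
      rw [hd.mem_tight, Finset.mem_singleton]
      rcases key a b with h | h
      · simp [h.1, h.2]
      · simp only [h.1, iff_false]
        exact h.2.ne'

lemma pairSum_ne_zero (p : Sym2 (Fin n)) : pairSum p ≠ 0 := by
  induction p using Sym2.ind with
  | _ i j =>
    intro h
    have := LinearMap.congr_fun h fun _ => 1
    rw [pairSum_mk] at this
    norm_num at this

/-- `S` consists of facet-defining tight pairs, so simplicity bounds its size by `n`. It still
spans: a tight pair at distance zero has both coordinates zero, so its functional is half the sum of
those of two tight loops. -/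
lemma IsMetric.free_positive (hd : IsMetric d) (hn : 0 < n) (hg : IsGeneric d) {v : Fin n → ℝ}
    (hv : v ∈ polyhedron d) (hspan : Spans pairSum (tight d v)) {S : Finset (Sym2 (Fin n))}
    (hS : ∀ i j, s(i, j) ∈ S ↔ s(i, j) ∈ tight d v ∧ (i = j ∨ 0 < d i j)) : Free pairSum S := by
  have hspanS : Spans pairSum S := by
    intro w hw
    have hdiag : ∀ i, v i = 0 → w i = 0 := fun i hi => by
      have := hw s(i, i) ((hS i i).2 ⟨hd.mem_tight.2 (by rw [hi, hd.diag]; simp), Or.inl rfl⟩)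
      rw [pairSum_mk] at this
      linarith
    refine hspan w fun p hp => ?_
    induction p using Sym2.ind with
    | _ i j =>
      by_cases hij : i = j ∨ 0 < d i j
      · exact hw _ ((hS i j).2 ⟨hp, hij⟩)
      · have h0 : d i j = 0 := le_antisymm (not_lt.1 fun h => hij (Or.inr h)) (hd.nonneg i j)
        have h1 := hd.mem_tight.1 hp
        have h2 := hd.polyhedron_nonneg hv i
        have h3 := hd.polyhedron_nonneg hv j
        rw [pairSum_mk, hdiag i (by linarith), hdiag j (by linarith), add_zero]
  refine hspanS.free ?_
  obtain ⟨x₀, hx₀, h₀⟩ := hd.exists_tight_eq_empty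
  rw [IsGeneric, polyhedron_eq_halfspaces] at hg
  rw [polyhedron_eq_halfspaces] at hx₀ hv
  refine hg.card_le hn hx₀ h₀ hv hspan (S := S) ?_ (fun p _ => pairSum_ne_zero p) ?_
  · intro p hp
    induction p using Sym2.ind with
    | _ i j => exact ((hS i j).1 hp).1
  · intro p hp
    induction p using Sym2.ind with
    | _ i j =>
      obtain ⟨x, hx, h⟩ := hd.exists_tight_eq_singleton i j ((hS i j).1 hp).2
      rw [polyhedron_eq_halfspaces] at hx
      exact ⟨x, hx, h⟩

lemma IsMetric.spans_tight_self (hd : IsMetric d) (i : Fin n) :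
    Spans pairSum (tight d (d i)) := by
  intro w hw
  have h : ∀ j, w i + w j = 0 := fun j => by
    have := hw s(i, j) (hd.mem_tight.2 (by rw [hd.diag, zero_add]))
    simpa using this
  have hi := h i
  ext j
  have hj := h j
  simp only [Pi.zero_apply]
  linarith

lemma tightSpan_eq_minFace {F : Set (Fin n → ℝ)} (hF : F ∈ tightSpan d) :
    ∃ x ∈ polyhedron d, F = {y ∈ polyhedron d | tight d x ⊆ tight d y} := by
  have h := hF.1
  rw [polyhedron_eq_halfspaces] at h ⊢
  exact h.eq_minFace

/-- An uncovered coordinate can be raised without limit, while a covered one is at most the distance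
in its tight pair because the partner is non-negative. -/
lemma IsMetric.covers_iff (hd : IsMetric d) {x : Fin n → ℝ} (hx : x ∈ polyhedron d) :
    Bornology.IsBounded {y ∈ polyhedron d | tight d x ⊆ tight d y} ↔ Covers (tight d x) := by
  constructor
  · intro hb
    by_contra hc
    simp only [Covers, not_forall] at hc
    obtain ⟨i, hi⟩ := hc
    push Not at hi
    obtain ⟨C, hC⟩ := hb.exists_norm_le
    have hmem : x + Pi.single i (C + 1 : ℝ) ∈
        {y ∈ polyhedron d | tight d x ⊆ tight d y} := by
      have hC0 : 0 ≤ C := (norm_nonneg x).trans (hC x ⟨hx, subset_rfl⟩)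
      refine ⟨fun a b => ?_, fun p hp => ?_⟩
      · have := hx a b
        simp only [Pi.add_apply, Pi.single_apply]
        split_ifs <;> linarith
      · have hip := hi p hp
        induction p using Sym2.ind with
        | _ a b =>
          rw [hd.mem_tight] at hp ⊢
          simp only [Sym2.mem_iff, not_or] at hip
          simp [hp, Ne.symm hip.1, Ne.symm hip.2]
    have h1 := hC _ hmem
    have h2 := (norm_le_pi_norm (x + Pi.single i (C + 1 : ℝ)) i).trans h1
    have h3 := hd.polyhedron_nonneg hx i
    rw [Pi.add_apply, Pi.single_eq_same, Real.norm_eq_abs] at h2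
    have := le_abs_self (x i + (C + 1))
    linarith
  · intro hc
    obtain ⟨C, hC, h⟩ := exists_gt_dist d
    rw [isBounded_iff_forall_norm_le]
    refine ⟨C, fun y hy => (pi_norm_le_iff_of_nonneg hC.le).2 fun i => ?_⟩
    obtain ⟨p, hp, hip⟩ := hc i
    obtain ⟨j, rfl⟩ := Sym2.mem_iff_exists.1 hip
    have h1 := hd.mem_tight.1 (hy.2 hp)
    have h2 := h i j
    have h3 := hd.polyhedron_nonneg hy.1 i
    have h4 := hd.polyhedron_nonneg hy.1 j
    rw [Real.norm_eq_abs, abs_of_nonneg h3]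
    linarith

/-- If `d i j = 0` and some `k` is at positive distance from `i`, four facet-defining pairs are
tight at the vertex `d i`: `ii`, `jj`, `ik`, `jk`. They are dependent, since `ii - jj = 2 (ik -
jk)`. If no such `k` exists, `d = 0` and the tight span is a point. -/
lemma IsMetric.pos_of_generic (hd : IsMetric d) (hn : 0 < n) (hg : IsGeneric d) {m : ℕ}
    (hm : 0 < m) (hdim : HasDim (tightSpan d) m) {i j : Fin n} (hij : i ≠ j) : 0 < d i j := by
  classical
  by_contra hpos
  have h0 : d i j = 0 := le_antisymm (not_lt.1 hpos) (hd.nonneg i j)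
  by_cases hall : ∀ k, d i k = 0
  · have hz : ∀ a b, d a b = 0 := fun a b => by
      have := hd.triangle a i b
      rw [hd.symm a i, hall, hall, add_zero] at this
      exact le_antisymm this (hd.nonneg a b)
    obtain ⟨F, hF, hFm⟩ := hdim.1
    obtain ⟨x, hx, rfl⟩ := tightSpan_eq_minFace hF
    have hc := (hd.covers_iff hx).1 hF.2
    have hsub : {y ∈ polyhedron d | tight d x ⊆ tight d y}.Subsingleton := by
      have hy0 : ∀ y ∈ {y ∈ polyhedron d | tight d x ⊆ tight d y}, y = 0 := by
        intro y hy
        ext a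
        obtain ⟨p, hp, hap⟩ := hc a
        obtain ⟨b, rfl⟩ := Sym2.mem_iff_exists.1 hap
        have h1 := hd.mem_tight.1 (hy.2 hp)
        rw [hz] at h1
        have h3 := hd.polyhedron_nonneg hy.1 a
        have h4 := hd.polyhedron_nonneg hy.1 b
        simp only [Pi.zero_apply]
        linarith
      intro y hy z hz
      rw [hy0 y hy, hy0 z hz]
    rw [faceDim, vectorSpan_of_subsingleton ℝ hsub, finrank_bot] at hFm
    omega
  · push Not at hall
    obtain ⟨k, hk⟩ := hall
    have hkpos : 0 < d i k := lt_of_le_of_ne (hd.nonneg i k) (Ne.symm hk)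
    have hjk : d j k = d i k := by
      have h1 := hd.triangle i j k
      have h2 := hd.triangle j i k
      rw [hd.symm j i] at h2
      linarith
    set S : Finset (Sym2 (Fin n)) := (tight d (d i)).filter
      fun p => p.IsDiag ∨ 0 < pairDist d p with hSdef
    have hS : ∀ a b, s(a, b) ∈ S ↔ s(a, b) ∈ tight d (d i) ∧ (a = b ∨ 0 < d a b) := by
      intro a b
      rw [hSdef, Finset.mem_filter, Sym2.mk_isDiag_iff, pairDist_mk, hd.symm b a, max_self]
    have hfree := hd.free_positive hn hg (hd.mem_polyhedron_self i) (hd.spans_tight_self i) hS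
    obtain ⟨w, hw⟩ := hfree fun p => if p = s(i, k) then 1 else 0
    have hik : i ≠ k := by rintro rfl; rw [hd.diag] at hkpos; exact lt_irrefl _ hkpos
    have hjk' : j ≠ k := by rintro rfl; rw [hd.diag] at hjk; linarith
    have e1 := hw s(i, i) ((hS _ _).2 ⟨hd.mem_tight.2 (by simp [hd.diag]), Or.inl rfl⟩)
    have e2 := hw s(j, j) ((hS _ _).2 ⟨hd.mem_tight.2 (by simp [hd.diag, h0]), Or.inl rfl⟩)
    have e3 := hw s(i, k) ((hS _ _).2 ⟨hd.mem_tight.2 (by simp [hd.diag]), Or.inr hkpos⟩)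
    have e4 := hw s(j, k) ((hS _ _).2 ⟨hd.mem_tight.2 (by simp [h0, hjk]), Or.inr (hjk ▸ hkpos)⟩)
    simp only [pairSum_mk, Sym2.eq_iff] at e1 e2 e3 e4
    simp [hik, hij.symm, hjk'] at e1 e2 e3 e4
    linarith

/-- Every tight set is contained in that of a vertex, and with positive distances all tight pairs
there define facets. -/
lemma IsMetric.free_tight (hd : IsMetric d) (hn : 0 < n) (hg : IsGeneric d)
    (hpos : ∀ i j, i ≠ j → 0 < d i j) {x : Fin n → ℝ} (hx : x ∈ polyhedron d) :
    Free pairSum (tight d x) := by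
  rw [polyhedron_eq_halfspaces] at hx
  obtain ⟨v, hv, hxv, hspan⟩ := exists_vertex spans_univ hx
  rw [← polyhedron_eq_halfspaces] at hv
  refine (hd.free_positive hn hg hv hspan (S := tight d v) fun i j => ?_).mono hxv
  have := hpos i j
  tauto

lemma exists_tight_eq (hfree : ∀ x ∈ polyhedron d, Free pairSum (tight d x)) {x : Fin n → ℝ}
    (hx : x ∈ polyhedron d) {S : Finset (Sym2 (Fin n))} (hS : S ⊆ tight d x) :
    ∃ y ∈ polyhedron d, tight d y = S := by
  have h := hfree x hx
  rw [polyhedron_eq_halfspaces] at hx ⊢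
  exact exists_active_eq hx h hS

lemma faceDim_tight (hfree : ∀ x ∈ polyhedron d, Free pairSum (tight d x)) {x : Fin n → ℝ}
    (hx : x ∈ polyhedron d) :
    faceDim {y ∈ polyhedron d | tight d x ⊆ tight d y} + (tight d x).card = n := by
  have h := hfree x hx
  rw [polyhedron_eq_halfspaces] at hx ⊢
  exact faceDim_minFace hx h

lemma IsMetric.mem_tightSpan (hd : IsMetric d) {x : Fin n → ℝ} (hx : x ∈ polyhedron d)
    (hc : Covers (tight d x)) : {y ∈ polyhedron d | tight d x ⊆ tight d y} ∈ tightSpan d := by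
  refine ⟨?_, (hd.covers_iff hx).2 hc⟩
  rw [polyhedron_eq_halfspaces] at hx ⊢
  exact isFace_minFace hx

lemma IsMetric.fVec_tightSpan (hd : IsMetric d)
    (hfree : ∀ x ∈ polyhedron d, Free pairSum (tight d x)) (k : ℕ) :
    fVec (tightSpan d) k = (coverFaces d k).ncard := by
  rw [fVec]
  have himage : {F ∈ tightSpan d | faceDim F = k} =
      (fun S => {y ∈ polyhedron d | S ⊆ tight d y}) '' coverFaces d k := by
    ext F
    constructor
    · rintro ⟨hF, hk⟩
      obtain ⟨x, hx, rfl⟩ := tightSpan_eq_minFace hF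
      refine ⟨tight d x, ⟨(hd.covers_iff hx).1 hF.2, ?_, x, hx, rfl⟩, rfl⟩
      have := faceDim_tight hfree hx
      omega
    · rintro ⟨S, ⟨hc, hk, x, hx, rfl⟩, rfl⟩
      refine ⟨hd.mem_tightSpan hx hc, ?_⟩
      have := faceDim_tight hfree hx
      dsimp only
      omega
  rw [himage, Set.InjOn.ncard_image]
  rintro S ⟨-, -, x, hx, rfl⟩ S' ⟨-, -, x', hx', rfl⟩ h
  rw [polyhedron_eq_halfspaces] at hx hx' h
  exact (minFace_eq_iff hx hx').1 h

lemma IsMetric.card_of_hasDim (hd : IsMetric d)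
    (hfree : ∀ x ∈ polyhedron d, Free pairSum (tight d x)) {m : ℕ}
    (hdim : HasDim (tightSpan d) m) {x : Fin n → ℝ} (hx : x ∈ polyhedron d)
    (hc : Covers (tight d x)) : n ≤ (tight d x).card + m := by
  have h1 := hdim.2 ⟨_, hd.mem_tightSpan hx hc, rfl⟩
  have h2 := faceDim_tight hfree hx
  omega

end Metric

end TightSpan

/-! ### Interior cells of the hypersimplex subdivision as covering tight sets. -/

namespace TightSpan

/-- The vertex `e_i + e_j` of the hypersimplex. -/
def pairVec {n : ℕ} : Sym2 (Fin n) → Fin n → ℝ :=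
  Sym2.lift ⟨fun i j => Pi.single i 1 + Pi.single j 1, fun _ _ => add_comm _ _⟩

section Cells

variable {n : ℕ} {d : Fin n → Fin n → ℝ}

lemma pairVec_mk (i j : Fin n) : pairVec s(i, j) = Pi.single i (1 : ℝ) + Pi.single j 1 := rfl

lemma pairVec_dotProduct (p : Sym2 (Fin n)) (w : Fin n → ℝ) :
    ∑ i, pairVec p i * w i = pairSum p w := by
  induction p using Sym2.ind with
  | _ i j => simp [pairVec_mk, add_mul, Finset.sum_add_distrib, Pi.single_apply]

lemma dual_pairVec (l : Module.Dual ℝ (Fin n → ℝ)) (i j : Fin n) :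
    l (pairVec s(i, j)) = l (Pi.single i 1) + l (Pi.single j 1) := by
  rw [pairVec_mk, map_add]

lemma edgePolytope_eq (Γ : SimpleGraph (Fin n)) :
    edgePolytope Γ = convexHull ℝ (pairVec '' Γ.edgeSet) := by
  rw [edgePolytope]
  congr 1
  ext x
  constructor
  · rintro ⟨i, j, h, rfl⟩
    exact ⟨s(i, j), h, rfl⟩
  · rintro ⟨p, hp, rfl⟩
    induction p using Sym2.ind with
    | _ i j => exact ⟨i, j, hp, rfl⟩

lemma pairVec_mem_edgePolytope {Γ : SimpleGraph (Fin n)} {i j : Fin n} (h : Γ.Adj i j) :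
    pairVec s(i, j) ∈ edgePolytope Γ :=
  subset_convexHull ℝ _ ⟨i, j, h, rfl⟩

lemma edgePolytope_subset {Γ : SimpleGraph (Fin n)} {K : Set (Fin n → ℝ)} (hK : Convex ℝ K)
    (h : ∀ i j, Γ.Adj i j → pairVec s(i, j) ∈ K) : edgePolytope Γ ⊆ K := by
  refine convexHull_min ?_ hK
  rintro _ ⟨i, j, hij, rfl⟩
  exact h i j hij

lemma exists_adj_of_nonempty {Γ : SimpleGraph (Fin n)} (h : (edgePolytope Γ).Nonempty) :
    ∃ i j, Γ.Adj i j := by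
  obtain ⟨_, i, j, hij, -⟩ := convexHull_nonempty_iff.1 h
  exact ⟨i, j, hij⟩

/-- A face of the hypersimplex containing a cell is proper iff it is cut out by a functional
which is not constant on the vertices. -/
lemma interior_iff {Γ : SimpleGraph (Fin n)} (hne : (edgePolytope Γ).Nonempty) :
    (∀ F, IsFace (hypersimplex n) F → F ≠ hypersimplex n → ¬ edgePolytope Γ ⊆ F) ↔
      ∀ (a : Fin n → ℝ) (M : ℝ), (∀ i j, i ≠ j → a i + a j ≤ M) →
        (∀ i j, Γ.Adj i j → a i + a j = M) → ∀ i j, i ≠ j → a i + a j = M := by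
  obtain ⟨i₀, j₀, h₀⟩ := exists_adj_of_nonempty hne
  constructor
  · intro h a M hle heq i j hij
    by_contra hne'
    set l : StrongDual ℝ (Fin n → ℝ) :=
      LinearMap.toContinuousLinearMap (∑ i, a i • LinearMap.proj i) with hl
    have hlv : ∀ i j, l (pairVec s(i, j)) = a i + a j := fun i j => by
      simp [hl, pairVec_mk, Pi.single_apply, mul_add, Finset.sum_add_distrib]
    have hΔ : ∀ x ∈ hypersimplex n, l x ≤ M := fun x hx =>
      edgePolytope_subset (Γ := ⊤) (K := {x | l x ≤ M}) (convex_halfSpace_le l.isLinear M)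
        (fun i j hij => by simpa [hlv] using hle i j hij) hx
    have hC : ∀ x ∈ edgePolytope Γ, l x = M := fun x hx =>
      edgePolytope_subset (K := {x | l x = M}) (convex_hyperplane l.isLinear M)
        (fun i j hij => by simpa [hlv] using heq i j hij) hx
    have hsub : edgePolytope Γ ⊆ hypersimplex n :=
      edgePolytope_subset (convex_convexHull ℝ _) fun i j hij =>
        pairVec_mem_edgePolytope (Γ := ⊤) hij.ne
    have hCF : edgePolytope Γ ⊆ {x ∈ hypersimplex n | ∀ y ∈ hypersimplex n, l y ≤ l x} :=
      fun x hx => ⟨hsub hx, fun y hy => (hΔ y hy).trans_eq (hC x hx).symm⟩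
    refine h {x ∈ hypersimplex n | ∀ y ∈ hypersimplex n, l y ≤ l x}
      ⟨hne.mono hCF, fun _ => ⟨l, rfl⟩⟩ ?_ hCF
    intro hF
    have hmem : pairVec s(i, j) ∈ hypersimplex n := pairVec_mem_edgePolytope (Γ := ⊤) hij
    rw [← hF] at hmem
    have h1 := hmem.2 _ (hsub (pairVec_mem_edgePolytope h₀))
    rw [hlv, hlv, heq _ _ h₀] at h1
    exact hne' (le_antisymm (hle i j hij) h1)
  · rintro h F ⟨hFne, hexp⟩ hne' hCF
    have hcF := hexp.convex (convex_convexHull ℝ _)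
    obtain ⟨l, hl⟩ := hexp hFne
    refine hne' (Set.Subset.antisymm hexp.subset ?_)
    have hmem : ∀ i j, Γ.Adj i j → ∀ y ∈ hypersimplex n, l y ≤ l (pairVec s(i, j)) :=
      fun i j hij => by
        have := hCF (pairVec_mem_edgePolytope hij)
        rw [hl] at this
        exact this.2
    have hΔ : ∀ i j, i ≠ j → pairVec s(i, j) ∈ hypersimplex n := fun i j hij =>
      pairVec_mem_edgePolytope (Γ := ⊤) hij
    have hlv : ∀ i j, l (pairVec s(i, j)) = l (Pi.single i 1) + l (Pi.single j 1) :=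
      fun i j => dual_pairVec l.toLinearMap i j
    have key := h (fun i => l (Pi.single i 1)) (l (pairVec s(i₀, j₀)))
      (fun i j hij => by rw [← hlv]; exact hmem _ _ h₀ _ (hΔ i j hij))
      (fun i j hij => by
        rw [← hlv]
        exact le_antisymm (hmem _ _ h₀ _ (hΔ i j hij.ne)) (hmem _ _ hij _ (hΔ _ _ h₀.ne)))
    refine edgePolytope_subset hcF fun i j hij => ?_
    rw [hl]
    refine ⟨hΔ i j hij, fun y hy => ?_⟩
    rw [hlv, key i j hij]
    exact hmem _ _ h₀ y hy

/-- Under the dot product `pairVec p` represents `pairSum p`, so the points are linearly independent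
and span a simplex. -/
lemma faceDim_convexHull_pairVec {S : Finset (Sym2 (Fin n))} (hS : Free pairSum S)
    (hne : S.Nonempty) : faceDim (convexHull ℝ (pairVec '' (S : Set (Sym2 (Fin n))))) + 1 =
      S.card := by
  classical
  have hli : LinearIndependent ℝ fun p : S => pairVec (p : Sym2 (Fin n)) := by
    rw [Fintype.linearIndependent_iff]
    intro c hc q
    obtain ⟨w, hw⟩ := hS fun p => if p = q then 1 else 0
    have h1 : ∑ p : S, c p * pairSum (p : Sym2 (Fin n)) w = 0 := by
      have h2 : ∑ i, (∑ p : S, c p • pairVec (p : Sym2 (Fin n))) i * w i = 0 := by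
        rw [hc]; simp
      rw [← h2]
      simp only [← pairVec_dotProduct, Finset.sum_apply, Pi.smul_apply, smul_eq_mul,
        Finset.sum_mul, Finset.mul_sum, mul_assoc]
      exact Finset.sum_comm
    have h3 : ∀ p : S, c p * pairSum (p : Sym2 (Fin n)) w = if p = q then c q else 0 := by
      intro p
      rw [hw p p.2]
      by_cases h : p = q
      · simp [h]
      · simp [h, Subtype.coe_injective.ne h]
    simpa [h3] using h1
  have hai := hli.affineIndependent
  obtain ⟨r, hr⟩ := Nat.exists_eq_succ_of_ne_zero hne.card_pos.ne'
  have := hai.finrank_vectorSpan (n := r) (by rw [Fintype.card_coe, hr])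
  rw [faceDim, ← direction_affineSpan, affineSpan_convexHull, direction_affineSpan, hr]
  have hset : pairVec '' (S : Set (Sym2 (Fin n))) =
      Set.range fun p : S => pairVec (p : Sym2 (Fin n)) := by
    ext x
    simp
  rw [hset, this]

/-- With `x i = 0` and `jk` tight, the triangle inequality makes `ij` and `ik` tight as well,
contradicting independence because `ii + jk = ij + ik`. -/
lemma IsMetric.loop_not_tight (hd : IsMetric d)
    (hfree : ∀ x ∈ polyhedron d, Free pairSum (tight d x)) {x : Fin n → ℝ} (hx : x ∈ polyhedron d)
    {i j k : Fin n} (hij : i ≠ j) (hik : i ≠ k) (hi : s(i, i) ∈ tight d x) :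
    s(j, k) ∉ tight d x := by
  classical
  intro hjk
  have h1 := hd.mem_tight.1 hi
  have h2 := hd.mem_tight.1 hjk
  rw [hd.diag] at h1
  have h3 := hx i j
  have h4 := hx i k
  have h5 := hd.triangle j i k
  rw [hd.symm j i] at h5
  have e1 : s(i, j) ∈ tight d x := hd.mem_tight.2 (by linarith)
  have e2 : s(i, k) ∈ tight d x := hd.mem_tight.2 (by linarith)
  obtain ⟨w, hw⟩ := hfree x hx fun p => if i ∈ p then 0 else 1
  have w1 := hw _ hi
  have w2 := hw _ hjk
  have w3 := hw _ e1
  have w4 := hw _ e2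
  simp [hij, hik] at w1 w2 w3 w4
  linarith

lemma star_card_le {S : Finset (Sym2 (Fin n))} {a : Fin n} {T : Finset (Fin n)}
    (h : ∀ j ∈ T, s(a, j) ∈ S) : T.card ≤ S.card := by
  refine Finset.card_le_card_of_injOn (fun j => s(a, j)) h ?_
  intro j _ k _ hjk
  exact Sym2.congr_right.1 hjk

/-- A tight loop at `i` forces all tight pairs through `i`; covering then takes `n` pairs, one for
each point, which is too many for `m ≥ 1`. -/
lemma IsMetric.loop_notMem (hd : IsMetric d)
    (hfree : ∀ x ∈ polyhedron d, Free pairSum (tight d x)) {m : ℕ} (hm : 1 ≤ m)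
    {S : Finset (Sym2 (Fin n))} (hS : S ∈ coverFaces d m) (i : Fin n) : s(i, i) ∉ S := by
  obtain ⟨hc, hcard, x, hx, rfl⟩ := hS
  intro hi
  have : (Finset.univ : Finset (Fin n)).card ≤ (tight d x).card := by
    refine star_card_le (a := i) fun j _ => ?_
    by_cases hij : i = j
    · exact hij ▸ hi
    · obtain ⟨p, hp, hjp⟩ := hc j
      obtain ⟨k, rfl⟩ := Sym2.mem_iff_exists.1 hjp
      by_cases hik : i = k
      · subst hik; rwa [Sym2.eq_swap]
      · exact absurd hp (hd.loop_not_tight hfree hx hij hik hi)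
  rw [Finset.card_univ, Fintype.card_fin] at this
  omega

lemma edgeSet_fromEdgeSet_of_loopless {S : Finset (Sym2 (Fin n))} (h : ∀ i, s(i, i) ∉ S) :
    (SimpleGraph.fromEdgeSet (S : Set (Sym2 (Fin n)))).edgeSet = S := by
  ext p
  induction p using Sym2.ind with
  | _ i j =>
    simp only [SimpleGraph.mem_edgeSet, SimpleGraph.fromEdgeSet_adj, Finset.mem_coe]
    refine ⟨fun h => h.1, fun hp => ⟨hp, ?_⟩⟩
    rintro rfl
    exact h i hp

lemma IsMetric.edgePolytope_mem_interiorCells (hd : IsMetric d)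
    (hfree : ∀ x ∈ polyhedron d, Free pairSum (tight d x)) {m : ℕ} (hm : 2 ≤ m) (hn : 0 < n)
    {S : Finset (Sym2 (Fin n))} (hS : S ∈ coverFaces d m) :
    edgePolytope (SimpleGraph.fromEdgeSet (S : Set (Sym2 (Fin n)))) ∈ interiorCells d ∧
      faceDim (edgePolytope (SimpleGraph.fromEdgeSet (S : Set (Sym2 (Fin n))))) = n - m - 1 := by
  have hloop := hd.loop_notMem hfree (by omega) hS
  obtain ⟨hc, hcard, x, hx, rfl⟩ := hS
  obtain ⟨p₀, hp₀, -⟩ := hc ⟨0, hn⟩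
  have hes := edgeSet_fromEdgeSet_of_loopless hloop
  have hadj : ∀ i j, (SimpleGraph.fromEdgeSet (tight d x : Set (Sym2 (Fin n)))).Adj i j ↔
      s(i, j) ∈ tight d x := fun i j => by
    rw [← SimpleGraph.mem_edgeSet, hes, Finset.mem_coe]
  have hne : (edgePolytope (SimpleGraph.fromEdgeSet
      (tight d x : Set (Sym2 (Fin n))))).Nonempty := by
    rw [edgePolytope_eq, hes]
    exact ⟨_, subset_convexHull ℝ _ ⟨p₀, hp₀, rfl⟩⟩
  refine ⟨⟨⟨hne, _, ⟨x, fun i j hij => ?_⟩, rfl⟩, ?_⟩, ?_⟩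
  · rw [hadj, hd.mem_tight]
    exact ⟨id, fun h => lt_of_le_of_ne (hx i j) (Ne.symm h)⟩
  · rw [interior_iff hne]
    intro a M hle heq
    have hnb : ∀ i, ∃ j, s(i, j) ∈ tight d x := fun i => by
      obtain ⟨p, hp, hip⟩ := hc i
      obtain ⟨j, rfl⟩ := Sym2.mem_iff_exists.1 hip
      exact ⟨j, hp⟩
    have heq' : ∀ i j, s(i, j) ∈ tight d x → a i + a j = M := fun i j h =>
      heq i j ((hadj i j).2 h)
    -- A point with `a i > M / 2` would be joined to every other point: an edge `jk` avoiding `i`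
    -- gives `2 * a i + M ≤ 2 * M`. Such a star has `n - 1` edges, which `2 ≤ m` excludes.
    have hsmall : ∀ i, ¬ M / 2 < a i := by
      intro i hi
      have hstar : (Finset.univ.erase i).card ≤ (tight d x).card := by
        refine star_card_le (a := i) fun j hj => ?_
        obtain ⟨k, hk⟩ := hnb j
        by_cases hik : i = k
        · subst hik; rwa [Sym2.eq_swap]
        · have h1 := heq' _ _ hk
          have h2 := hle i j (Finset.ne_of_mem_erase hj).symm
          have h3 := hle i k hik
          linarith
      rw [Finset.card_erase_of_mem (Finset.mem_univ _), Finset.card_univ, Fintype.card_fin] at hstar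
      omega
    have hall : ∀ i, a i = M / 2 := fun i => by
      obtain ⟨j, hj⟩ := hnb i
      have h1 := heq' i j hj
      have h2 := hsmall i
      have h3 := hsmall j
      linarith
    intro i j _
    rw [hall, hall]
    ring
  · have := faceDim_convexHull_pairVec (hfree x hx) ⟨p₀, hp₀⟩
    rw [edgePolytope_eq, hes]
    omega

/-- Not lying in `x_i = 0` means that `i` is covered, and not lying in `x_i = 1` means that some
edge avoids `i`. By the triangle inequality on such an edge the height `h i` is non-negative, so `h`
lies in `P_d`. -/
lemma IsMetric.exists_coverFaces_of_interiorCells (hd : IsMetric d)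
    (hfree : ∀ x ∈ polyhedron d, Free pairSum (tight d x)) {m : ℕ} (hmn : m < n) (hn : 3 ≤ n)
    {C : Set (Fin n → ℝ)} (hC : C ∈ interiorCells d) (hdim : faceDim C = n - m - 1) :
    ∃ S ∈ coverFaces d m, C = edgePolytope (SimpleGraph.fromEdgeSet (S : Set (Sym2 (Fin n)))) := by
  obtain ⟨⟨hne, Γ, ⟨h, hh⟩, rfl⟩, hint⟩ := hC
  rw [interior_iff hne] at hint
  have hcov : ∀ i, ∃ j, Γ.Adj i j := by
    intro i
    by_contra! hi
    obtain ⟨j, hj⟩ : ∃ j : Fin n, i ≠ j := by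
      have : Nontrivial (Fin n) := Fin.nontrivial_iff_two_le.2 (by omega)
      obtain ⟨j, hj⟩ := exists_ne i
      exact ⟨j, hj.symm⟩
    -- The functional `-x_i`, maximal on the face `x_i = 0`.
    have := hint (fun k => if k = i then -1 else 0) 0 (fun a b _ => by
      split_ifs <;> norm_num) (fun a b hab => by
      have ha : a ≠ i := by rintro rfl; exact hi _ hab
      have hb : b ≠ i := by rintro rfl; exact hi _ hab.symm
      simp [ha, hb]) i j hj
    simp [hj.symm] at this
  have hstar : ∀ i, ∃ j k, Γ.Adj j k ∧ i ≠ j ∧ i ≠ k := by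
    intro i
    by_contra! hi
    obtain ⟨j, k, hj, hk, hjk⟩ : ∃ j k : Fin n, j ≠ i ∧ k ≠ i ∧ j ≠ k := by
      have hc : 1 < (Finset.univ.erase i).card := by
        rw [Finset.card_erase_of_mem (Finset.mem_univ _), Finset.card_univ, Fintype.card_fin]
        omega
      obtain ⟨j, hj, k, hk, hjk⟩ := Finset.one_lt_card.1 hc
      exact ⟨j, k, Finset.ne_of_mem_erase hj, Finset.ne_of_mem_erase hk, hjk⟩
    -- The functional `x_i`, maximal on the face `x_i = 1`.
    have := hint (fun k => if k = i then 1 else 0) 1 (fun a b hab => by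
      split_ifs with h1 h2
      · exact absurd (h1.trans h2.symm) hab
      all_goals norm_num) (fun a b hab => by
      by_cases ha : i = a
      · subst ha; simp [hab.ne']
      · have := hi a b hab ha; subst this; simp [Ne.symm ha]) j k hjk
    simp [hj, hk] at this
  have hge : ∀ i j, i ≠ j → d i j ≤ h i + h j := fun i j hij => by
    by_cases hadj : Γ.Adj i j
    · exact ((hh i j hij).1 hadj).ge
    · exact ((hh i j hij).2 hadj).le
  have hpos : ∀ i, 0 ≤ h i := by
    intro i
    obtain ⟨j, k, hjk, hij, hik⟩ := hstar i
    have h1 := (hh j k hjk.ne).1 hjk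
    have h2 := hge i j hij
    have h3 := hge i k hik
    have h4 := hd.triangle j i k
    rw [hd.symm j i] at h4
    linarith
  have hP : h ∈ polyhedron d := fun i j => by
    by_cases hij : i = j
    · subst hij
      rw [hd.diag]
      have := hpos i
      linarith
    · exact hge i j hij
  have hadj : ∀ i j, s(i, j) ∈ tight d h ↔ Γ.Adj i j := by
    intro i j
    by_cases hij : i = j
    · subst hij
      refine iff_of_false (fun hi => ?_) (Γ.loopless.irrefl i)
      obtain ⟨j, k, hjk, hij, hik⟩ := hstar i
      exact hd.loop_not_tight hfree hP hij hik hi (hd.mem_tight.2 ((hh j k hjk.ne).1 hjk))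
    · rw [hd.mem_tight]
      refine ⟨fun h1 => ?_, (hh i j hij).1⟩
      by_contra h2
      have := (hh i j hij).2 h2
      linarith
  have hes : Γ.edgeSet = (tight d h : Set (Sym2 (Fin n))) := by
    ext p
    induction p using Sym2.ind with
    | _ i j => rw [SimpleGraph.mem_edgeSet, Finset.mem_coe, hadj]
  have hc : Covers (tight d h) := fun i => by
    obtain ⟨j, hj⟩ := hcov i
    exact ⟨s(i, j), (hadj i j).2 hj, Sym2.mem_mk_left _ _⟩
  refine ⟨tight d h, ⟨hc, ?_, h, hP, rfl⟩, by rw [← hes, SimpleGraph.fromEdgeSet_edgeSet]⟩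
  obtain ⟨p, hp, -⟩ := hc ⟨0, by omega⟩
  have := faceDim_convexHull_pairVec (hfree h hP) ⟨p, hp⟩
  rw [← hes, ← edgePolytope_eq, hdim] at this
  omega

/-- The functional `x_i + x_j` is `2` at this vertex and at most `1` at all others. Thus a cell
determines its graph. -/
lemma pairVec_mem_edgePolytope_iff {Γ : SimpleGraph (Fin n)} {i j : Fin n} (hij : i ≠ j) :
    pairVec s(i, j) ∈ edgePolytope Γ ↔ Γ.Adj i j := by
  refine ⟨fun h => ?_, pairVec_mem_edgePolytope⟩
  by_contra hadj
  have hsub := edgePolytope_subset (Γ := Γ) (K := {x | pairSum s(i, j) x ≤ 1})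
    (convex_halfSpace_le (pairSum s(i, j)).isLinear 1) (fun a b hab => ?_) h
  · simp [pairVec_mk, hij, hij.symm] at hsub
    norm_num at hsub
  · have h1 : ¬ (a = i ∧ b = j) := by rintro ⟨rfl, rfl⟩; exact hadj hab
    have h2 : ¬ (a = j ∧ b = i) := by rintro ⟨rfl, rfl⟩; exact hadj hab.symm
    have hab' := hab.ne
    simp only [Set.mem_ofPred_eq, pairSum_mk, pairVec_mk, Pi.add_apply, Pi.single_apply]
    split_ifs <;> first | (norm_num; done) | grind

theorem IsMetric.fVec_interiorCells (hd : IsMetric d)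
    (hfree : ∀ x ∈ polyhedron d, Free pairSum (tight d x)) {m : ℕ} (hm : 2 ≤ m) (hmn : m < n) :
    fVec (interiorCells d) (n - m - 1) = (coverFaces d m).ncard := by
  have himage : {C ∈ interiorCells d | faceDim C = n - m - 1} =
      (fun S : Finset (Sym2 (Fin n)) =>
        edgePolytope (SimpleGraph.fromEdgeSet (S : Set (Sym2 (Fin n))))) '' coverFaces d m := by
    ext C
    constructor
    · rintro ⟨hC, hdim⟩
      obtain ⟨S, hS, h⟩ :=
        hd.exists_coverFaces_of_interiorCells hfree hmn (by omega) hC hdim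
      exact ⟨S, hS, h.symm⟩
    · rintro ⟨S, hS, rfl⟩
      exact hd.edgePolytope_mem_interiorCells hfree hm (by omega) hS
  rw [fVec, himage, Set.InjOn.ncard_image]
  intro S hS S' hS' h
  dsimp only at h
  ext p
  induction p using Sym2.ind with
  | _ i j =>
    by_cases hij : i = j
    · subst hij
      exact iff_of_false (hd.loop_notMem hfree (by omega) hS i)
        (hd.loop_notMem hfree (by omega) hS' i)
    · have h1 := pairVec_mem_edgePolytope_iff
        (Γ := SimpleGraph.fromEdgeSet (S : Set (Sym2 (Fin n)))) hij
      have h2 := pairVec_mem_edgePolytope_iff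
        (Γ := SimpleGraph.fromEdgeSet (S' : Set (Sym2 (Fin n)))) hij
      rw [h, h2, SimpleGraph.fromEdgeSet_adj, SimpleGraph.fromEdgeSet_adj] at h1
      simpa [hij] using h1.symm

end Cells

end TightSpan

/-! ### A permutation supported on tight pairs, and sliding a point of `P_d`. -/

namespace TightSpan

section Support

variable {n : ℕ} {d : Fin n → Fin n → ℝ}

lemma IsMetric.exists_sum_minimal (hd : IsMetric d) :
    ∃ x ∈ polyhedron d, ∀ y ∈ polyhedron d, ∑ i, x i ≤ ∑ i, y i := by
  obtain ⟨x₀, hx₀, -⟩ := hd.exists_tight_eq_empty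
  set K : Set (Fin n → ℝ) := polyhedron d ∩ {x | ∑ i, x i ≤ ∑ i, x₀ i} with hK
  have hclosed : IsClosed (polyhedron d) := by
    have : polyhedron d = ⋂ i, ⋂ j, {x : Fin n → ℝ | d i j ≤ x i + x j} := by
      ext x; simp [polyhedron]
    rw [this]
    exact isClosed_iInter fun i => isClosed_iInter fun j =>
      isClosed_le continuous_const (by fun_prop)
  have hcomp : IsCompact K := by
    refine Metric.isCompact_of_isClosed_isBounded
      (hclosed.inter (isClosed_le (by fun_prop) continuous_const)) ?_
    rw [isBounded_iff_forall_norm_le]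
    have hC : 0 ≤ ∑ i, x₀ i := Finset.sum_nonneg fun i _ => hd.polyhedron_nonneg hx₀ i
    refine ⟨∑ i, x₀ i, fun y hy => (pi_norm_le_iff_of_nonneg hC).2 fun i => ?_⟩
    rw [Real.norm_eq_abs, abs_of_nonneg (hd.polyhedron_nonneg hy.1 i)]
    exact (Finset.single_le_sum (fun j _ => hd.polyhedron_nonneg hy.1 j)
      (Finset.mem_univ i)).trans hy.2
  obtain ⟨x, hx, hmin⟩ := hcomp.exists_isMinOn ⟨x₀, hx₀, le_refl (∑ i, x₀ i)⟩
    (f := fun x : Fin n → ℝ => ∑ i, x i) (by fun_prop)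
  refine ⟨x, hx.1, fun y hy => ?_⟩
  rcases le_total (∑ i, y i) (∑ i, x₀ i) with h | h
  · exact hmin ⟨hy, h⟩
  · exact hx.2.trans h

/-- Some permutation is supported on the tight pairs of a point. -/
lemma IsMetric.exists_perm_tight (hd : IsMetric d) :
    ∃ x ∈ polyhedron d, ∃ σ : Equiv.Perm (Fin n), ∀ i, s(i, σ i) ∈ tight d x := by
  classical
  obtain ⟨x, hx, hmin⟩ := hd.exists_sum_minimal
  refine ⟨x, hx, ?_⟩
  have hall := (Finset.all_card_le_biUnion_card_iff_exists_injective
    fun i : Fin n => Finset.univ.filter fun j => s(i, j) ∈ tight d x).1 ?_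
  · obtain ⟨f, hf, h⟩ := hall
    refine ⟨Equiv.ofBijective f hf.bijective_of_finite, fun i => ?_⟩
    simpa using h i
  · intro A
    by_contra! hlt
    set N := A.biUnion fun i : Fin n => Finset.univ.filter fun j => s(i, j) ∈ tight d x with hN
    have hmem : ∀ i j, i ∈ A → s(i, j) ∈ tight d x → j ∈ N := fun i j hi hij => by
      rw [hN, Finset.mem_biUnion]
      exact ⟨i, hi, by simpa using hij⟩
    have hx' := hx
    rw [polyhedron_eq_halfspaces] at hx'
    -- If Hall's condition fails for `A` with neighbourhood `N`, the direction `1_N - 1_A` is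
    -- admissible, since tight partners of `A` lie in `N`, and it lowers the minimal coordinate sum.
    obtain ⟨t, ht, hP, -⟩ := exists_move hx'
      (w := fun i => (if i ∈ N then 1 else 0) - (if i ∈ A then 1 else 0)) (fun p hp => by
        induction p using Sym2.ind with
        | _ i j =>
          have h1 := fun hi => hmem i j hi hp
          have h2 := fun hj => hmem j i hj (by rw [Sym2.eq_swap]; exact hp)
          rw [pairSum_mk]
          by_cases hi : i ∈ A <;> by_cases hj : j ∈ A
          · simp [hi, hj, h1 hi, h2 hj]
          · simp only [hi, hj, h1 hi, if_true, if_false]; split_ifs <;> norm_num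
          · simp only [hi, hj, h2 hj, if_true, if_false]; split_ifs <;> norm_num
          · simp only [hi, hj, if_false]; split_ifs <;> norm_num)
    rw [← polyhedron_eq_halfspaces] at hP
    have h3 := hmin _ hP
    simp only [Pi.add_apply, Pi.smul_apply, smul_eq_mul, Finset.sum_add_distrib,
      ← Finset.mul_sum, Finset.sum_sub_distrib, Finset.sum_ite_mem, Finset.univ_inter,
      Finset.sum_const, nsmul_eq_mul, mul_one] at h3
    have h4 : (N.card : ℝ) < A.card := by exact_mod_cast hlt
    nlinarith

/-- A fixed point `i` gives a tight loop, while the pair of any other `j` is tight and avoids `i`.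
-/
lemma IsMetric.perm_ne_self (hd : IsMetric d)
    (hfree : ∀ x ∈ polyhedron d, Free pairSum (tight d x)) (hn : 2 ≤ n) {x : Fin n → ℝ}
    (hx : x ∈ polyhedron d) {σ : Equiv.Perm (Fin n)} (hσ : ∀ i, s(i, σ i) ∈ tight d x)
    (i : Fin n) : σ i ≠ i := by
  intro hi
  have : Nontrivial (Fin n) := Fin.nontrivial_iff_two_le.2 hn
  obtain ⟨j, hj⟩ := exists_ne i
  have h1 := hσ i
  rw [hi] at h1
  refine hd.loop_not_tight hfree hx hj.symm ?_ h1 (hσ j)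
  intro h
  exact hj (σ.injective (by rw [hi, ← h]))

/-- Lowering `u` and raising the other points of `O` until some pair `s(u, t)` with `t` outside
`O` becomes tight. -/
lemma IsMetric.exists_slide (hd : IsMetric d) {x : Fin n → ℝ} (hx : x ∈ polyhedron d)
    {σ : Equiv.Perm (Fin n)} (hσ : ∀ i, s(i, σ i) ∈ tight d x) {O : Finset (Fin n)}
    (hO : ∀ i, i ∉ O → σ i ∉ O) (hO' : ∃ j, j ∉ O) {u : Fin n} (hu : u ∈ O) :
    ∃ y ∈ polyhedron d, ∃ t, t ∉ O ∧ s(u, t) ∈ tight d y ∧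
      (∀ w, w ∉ O → s(w, σ w) ∈ tight d y) ∧
      ∀ w ∈ O, w ≠ u → s(u, w) ∈ tight d x → s(u, w) ∈ tight d y := by
  classical
  obtain ⟨j, hj⟩ := hO'
  -- `t` is the outside point with least slack to `u`; that slack is the length of the slide.
  obtain ⟨t, ht, hmin⟩ := Finset.exists_min_image Oᶜ (fun j => x u + x j - d u j)
    ⟨j, Finset.mem_compl.2 hj⟩
  simp only [Finset.mem_compl] at ht hmin
  set s := x u + x t - d u t with hs
  have hs0 : 0 ≤ s := by have := hx u t; linarith
  set y : Fin n → ℝ := fun i => if i = u then x i - s else if i ∈ O then x i + s else x i with hy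
  have hyu : y u = x u - s := by simp [hy]
  have hyO : ∀ i ∈ O, i ≠ u → y i = x i + s := fun i hi hiu => by simp [hy, hi, hiu]
  have hyN : ∀ i, i ∉ O → y i = x i := fun i hi => by
    have : i ≠ u := by rintro rfl; exact hi hu
    simp [hy, hi, this]
  -- Here `y u = d u t - x t`, and minimality at `σ t` gives `y u ≥ d u (σ t) - x (σ t)`. Since
  -- `s(t, σ t)` is tight, adding these and applying the triangle inequality yields `2 * y u ≥ 0`.
  have hupos : 0 ≤ y u := by
    have h1 := hd.mem_tight.1 (hσ t)
    have h2 := hd.triangle t u (σ t)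
    have h3 := hmin _ (hO t ht)
    rw [hd.symm t u] at h2
    linarith
  have hge : ∀ i, i ≠ u → x i ≤ y i := fun i hi => by
    by_cases hiO : i ∈ O
    · rw [hyO i hiO hi]; linarith
    · rw [hyN i hiO]
  have hyuj : ∀ j, d u j ≤ y u + y j := by
    intro j
    by_cases hju : j = u
    · rw [hju, hd.diag]; linarith
    · by_cases hjO : j ∈ O
      · rw [hyu, hyO j hjO hju]; have := hx u j; linarith
      · rw [hyu, hyN j hjO]; have := hmin j hjO; linarith
  refine ⟨y, fun i j => ?_, t, ht, ?_, fun w hw => ?_, fun w hw hwu h => ?_⟩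
  · by_cases hi : i = u
    · rw [hi]; exact hyuj j
    · by_cases hj : j = u
      · rw [hj, hd.symm, add_comm]; exact hyuj i
      · have := hge i hi; have := hge j hj; have := hx i j; linarith
  · rw [hd.mem_tight, hyu, hyN t ht]; linarith
  · rw [hd.mem_tight, hyN w hw, hyN _ (hO w hw)]; exact hd.mem_tight.1 (hσ w)
  · rw [hd.mem_tight, hyu, hyO w hw hwu]
    have := hd.mem_tight.1 h
    linarith

lemma card_le_ncard_coverFaces (hfree : ∀ x ∈ polyhedron d, Free pairSum (tight d x)) {m : ℕ}
    {𝒮 : Finset (Finset (Sym2 (Fin n)))} (h : ∀ S ∈ 𝒮, Covers S ∧ S.card + m = n ∧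
      ∃ x ∈ polyhedron d, S ⊆ tight d x) : 𝒮.card ≤ (coverFaces d m).ncard := by
  rw [← Set.ncard_coe_finset]
  refine Set.ncard_le_ncard (fun S hS => ?_) (Set.toFinite _)
  obtain ⟨h1, h2, x, hx, hSx⟩ := h S hS
  exact ⟨h1, h2, exists_tight_eq hfree hx hSx⟩

end Support

end TightSpan

/-! ### Edge covers built from the cycles of a permutation. -/

namespace TightSpan

open Equiv

section Permutations

variable {α : Type*} [Fintype α] [DecidableEq α]

open Classical in
/-- The orbit of a point under a permutation. -/
noncomputable def orb (σ : Perm α) (u : α) : Finset α := {w | σ.SameCycle u w}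

open Classical in
/-- The orbits with an odd number of points. -/
noncomputable def oddOrbits (σ : Perm α) : Finset (Finset α) :=
  (Finset.univ.image (orb σ)).filter fun o => Odd o.card

/-- `v` chooses a point in each orbit. -/
def IsTransversal (σ : Perm α) (v : Finset α → α) : Prop := ∀ u, v (orb σ u) ∈ orb σ u

/-- The number of steps from the chosen point of its orbit to `u`. -/
noncomputable def pos (σ : Perm α) (v : Finset α → α) (u : α) : ℕ :=
  sInf {j | (σ ^ j) (v (orb σ u)) = u}

open Classical in
/-- The points at an even distance from the chosen point of their orbit. -/
noncomputable def evens (σ : Perm α) (v : Finset α → α) : Finset α := {u | Even (pos σ v u)}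

/-- An edge cover contained in the pairs `s(u, σ u)`: in each orbit of odd size at least three
it consists of a path with two edges centred at the chosen point and of disjoint edges. -/
noncomputable def cover (σ : Perm α) (v : Finset α → α) : Finset (Sym2 α) :=
  (evens σ v).image fun u => s(u, σ u)

variable {σ : Perm α} {v v' : Finset α → α}

lemma mem_orb {u w : α} : w ∈ orb σ u ↔ σ.SameCycle u w := by simp [orb]

lemma mem_orb_self (u : α) : u ∈ orb σ u := mem_orb.2 (Perm.SameCycle.refl _ _)

lemma orb_eq_iff {u w : α} : orb σ u = orb σ w ↔ u ∈ orb σ w := by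
  constructor
  · intro h; rw [← h]; exact mem_orb_self u
  · intro h
    rw [mem_orb] at h
    ext z
    rw [mem_orb, mem_orb]
    exact ⟨fun h' => h.trans h', fun h' => h.symm.trans h'⟩

lemma orb_apply (u : α) : orb σ (σ u) = orb σ u :=
  orb_eq_iff.2 (mem_orb.2 ((Perm.SameCycle.refl σ u).apply_right))

lemma apply_mem_orb {u w : α} : σ u ∈ orb σ w ↔ u ∈ orb σ w := by
  rw [← orb_eq_iff, orb_apply, orb_eq_iff]

lemma orb_subset {u : α} {A : Finset α} (hu : u ∈ A) (hA : ∀ w ∈ A, σ w ∈ A) : orb σ u ⊆ A := by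
  intro w hw
  obtain ⟨j, rfl⟩ := (mem_orb.1 hw).exists_nat_pow_eq
  clear hw
  induction j with
  | zero => simpa using hu
  | succ j ih => rw [pow_succ', Perm.mul_apply]; exact hA _ ih

lemma mem_oddOrbits {o : Finset α} : o ∈ oddOrbits σ ↔ (∃ u, orb σ u = o) ∧ Odd o.card := by
  simp [oddOrbits]

lemma orb_mem_oddOrbits {u : α} : orb σ u ∈ oddOrbits σ ↔ Odd (orb σ u).card := by
  simp [mem_oddOrbits]

lemma IsTransversal.orb_eq (hv : IsTransversal σ v) (u : α) : orb σ (v (orb σ u)) = orb σ u :=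
  orb_eq_iff.2 (hv u)

lemma IsTransversal.pow_pos (hv : IsTransversal σ v) (u : α) :
    (σ ^ pos σ v u) (v (orb σ u)) = u := by
  have : (σ.SameCycle (v (orb σ u)) u) := (mem_orb.1 (hv u)).symm
  exact Nat.sInf_mem (s := {j | (σ ^ j) (v (orb σ u)) = u}) this.exists_nat_pow_eq

lemma pos_le {u : α} {j : ℕ} (h : (σ ^ j) (v (orb σ u)) = u) : pos σ v u ≤ j := Nat.sInf_le h

lemma IsTransversal.pos_eq_zero (hv : IsTransversal σ v) {u : α} :
    pos σ v u = 0 ↔ v (orb σ u) = u := by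
  constructor
  · intro h
    have := hv.pow_pos u
    rwa [h, pow_zero, Perm.one_apply] at this
  · intro h
    exact Nat.le_zero.1 (pos_le (by simpa using h))

lemma IsTransversal.pos_apply (hv : IsTransversal σ v) {u : α} (h : v (orb σ u) ≠ σ u) :
    pos σ v (σ u) = pos σ v u + 1 := by
  apply le_antisymm
  · refine pos_le ?_
    rw [orb_apply, pow_succ', Perm.mul_apply, hv.pow_pos]
  · have h0 : pos σ v (σ u) ≠ 0 := fun h0 => h (by
      have := hv.pos_eq_zero.1 h0
      rwa [orb_apply] at this)
    obtain ⟨j, hj⟩ := Nat.exists_eq_succ_of_ne_zero h0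
    have h1 := hv.pow_pos (σ u)
    rw [hj, Nat.succ_eq_add_one, pow_succ', Perm.mul_apply, orb_apply] at h1
    have := pos_le (σ.injective h1)
    omega

lemma mem_evens {u : α} : u ∈ evens σ v ↔ Even (pos σ v u) := by simp [evens]

lemma IsTransversal.rep_mem_evens (hv : IsTransversal σ v) {u : α} (h : v (orb σ u) = u) :
    u ∈ evens σ v := by
  rw [mem_evens, hv.pos_eq_zero.2 h]
  exact Even.zero

lemma IsTransversal.apply_mem_evens (hv : IsTransversal σ v) {u : α} (h : u ∉ evens σ v) :
    σ u ∈ evens σ v := by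
  by_cases h1 : v (orb σ u) = σ u
  · exact hv.rep_mem_evens (by rw [orb_apply, h1])
  · rw [mem_evens] at h ⊢
    rw [hv.pos_apply h1]
    exact (Nat.not_even_iff_odd.1 h).add_one

lemma IsTransversal.apply_notMem_evens (hv : IsTransversal σ v) {u : α} (h : u ∈ evens σ v)
    (h1 : v (orb σ u) ≠ σ u) : σ u ∉ evens σ v := by
  rw [mem_evens] at h ⊢
  rw [hv.pos_apply h1, Nat.not_even_iff_odd]
  exact h.add_one

lemma IsTransversal.two_mul_card_orb (hv : IsTransversal σ v) (u : α) :
    2 * ((evens σ v).filter (· ∈ orb σ u)).card =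
      (orb σ u).card + if Odd (orb σ u).card then 1 else 0 := by
  set r := v (orb σ u) with hr
  set e := σ.symm r with he
  have her : σ e = r := by simp [he]
  have horbe : orb σ e = orb σ u := by rw [← orb_apply, her, hv.orb_eq]
  set A := (evens σ v).filter (· ∈ orb σ u) with hA
  -- Apart from the predecessor `e` of the chosen point, `σ` maps the points at even positions
  -- bijectively onto those at odd positions. The cycle is odd exactly when `e` itself is even.
  have h1 : ((A.erase e).map σ.toEmbedding) = (orb σ u) \ A := by
    ext y
    obtain ⟨z, rfl⟩ := σ.surjective y
    simp only [Finset.mem_map_equiv, Finset.mem_erase, Finset.mem_sdiff, hA, Finset.mem_filter,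
      symm_apply_apply, apply_mem_orb]
    constructor
    · rintro ⟨hze, hzE, hzo⟩
      refine ⟨hzo, fun h => hv.apply_notMem_evens hzE ?_ h.1⟩
      rw [orb_eq_iff.2 hzo, ← hr, ← her]
      exact fun h => hze (σ.injective h).symm
    · rintro ⟨hzo, hzE⟩
      have hzE' : σ z ∉ evens σ v := fun h => hzE ⟨h, hzo⟩
      refine ⟨?_, ?_, hzo⟩
      · rintro rfl
        exact hzE' (hv.rep_mem_evens (by rw [orb_apply, horbe, her, hr]))
      · by_contra h
        exact hzE' (hv.apply_mem_evens h)
  have h2 := congrArg Finset.card h1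
  have hsub : A ⊆ orb σ u := fun w hw => (Finset.mem_filter.1 hw).2
  rw [Finset.card_map, Finset.card_sdiff_of_subset hsub] at h2
  have h3 := Finset.card_le_card hsub
  by_cases heA : e ∈ A
  · rw [Finset.card_erase_of_mem heA] at h2
    have := Finset.card_pos.2 ⟨e, heA⟩
    have hodd : Odd (orb σ u).card := ⟨A.card - 1, by omega⟩
    rw [if_pos hodd]
    omega
  · rw [Finset.erase_eq_of_notMem heA] at h2
    have hodd : ¬ Odd (orb σ u).card := by
      rw [Nat.not_odd_iff_even]; exact ⟨A.card, by omega⟩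
    rw [if_neg hodd]
    omega

lemma card_eq_sum_orb (A : Finset α) :
    A.card = ∑ o ∈ Finset.univ.image (orb σ), (A.filter (· ∈ o)).card := by
  classical
  rw [Finset.card_eq_sum_card_fiberwise (f := orb σ) (t := Finset.univ.image (orb σ))
    (fun _ _ => by simp)]
  refine Finset.sum_congr rfl fun o ho => ?_
  obtain ⟨u, -, rfl⟩ := Finset.mem_image.1 ho
  congr 1
  ext w
  simp [orb_eq_iff]

lemma sum_card_orb : ∑ o ∈ Finset.univ.image (orb σ), o.card = Fintype.card α := by
  rw [← Finset.card_univ, card_eq_sum_orb (σ := σ) Finset.univ]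
  refine Finset.sum_congr rfl fun o _ => ?_
  simp

lemma IsTransversal.two_mul_card_evens (hv : IsTransversal σ v) :
    2 * (evens σ v).card = Fintype.card α + (oddOrbits σ).card := by
  rw [card_eq_sum_orb (σ := σ) (evens σ v), Finset.mul_sum, ← sum_card_orb (σ := σ), oddOrbits,
    Finset.card_filter, ← Finset.sum_add_distrib]
  refine Finset.sum_congr rfl fun o ho => ?_
  obtain ⟨u, -, rfl⟩ := Finset.mem_image.1 ho
  exact hv.two_mul_card_orb u

lemma IsTransversal.card_cover (hv : IsTransversal σ v) (hσ : ∀ u, σ u ≠ u) :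
    2 * (cover σ v).card = Fintype.card α + (oddOrbits σ).card := by
  rw [← hv.two_mul_card_evens, cover, Finset.card_image_of_injOn]
  intro u hu w hw h
  simp only [Finset.mem_coe] at hu hw
  rcases Sym2.eq_iff.1 h with h | ⟨h1, h2⟩
  -- Two different even points could give the same pair only on a 2-cycle, where just one of the two
  -- points is even.
  · exact h.1
  · exfalso
    subst h1
    have h3 : v (orb σ w) = σ w := by
      by_contra h3
      exact hv.apply_notMem_evens hw h3 hu
    refine hv.apply_notMem_evens hu ?_ (by rw [h2]; exact hw)
    rw [orb_apply, h3, h2]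
    exact hσ w

lemma IsTransversal.exists_mem_cover (hv : IsTransversal σ v) (u : α) :
    ∃ p ∈ cover σ v, u ∈ p := by
  obtain ⟨w, rfl⟩ := σ.surjective u
  by_cases h : w ∈ evens σ v
  · exact ⟨_, Finset.mem_image_of_mem _ h, Sym2.mem_mk_right _ _⟩
  · exact ⟨_, Finset.mem_image_of_mem _ (hv.apply_mem_evens h), Sym2.mem_mk_left _ _⟩

lemma mem_cover_iff {u : α} (hu : σ (σ u) ≠ u) : s(u, σ u) ∈ cover σ v ↔ u ∈ evens σ v := by
  refine ⟨fun h => ?_, fun h => Finset.mem_image_of_mem _ h⟩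
  obtain ⟨w, hw, h⟩ := Finset.mem_image.1 h
  rcases Sym2.eq_iff.1 h with h | ⟨rfl, h2⟩
  · exact h.1 ▸ hw
  · exact absurd h2 hu

lemma exists_of_mem_cover {p : Sym2 α} (hp : p ∈ cover σ v) : ∃ w, p = s(w, σ w) := by
  obtain ⟨w, -, h⟩ := Finset.mem_image.1 hp
  exact ⟨w, h.symm⟩

lemma orb_eq_of_mem_cover {a b : α} (h : s(a, b) ∈ cover σ v) : orb σ a = orb σ b := by
  obtain ⟨w, h⟩ := exists_of_mem_cover h
  rcases Sym2.eq_iff.1 h with ⟨rfl, rfl⟩ | ⟨rfl, rfl⟩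
  · exact orb_apply _ |>.symm
  · exact orb_apply _

lemma orb_of_apply_apply {u : α} (h : σ (σ u) = u) : orb σ u ⊆ {u, σ u} :=
  orb_subset (by simp) (by simp [h])

lemma apply_apply_ne (hσ : ∀ u, σ u ≠ u) {u : α} (h : Odd (orb σ u).card) : σ (σ u) ≠ u := by
  intro h1
  have h2 : orb σ u = {u, σ u} := by
    refine Finset.Subset.antisymm (orb_of_apply_apply h1) ?_
    intro w hw
    rcases Finset.mem_insert.1 hw with rfl | hw
    · exact mem_orb_self _
    · rw [Finset.mem_singleton.1 hw, apply_mem_orb]; exact mem_orb_self _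
  rw [h2, Finset.card_pair (hσ u).symm] at h
  exact absurd h (by decide)

lemma three_le_card_orb (hσ : ∀ u, σ u ≠ u) {u : α} (h : Odd (orb σ u).card) :
    3 ≤ (orb σ u).card := by
  have h1 : 1 < (orb σ u).card := Finset.one_lt_card.2
    ⟨u, mem_orb_self u, σ u, apply_mem_orb.2 (mem_orb_self u), (hσ u).symm⟩
  obtain ⟨k, hk⟩ := h
  omega

lemma orb_of_card_eq_three (hσ : ∀ u, σ u ≠ u) {u : α} (h : (orb σ u).card = 3) :
    orb σ u = {u, σ u, σ (σ u)} ∧ σ (σ (σ u)) = u := by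
  have h2 := apply_apply_ne hσ (u := u) (by rw [h]; decide)
  have hcard : ({u, σ u, σ (σ u)} : Finset α).card = 3 :=
    Finset.card_eq_three.2 ⟨_, _, _, (hσ u).symm, h2.symm, (hσ (σ u)).symm, rfl⟩
  have heq : ({u, σ u, σ (σ u)} : Finset α) = orb σ u := by
    refine Finset.eq_of_subset_of_card_le ?_ (by rw [h, hcard])
    intro w hw
    simp only [Finset.mem_insert, Finset.mem_singleton] at hw
    rcases hw with rfl | rfl | rfl <;> simp [apply_mem_orb, mem_orb_self]
  refine ⟨heq.symm, ?_⟩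
  have h3 : σ (σ (σ u)) ∈ orb σ u := by simp [apply_mem_orb, mem_orb_self]
  rw [← heq] at h3
  simp only [Finset.mem_insert, Finset.mem_singleton] at h3
  rcases h3 with h3 | h3 | h3
  · exact h3
  · exact absurd (σ.injective h3) h2
  · exact absurd (σ.injective (σ.injective h3)) (hσ u)

/-- On an odd cycle the chosen point is the only even point whose predecessor is even too, and on
cycles longer than two the cover determines which points are even. -/
lemma IsTransversal.eq_of_cover_eq (hv : IsTransversal σ v) (hv' : IsTransversal σ v')
    (hσ : ∀ u, σ u ≠ u) (h : cover σ v = cover σ v') {u : α} (hu : Odd (orb σ u).card) :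
    v (orb σ u) = v' (orb σ u) := by
  set a := v (orb σ u) with ha
  have horba : orb σ a = orb σ u := hv.orb_eq u
  obtain ⟨e, hea⟩ := σ.surjective a
  have horbe : orb σ e = orb σ u := by rw [← orb_apply, hea, horba]
  have hane : σ (σ a) ≠ a := apply_apply_ne hσ (by rwa [horba])
  have hene : σ (σ e) ≠ e := apply_apply_ne hσ (by rwa [horbe])
  have haE : a ∈ evens σ v := hv.rep_mem_evens (by rw [horba])
  -- Otherwise `σ` would inject the even points of the cycle into the odd ones, although the even
  -- points are in the majority.
  have heE : e ∈ evens σ v := by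
    have h1 := hv.two_mul_card_orb u
    by_contra he
    obtain ⟨k, hk⟩ := hu
    have h2 : ((evens σ v).filter (· ∈ orb σ u)).card ≤ (orb σ u \
        (evens σ v).filter (· ∈ orb σ u)).card := by
      refine Finset.card_le_card_of_injOn σ ?_ σ.injective.injOn
      intro z hz
      obtain ⟨hzE, hzo⟩ := Finset.mem_filter.1 hz
      refine Finset.mem_coe.2 (Finset.mem_sdiff.2 ⟨apply_mem_orb.2 hzo, fun h => ?_⟩)
      refine hv.apply_notMem_evens hzE ?_ (Finset.mem_filter.1 h).1
      rw [orb_eq_iff.2 hzo, ← ha, ← hea]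
      rintro h
      exact he (σ.injective h ▸ hzE)
    have hsub : (evens σ v).filter (· ∈ orb σ u) ⊆ orb σ u :=
      fun w hw => (Finset.mem_filter.1 hw).2
    rw [Finset.card_sdiff_of_subset hsub] at h2
    rw [if_pos ⟨k, hk⟩] at h1
    omega
  have haE' : a ∈ evens σ v' := by rwa [← mem_cover_iff hane, ← h, mem_cover_iff hane]
  have heE' : e ∈ evens σ v' := by rwa [← mem_cover_iff hene, ← h, mem_cover_iff hene]
  by_contra hne
  refine hv'.apply_notMem_evens heE' ?_ (hea ▸ haE')
  rw [horbe, hea]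
  exact Ne.symm hne

end Permutations

end TightSpan

/-! ### Choices of centres, and exchanging the path of a triangle. -/

namespace TightSpan

open Equiv

section Exchange

variable {α : Type*} [Fintype α] [DecidableEq α]

lemma exists_isTransversal [Nonempty α] (σ : Perm α) : ∃ v, IsTransversal σ v := by
  classical
  refine ⟨fun o => if h : o.Nonempty then h.choose else Classical.arbitrary α, fun u => ?_⟩
  have h : (orb σ u).Nonempty := ⟨u, mem_orb_self u⟩
  simp only [h, dif_pos]
  exact h.choose_spec

open Classical in
/-- The transversals which agree with `v₀` outside the odd orbits. -/
noncomputable def choices (σ : Perm α) (v₀ : Finset α → α) : Finset (Finset α → α) :=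
  Fintype.piFinset fun o => if o ∈ oddOrbits σ then o else {v₀ o}

/-- Replacing two edges of a triangle at `t` by the third one and an edge to `u`. -/
def exchange (σ : Perm α) (C : Finset (Sym2 α)) (u t : α) : Finset (Sym2 α) :=
  (C \ {s(t, σ t), s(σ (σ t), t)}) ∪ {s(u, t), s(σ t, σ (σ t))}

variable {σ : Perm α} {v₀ v v' : Finset α → α}

lemma card_choices : (choices σ v₀).card = ∏ o ∈ oddOrbits σ, o.card := by
  classical
  rw [choices, Fintype.card_piFinset, ← Finset.prod_subset (Finset.subset_univ (oddOrbits σ))]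
  · exact Finset.prod_congr rfl fun o ho => by rw [if_pos ho]
  · intro o _ ho
    rw [if_neg ho, Finset.card_singleton]

lemma mem_choices : v ∈ choices σ v₀ ↔
    (∀ o ∈ oddOrbits σ, v o ∈ o) ∧ ∀ o ∉ oddOrbits σ, v o = v₀ o := by
  classical
  rw [choices, Fintype.mem_piFinset]
  constructor
  · intro h
    refine ⟨fun o ho => ?_, fun o ho => ?_⟩
    · simpa [ho] using h o
    · simpa [ho] using h o
  · rintro ⟨h1, h2⟩ o
    by_cases ho : o ∈ oddOrbits σ
    · simpa [ho] using h1 o ho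
    · simpa [ho] using h2 o ho

lemma isTransversal_of_mem_choices (hv₀ : IsTransversal σ v₀) (hv : v ∈ choices σ v₀) :
    IsTransversal σ v := by
  intro u
  rw [mem_choices] at hv
  by_cases h : orb σ u ∈ oddOrbits σ
  · exact hv.1 _ h
  · rw [hv.2 _ h]; exact hv₀ u

lemma cover_injOn_choices (hv₀ : IsTransversal σ v₀) (hσ : ∀ u, σ u ≠ u) :
    Set.InjOn (cover σ) (choices σ v₀) := by
  intro v hv v' hv' h
  have hv := Finset.mem_coe.1 hv
  have hv' := Finset.mem_coe.1 hv'
  ext o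
  by_cases ho : o ∈ oddOrbits σ
  · obtain ⟨⟨u, rfl⟩, hodd⟩ := mem_oddOrbits.1 ho
    exact (isTransversal_of_mem_choices hv₀ hv).eq_of_cover_eq
      (isTransversal_of_mem_choices hv₀ hv') hσ h hodd
  · rw [(mem_choices.1 hv).2 o ho, (mem_choices.1 hv').2 o ho]

lemma card_piFinset_update {ι β : Type*} [Fintype ι] [DecidableEq ι] [DecidableEq β]
    (s : ι → Finset β) (i : ι) (a : β) :
    (Fintype.piFinset (Function.update s i {a})).card * (s i).card = (Fintype.piFinset s).card := by
  rw [Fintype.card_piFinset, Fintype.card_piFinset,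
    ← Finset.mul_prod_erase _ _ (Finset.mem_univ i), ← Finset.mul_prod_erase _ _ (Finset.mem_univ i)]
  rw [Function.update_self, Finset.card_singleton, one_mul, mul_comm]
  congr 1
  refine Finset.prod_congr rfl fun j hj => ?_
  rw [Function.update_of_ne (Finset.ne_of_mem_erase hj)]

/-- The choices with a prescribed value at one odd orbit, or at two. -/
lemma card_choices_filter {t u : α} (ht : Odd (orb σ t).card) (hut : orb σ u ≠ orb σ t)
    (h3 : ∀ o ∈ oddOrbits σ, o.card = 3) :
    ((choices σ v₀).filter fun v => v (orb σ t) = t ∧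
      (Odd (orb σ u).card → v (orb σ u) = u)).card *
      (if Odd (orb σ u).card then 9 else 3) = 3 ^ (oddOrbits σ).card := by
  classical
  have hc : (choices σ v₀).card = 3 ^ (oddOrbits σ).card := by
    rw [card_choices, Finset.prod_congr rfl h3, Finset.prod_const]
  have hto : orb σ t ∈ oddOrbits σ := orb_mem_oddOrbits.2 ht
  have h1 := Fintype.piFinset_update_singleton_eq_filter_piFinset_eq
    (fun o => if o ∈ oddOrbits σ then o else {v₀ o}) (orb σ t) (a := t)
    (by simp [hto, mem_orb_self])
  have c1 := card_piFinset_update (fun o => if o ∈ oddOrbits σ then o else {v₀ o}) (orb σ t) t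
  rw [if_pos hto, h3 _ hto] at c1
  change _ = (choices σ v₀).card at c1
  by_cases hu : Odd (orb σ u).card
  · have huo : orb σ u ∈ oddOrbits σ := orb_mem_oddOrbits.2 hu
    have h2 := Fintype.piFinset_update_singleton_eq_filter_piFinset_eq
      (Function.update (fun o => if o ∈ oddOrbits σ then o else {v₀ o}) (orb σ t) {t})
      (orb σ u) (a := u) (by rw [Function.update_of_ne hut]; simp [huo, mem_orb_self])
    have c2 := card_piFinset_update
      (Function.update (fun o => if o ∈ oddOrbits σ then o else {v₀ o}) (orb σ t) {t}) (orb σ u) u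
    rw [Function.update_of_ne hut, if_pos huo, h3 _ huo, h2, h1, Finset.filter_filter] at c2
    rw [h1] at c1
    change (Finset.filter _ (choices σ v₀)).card * 3 = (Finset.filter _ (choices σ v₀)).card at c2
    change (Finset.filter _ (choices σ v₀)).card * 3 = _ at c1
    simp only [hu, if_true, forall_const]
    rw [← hc, ← c1, ← c2]
    ring
  · simp only [hu, if_false, false_imp_iff, and_true]
    rw [← hc, ← c1, h1]
    rfl

/-- The hypotheses under which an exchange at `t`, `u` is made. -/
structure ExchangeData (σ : Perm α) (v : Finset α → α) (u t : α) : Prop where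
  transversal : IsTransversal σ v
  ne_self : ∀ u, σ u ≠ u
  card : (orb σ t).card = 3
  rep : v (orb σ t) = t
  orb_ne : orb σ u ≠ orb σ t

namespace ExchangeData

variable {u t : α}

lemma odd (h : ExchangeData σ v u t) : Odd (orb σ t).card := by rw [h.card]; decide

lemma apply_apply_ne (h : ExchangeData σ v u t) : σ (σ t) ≠ t :=
  TightSpan.apply_apply_ne h.ne_self h.odd

lemma apply_three (h : ExchangeData σ v u t) : σ (σ (σ t)) = t :=
  (orb_of_card_eq_three h.ne_self h.card).2

/-- The points `t`, `σ t`, `σ (σ t)` have positions 0, 1, 2, so the cover contains the two triangle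
edges at `t` and not the opposite one. -/
lemma rep_mem_evens (h : ExchangeData σ v u t) :
    t ∈ evens σ v ∧ σ t ∉ evens σ v ∧ σ (σ t) ∈ evens σ v := by
  have h1 := h.transversal.rep_mem_evens h.rep
  have h2 := h.transversal.apply_notMem_evens h1 (by rw [h.rep]; exact (h.ne_self t).symm)
  exact ⟨h1, h2, h.transversal.apply_mem_evens h2⟩

lemma removed_subset (h : ExchangeData σ v u t) :
    ({s(t, σ t), s(σ (σ t), t)} : Finset (Sym2 α)) ⊆ cover σ v := by
  intro p hp
  rcases Finset.mem_insert.1 hp with rfl | hp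
  · exact Finset.mem_image_of_mem _ h.rep_mem_evens.1
  · rw [Finset.mem_singleton.1 hp]
    exact Finset.mem_image.2 ⟨_, h.rep_mem_evens.2.2, by rw [h.apply_three]⟩

lemma opposite_notMem (h : ExchangeData σ v u t) : s(σ t, σ (σ t)) ∉ cover σ v := by
  rw [mem_cover_iff]
  · exact h.rep_mem_evens.2.1
  · rw [h.apply_three]; exact (h.ne_self t).symm

lemma card_le (h : ExchangeData σ v u t) : (exchange σ (cover σ v) u t).card ≤ (cover σ v).card := by
  have h1 := Finset.card_union_le (cover σ v \ {s(t, σ t), s(σ (σ t), t)})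
    {s(u, t), s(σ t, σ (σ t))}
  have h2 : ({s(u, t), s(σ t, σ (σ t))} : Finset (Sym2 α)).card ≤ 2 := Finset.card_le_two
  have h3 : ({s(t, σ t), s(σ (σ t), t)} : Finset (Sym2 α)).card = 2 := by
    refine Finset.card_pair fun he => ?_
    rcases Sym2.eq_iff.1 he with ⟨h4, -⟩ | ⟨-, h4⟩
    · exact h.apply_apply_ne h4.symm
    · exact h.ne_self _ h4.symm
  have h4 := Finset.card_le_card h.removed_subset
  rw [Finset.card_sdiff_of_subset h.removed_subset] at h1
  rw [exchange]
  omega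

lemma exists_mem (h : ExchangeData σ v u t) (w : α) :
    ∃ p ∈ exchange σ (cover σ v) u t, w ∈ p := by
  by_cases h1 : w = t
  · exact ⟨s(u, t), by simp [exchange], by simp [h1]⟩
  by_cases h2 : w = σ t ∨ w = σ (σ t)
  · exact ⟨s(σ t, σ (σ t)), by simp [exchange], by simpa using h2⟩
  · obtain ⟨p, hp, hw⟩ := h.transversal.exists_mem_cover w
    refine ⟨p, Finset.mem_union_left _ (Finset.mem_sdiff.2 ⟨hp, fun hp' => ?_⟩), hw⟩
    rcases Finset.mem_insert.1 hp' with rfl | hp'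
    · rw [Sym2.mem_iff] at hw; tauto
    · rw [Finset.mem_singleton.1 hp', Sym2.mem_iff] at hw; tauto

/-- The listed pairs are those that stay or become tight when `u` slides. The orbit of `u` is a
2-cycle, or a triangle with centre `u`, so all its cover edges contain `u`. -/
lemma mem_cases (h : ExchangeData σ v u t) (hu : σ (σ u) = u ∨ (orb σ u).card = 3)
    (hvu : Odd (orb σ u).card → v (orb σ u) = u) {p : Sym2 α}
    (hp : p ∈ exchange σ (cover σ v) u t) :
    p = s(u, t) ∨ ∃ w, p = s(w, σ w) ∧ (w ∉ orb σ u ∨ ∃ z ∈ orb σ u, z ≠ u ∧ p = s(u, z)) := by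
  rcases Finset.mem_union.1 hp with hp | hp
  · right
    obtain ⟨w, hw, rfl⟩ := Finset.mem_image.1 (Finset.mem_sdiff.1 hp).1
    refine ⟨w, rfl, ?_⟩
    by_cases hwu : w ∈ orb σ u
    · right
      rcases hu with hu | hu
      · have := orb_of_apply_apply hu hwu
        simp only [Finset.mem_insert, Finset.mem_singleton] at this
        refine ⟨σ u, apply_mem_orb.2 (mem_orb_self u), h.ne_self u, ?_⟩
        rcases this with rfl | rfl
        · rfl
        · rw [hu, Sym2.eq_swap]
      · have hodd : Odd (orb σ u).card := by rw [hu]; decide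
        obtain ⟨ho, h3⟩ := orb_of_card_eq_three h.ne_self hu
        have hmem := hwu
        rw [ho] at hmem
        simp only [Finset.mem_insert, Finset.mem_singleton] at hmem
        rcases hmem with rfl | rfl | rfl
        · exact ⟨σ w, apply_mem_orb.2 (mem_orb_self w), h.ne_self w, rfl⟩
        · exact absurd hw (h.transversal.apply_notMem_evens
            (h.transversal.rep_mem_evens (hvu hodd)) (by rw [hvu hodd]; exact (h.ne_self u).symm))
        · exact ⟨σ (σ u), hwu, TightSpan.apply_apply_ne h.ne_self hodd, by rw [h3, Sym2.eq_swap]⟩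
    · exact Or.inl hwu
  · rcases Finset.mem_insert.1 hp with rfl | hp
    · exact Or.inl rfl
    · right
      refine ⟨σ t, Finset.mem_singleton.1 hp, Or.inl fun hmem => h.orb_ne ?_⟩
      rw [← orb_eq_iff, orb_apply] at hmem
      exact hmem.symm

lemma eq_of_orb_ne {a b : α}
    (hp : s(a, b) ∈ exchange σ (cover σ v) u t) (hab : orb σ a ≠ orb σ b) : s(a, b) = s(u, t) := by
  rcases Finset.mem_union.1 hp with hp | hp
  · exact absurd (orb_eq_of_mem_cover (Finset.mem_sdiff.1 hp).1) hab
  · rcases Finset.mem_insert.1 hp with hp | hp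
    · exact hp
    · exfalso
      rcases Sym2.eq_iff.1 (Finset.mem_singleton.1 hp) with ⟨rfl, rfl⟩ | ⟨rfl, rfl⟩
      · exact hab (orb_apply _).symm
      · exact hab (orb_apply _)

/-- The exchange can be undone, so for fixed `u` and `t` it is injective in the cover. -/
lemma restore (h : ExchangeData σ v u t) : (exchange σ (cover σ v) u t \
    {s(u, t), s(σ t, σ (σ t))}) ∪ {s(t, σ t), s(σ (σ t), t)} = cover σ v := by
  have h1 : s(u, t) ∉ cover σ v := fun hp => h.orb_ne (orb_eq_of_mem_cover hp)
  have h2 := h.opposite_notMem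
  have h3 := h.removed_subset
  ext p
  by_cases hp : p ∈ ({s(t, σ t), s(σ (σ t), t)} : Finset (Sym2 α))
  · exact iff_of_true (Finset.mem_union_right _ hp) (h3 hp)
  · by_cases hp' : p ∈ ({s(u, t), s(σ t, σ (σ t))} : Finset (Sym2 α))
    · refine iff_of_false (fun hm => ?_) (fun hm => ?_)
      · rcases Finset.mem_union.1 hm with hm | hm
        · exact (Finset.mem_sdiff.1 hm).2 hp'
        · exact hp hm
      · rcases Finset.mem_insert.1 hp' with rfl | hp'
        · exact h1 hm
        · rw [Finset.mem_singleton.1 hp'] at hm; exact h2 hm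
    · simp only [exchange, Finset.mem_union, Finset.mem_sdiff, hp, hp', or_false, not_false_eq_true,
        and_true]

/-- The new pair is the only one joining two orbits, so it is recovered from the exchanged cover.
Its ends cannot be swapped: then `t = u'` would be the centre for `v'`, and the edge `s(t, σ t)`
would be kept on one side but removed on the other. -/
lemma eq_left {u' t' : α} (h : ExchangeData σ v u t) (h' : ExchangeData σ v' u' t')
    (hvu' : Odd (orb σ u').card → v' (orb σ u') = u')
    (he : exchange σ (cover σ v) u t = exchange σ (cover σ v') u' t') : u = u' := by
  have h1 : s(u, t) ∈ exchange σ (cover σ v') u' t' := by rw [← he]; simp [exchange]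
  rcases Sym2.eq_iff.1 (eq_of_orb_ne h1 h.orb_ne) with h2 | ⟨rfl, rfl⟩
  · exact h2.1
  · exfalso
    have h3 : s(t, σ t) ∈ exchange σ (cover σ v') t u := by
      refine Finset.mem_union_left _ (Finset.mem_sdiff.2 ⟨?_, fun hm => ?_⟩)
      · rw [mem_cover_iff h.apply_apply_ne]
        exact h'.transversal.rep_mem_evens (hvu' h.odd)
      · have key : ∀ a b, s(t, σ t) = s(a, b) → a ∈ orb σ u → b ∈ orb σ u → False := by
          intro a b hab ha hb
          have : t ∈ orb σ u := by
            rcases Sym2.eq_iff.1 hab with ⟨rfl, -⟩ | ⟨rfl, -⟩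
            · exact ha
            · exact hb
          exact h.orb_ne (orb_eq_iff.2 this).symm
        rcases Finset.mem_insert.1 hm with hm | hm
        · exact key _ _ hm (mem_orb_self u) (apply_mem_orb.2 (mem_orb_self u))
        · exact key _ _ (Finset.mem_singleton.1 hm)
            (apply_mem_orb.2 (apply_mem_orb.2 (mem_orb_self u))) (mem_orb_self u)
    rw [← he] at h3
    rcases Finset.mem_union.1 h3 with h3 | h3
    · exact (Finset.mem_sdiff.1 h3).2 (by simp)
    · rcases Finset.mem_insert.1 h3 with h3 | h3
      · rcases Sym2.eq_iff.1 h3 with ⟨h4, -⟩ | ⟨-, h4⟩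
        · exact h.orb_ne (by rw [h4])
        · exact h.orb_ne (by rw [← h4, orb_apply])
      · rcases Sym2.eq_iff.1 (Finset.mem_singleton.1 h3) with ⟨h4, -⟩ | ⟨h4, -⟩
        · exact h.ne_self t h4.symm
        · exact h.apply_apply_ne h4.symm

end ExchangeData

end Exchange

end TightSpan

/-! ### The lower bounds. -/

namespace TightSpan

section LowerBound

variable {n : ℕ} {d : Fin n → Fin n → ℝ}

/-- A permutation supported on tight pairs, for a generic metric. -/
lemma IsMetric.exists_tight_perm (hd : IsMetric d)
    (hfree : ∀ x ∈ polyhedron d, Free pairSum (tight d x)) (hn : 2 ≤ n) :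
    ∃ x ∈ polyhedron d, ∃ σ : Equiv.Perm (Fin n), (∀ i, s(i, σ i) ∈ tight d x) ∧ ∀ i, σ i ≠ i := by
  obtain ⟨x, hx, σ, hσ⟩ := hd.exists_perm_tight
  exact ⟨x, hx, σ, hσ, hd.perm_ne_self hfree hn hx hσ⟩

lemma cover_subset {α : Type*} [Fintype α] [DecidableEq α] {σ : Equiv.Perm α} {v : Finset α → α}
    {T : Finset (Sym2 α)} (h : ∀ i, s(i, σ i) ∈ T) : cover σ v ⊆ T := by
  intro p hp
  obtain ⟨w, rfl⟩ := exists_of_mem_cover hp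
  exact h w

/-- Every dimension bound for the tight span bounds the number of odd orbits from below. -/
lemma le_card_oddOrbits (hfree : ∀ x ∈ polyhedron d, Free pairSum (tight d x)) (hn : 2 ≤ n) {m : ℕ}
    (hm : ∀ x ∈ polyhedron d, Covers (tight d x) → n ≤ (tight d x).card + m) {x : Fin n → ℝ}
    (hx : x ∈ polyhedron d) {σ : Equiv.Perm (Fin n)} (hσ : ∀ i, s(i, σ i) ∈ tight d x)
    (hσ' : ∀ i, σ i ≠ i) : n ≤ (oddOrbits σ).card + 2 * m := by
  have : Nonempty (Fin n) := ⟨⟨0, by omega⟩⟩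
  obtain ⟨v, hv⟩ := exists_isTransversal σ
  obtain ⟨y, hy, hyS⟩ := exists_tight_eq hfree hx (cover_subset (v := v) hσ)
  have h1 := hm y hy (by rw [hyS]; exact hv.exists_mem_cover)
  have h2 := hv.card_cover hσ'
  rw [hyS] at h1
  rw [Fintype.card_fin] at h2
  omega

lemma three_mul_card_oddOrbits_le {σ : Equiv.Perm (Fin n)} (hσ : ∀ i, σ i ≠ i) :
    3 * (oddOrbits σ).card ≤ ∑ o ∈ oddOrbits σ, o.card ∧ ∑ o ∈ oddOrbits σ, o.card ≤ n := by
  constructor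
  · rw [mul_comm, ← smul_eq_mul]
    refine Finset.card_nsmul_le_sum _ _ _ fun o ho => ?_
    obtain ⟨⟨u, rfl⟩, hodd⟩ := mem_oddOrbits.1 ho
    exact three_le_card_orb hσ hodd
  · calc ∑ o ∈ oddOrbits σ, o.card ≤ ∑ o ∈ Finset.univ.image (orb σ), o.card :=
        Finset.sum_le_sum_of_subset (Finset.filter_subset _ _)
      _ = n := by rw [sum_card_orb, Fintype.card_fin]

/-- Different centres in the odd cycles give different covers of the same size, all contained in the
tight set of one point. -/
lemma prod_card_le_ncard (hfree : ∀ x ∈ polyhedron d, Free pairSum (tight d x))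
    (hn : 2 ≤ n) {m : ℕ} {x : Fin n → ℝ}
    (hx : x ∈ polyhedron d) {σ : Equiv.Perm (Fin n)} (hσ : ∀ i, s(i, σ i) ∈ tight d x)
    (hσ' : ∀ i, σ i ≠ i) (hc : (oddOrbits σ).card + 2 * m = n) :
    ∏ o ∈ oddOrbits σ, o.card ≤ (coverFaces d m).ncard := by
  have : Nonempty (Fin n) := ⟨⟨0, by omega⟩⟩
  obtain ⟨v₀, hv₀⟩ := exists_isTransversal σ
  rw [← card_choices (v₀ := v₀), ← Finset.card_image_of_injOn (cover_injOn_choices hv₀ hσ')]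
  refine card_le_ncard_coverFaces hfree fun S hS => ?_
  obtain ⟨v, hv, rfl⟩ := Finset.mem_image.1 hS
  have hvt := isTransversal_of_mem_choices hv₀ hv
  refine ⟨hvt.exists_mem_cover, ?_, x, hx, cover_subset hσ⟩
  have := hvt.card_cover hσ'
  rw [Fintype.card_fin] at this
  omega

/-- Each `u ∈ U` slides to some `τ u` in another triangle, independently of the centres. Exchanges
are possible for the choices centred at `τ u`, and at `u` if its orbit is odd, hence the factors 3
and 9. The new covers contain a pair joining two orbits, which separates them from the old ones and
determines `u`. -/
lemma IsMetric.exchange_bound (hd : IsMetric d)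
    (hfree : ∀ x ∈ polyhedron d, Free pairSum (tight d x)) (hn : 2 ≤ n) {m : ℕ}
    (hm : ∀ x ∈ polyhedron d, Covers (tight d x) → n ≤ (tight d x).card + m) {x : Fin n → ℝ}
    (hx : x ∈ polyhedron d) {σ : Equiv.Perm (Fin n)} (hσ : ∀ i, s(i, σ i) ∈ tight d x)
    (hσ' : ∀ i, σ i ≠ i) (hc : (oddOrbits σ).card + 2 * m = n)
    (h3 : ∀ o ∈ oddOrbits σ, o.card = 3) {U : Finset (Fin n)}
    (hU : ∀ u ∈ U, (σ (σ u) = u ∨ (orb σ u).card = 3) ∧ (∃ t, t ∉ orb σ u) ∧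
      ∀ t, t ∉ orb σ u → Odd (orb σ t).card) :
    ∃ f : Fin n → ℕ, (∀ u ∈ U, f u * (if Odd (orb σ u).card then 9 else 3) =
      3 ^ (oddOrbits σ).card) ∧
      3 ^ (oddOrbits σ).card + ∑ u ∈ U, f u ≤ (coverFaces d m).ncard := by
  classical
  have : Nonempty (Fin n) := ⟨⟨0, by omega⟩⟩
  obtain ⟨v₀, hv₀⟩ := exists_isTransversal σ
  have hslide : ∀ u ∈ U, ∃ t, t ∉ orb σ u ∧ ∃ y ∈ polyhedron d, s(u, t) ∈ tight d y ∧
      (∀ w, w ∉ orb σ u → s(w, σ w) ∈ tight d y) ∧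
      ∀ w ∈ orb σ u, w ≠ u → s(u, w) ∈ tight d x → s(u, w) ∈ tight d y := by
    intro u hu
    obtain ⟨y, hy, t, ht, h⟩ := hd.exists_slide hx hσ (O := orb σ u)
      (fun i hi => by rwa [apply_mem_orb]) (hU u hu).2.1 (mem_orb_self u)
    exact ⟨t, ht, y, hy, h⟩
  choose! τ hτ y hy hyt hyout hyin using hslide
  have hodd : ∀ u ∈ U, Odd (orb σ (τ u)).card := fun u hu => (hU u hu).2.2 _ (hτ u hu)
  have hne : ∀ u ∈ U, orb σ u ≠ orb σ (τ u) := fun u hu h =>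
    hτ u hu (h ▸ mem_orb_self (τ u))
  set sel : Fin n → Finset (Finset (Fin n) → Fin n) := fun u => (choices σ v₀).filter fun v =>
    v (orb σ (τ u)) = τ u ∧ (Odd (orb σ u).card → v (orb σ u) = u) with hsel
  have hdata : ∀ u ∈ U, ∀ v ∈ sel u, ExchangeData σ v u (τ u) := fun u hu v hv => by
    obtain ⟨hv1, hv2, -⟩ := Finset.mem_filter.1 hv
    exact ⟨isTransversal_of_mem_choices hv₀ hv1, hσ', h3 _ (orb_mem_oddOrbits.2 (hodd u hu)),
      hv2, hne u hu⟩
  have hrep : ∀ u ∈ U, ∀ v ∈ sel u, Odd (orb σ u).card → v (orb σ u) = u :=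
    fun u _ v hv => (Finset.mem_filter.1 hv).2.2
  refine ⟨fun u => (sel u).card, fun u hu => card_choices_filter (hodd u hu) (hne u hu) h3, ?_⟩
  set 𝒜 := (choices σ v₀).image (cover σ) with h𝒜
  set ℬ : Fin n → Finset (Finset (Sym2 (Fin n))) := fun u =>
    (sel u).image fun v => exchange σ (cover σ v) u (τ u) with hℬ
  have hcardA : 𝒜.card = 3 ^ (oddOrbits σ).card := by
    rw [h𝒜, Finset.card_image_of_injOn (cover_injOn_choices hv₀ hσ'), card_choices,
      Finset.prod_congr rfl h3, Finset.prod_const]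
  have hcardB : ∀ u ∈ U, (ℬ u).card = (sel u).card := fun u hu => by
    refine Finset.card_image_of_injOn fun v hv v' hv' h => ?_
    refine cover_injOn_choices hv₀ hσ' (Finset.mem_filter.1 hv).1 (Finset.mem_filter.1 hv').1 ?_
    rw [← (hdata u hu v hv).restore, ← (hdata u hu v' hv').restore, h]
  have hdisj : (U : Set (Fin n)).PairwiseDisjoint ℬ := by
    intro u hu u' hu' huu'
    refine Finset.disjoint_left.2 fun S hS hS' => huu' ?_
    obtain ⟨v, hv, rfl⟩ := Finset.mem_image.1 hS
    obtain ⟨v', hv', h⟩ := Finset.mem_image.1 hS'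
    exact (hdata u hu v hv).eq_left (hdata u' hu' v' hv') (hrep u' hu' v' hv') h.symm
  have hdisj' : Disjoint 𝒜 (U.biUnion ℬ) := by
    refine Finset.disjoint_left.2 fun S hS hS' => ?_
    obtain ⟨v, -, rfl⟩ := Finset.mem_image.1 hS
    obtain ⟨u, hu, hS'⟩ := Finset.mem_biUnion.1 hS'
    obtain ⟨v', -, h⟩ := Finset.mem_image.1 hS'
    refine hne u hu (orb_eq_of_mem_cover (v := v) ?_)
    rw [← h]
    simp [exchange]
  rw [← hcardA, ← Finset.sum_congr rfl hcardB, ← Finset.card_biUnion hdisj,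
    ← Finset.card_union_of_disjoint hdisj']
  refine card_le_ncard_coverFaces hfree fun S hS => ?_
  rcases Finset.mem_union.1 hS with hS | hS
  · obtain ⟨v, hv, rfl⟩ := Finset.mem_image.1 hS
    have hvt := isTransversal_of_mem_choices hv₀ hv
    refine ⟨hvt.exists_mem_cover, ?_, x, hx, cover_subset hσ⟩
    have := hvt.card_cover hσ'
    rw [Fintype.card_fin] at this
    omega
  · obtain ⟨u, hu, hS⟩ := Finset.mem_biUnion.1 hS
    obtain ⟨v, hv, rfl⟩ := Finset.mem_image.1 hS
    have hE := hdata u hu v hv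
    have hsub : exchange σ (cover σ v) u (τ u) ⊆ tight d (y u) := by
      intro p hp
      rcases hE.mem_cases (hU u hu).1 (hrep u hu v hv) hp with rfl | ⟨w, rfl, hw | ⟨z, hz, hzu, hp'⟩⟩
      · exact hyt u hu
      · exact hyout u hu w hw
      · rw [hp']
        exact hyin u hu z hz hzu (hp' ▸ hσ w)
    refine ⟨hE.exists_mem, ?_, y u, hy u hu, hsub⟩
    -- The exchange does not increase the size. It cannot decrease it either, because the result is
    -- a covering tight set and the dimension hypothesis applies.
    obtain ⟨z, hz, hzS⟩ := exists_tight_eq hfree (hy u hu) hsub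
    have h1 := hm z hz (by rw [hzS]; exact hE.exists_mem)
    have h2 := hE.transversal.card_cover hσ'
    have h4 := hE.card_le
    rw [hzS] at h1
    rw [Fintype.card_fin] at h2
    omega

theorem IsMetric.lower_bound_zero (hd : IsMetric d)
    (hfree : ∀ x ∈ polyhedron d, Free pairSum (tight d x)) {k : ℕ} (hk : 2 ≤ k) (hn : n = 3 * k)
    (hm : ∀ x ∈ polyhedron d, Covers (tight d x) → n ≤ (tight d x).card + k) :
    n * 3 ^ (k - 2) + 3 ^ k ≤ (coverFaces d k).ncard := by
  obtain ⟨x, hx, σ, hσ, hσ'⟩ := hd.exists_tight_perm hfree (by omega)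
  have h1 := le_card_oddOrbits hfree (by omega) hm hx hσ hσ'
  obtain ⟨h2, h3⟩ := three_mul_card_oddOrbits_le hσ'
  -- At least `k` odd orbits with at least three points each fill all `3k` points, so all orbits are
  -- triangles.
  have hc : (oddOrbits σ).card = k := by omega
  have hge : ∀ o ∈ oddOrbits σ, 3 ≤ o.card := fun o ho => by
    obtain ⟨⟨u, rfl⟩, hodd⟩ := mem_oddOrbits.1 ho
    exact three_le_card_orb hσ' hodd
  have hthree : ∀ o ∈ oddOrbits σ, o.card = 3 := fun o ho =>
    (((Finset.sum_eq_sum_iff_of_le hge).1 (by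
      rw [Finset.sum_const, smul_eq_mul]; omega)) o ho).symm
  have hallodd : ∀ u, Odd (orb σ u).card := by
    intro u
    by_contra hu
    have h4 : ∑ o ∈ oddOrbits σ, o.card < ∑ o ∈ Finset.univ.image (orb σ), o.card :=
      Finset.sum_lt_sum_of_subset (Finset.filter_subset _ _)
        (Finset.mem_image_of_mem _ (Finset.mem_univ u)) (fun h => hu (orb_mem_oddOrbits.1 h))
        (Finset.card_pos.2 ⟨u, mem_orb_self u⟩) (fun _ _ _ => Nat.zero_le _)
    rw [sum_card_orb, Fintype.card_fin] at h4
    omega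
  obtain ⟨f, hf, hN⟩ := hd.exchange_bound hfree (by omega) hm hx hσ hσ' (by omega) hthree
    (U := Finset.univ) fun u _ => by
      have hu := hthree _ (orb_mem_oddOrbits.2 (hallodd u))
      refine ⟨Or.inr hu, ?_, fun t _ => hallodd t⟩
      by_contra! hall
      have := Finset.card_le_card (fun t _ => hall t : (Finset.univ : Finset (Fin n)) ⊆ orb σ u)
      rw [Finset.card_univ, Fintype.card_fin] at this
      omega
  have hf' : ∀ u ∈ Finset.univ, f u = 3 ^ (k - 2) := fun u hu => by
    have := hf u hu
    rw [if_pos (hallodd u), hc] at this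
    obtain ⟨j, rfl⟩ := Nat.exists_eq_add_of_le hk
    rw [pow_add] at this
    simp only [Nat.add_sub_cancel_left]
    omega
  rw [Finset.sum_congr rfl hf', Finset.sum_const, Finset.card_univ, Fintype.card_fin, hc,
    smul_eq_mul] at hN
  omega

lemma three_pow_le_prod_card {σ : Equiv.Perm (Fin n)} (hσ : ∀ i, σ i ≠ i)
    {A : Finset (Finset (Fin n))} (hA : A ⊆ oddOrbits σ) : 3 ^ A.card ≤ ∏ o ∈ A, o.card := by
  rw [← Finset.prod_const]
  refine Finset.prod_le_prod' fun o ho => ?_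
  obtain ⟨⟨u, rfl⟩, hodd⟩ := mem_oddOrbits.1 (hA ho)
  exact three_le_card_orb hσ hodd

theorem IsMetric.lower_bound_one (hd : IsMetric d)
    (hfree : ∀ x ∈ polyhedron d, Free pairSum (tight d x)) {k : ℕ} (hk : 1 ≤ k)
    (hn : n = 3 * k + 1)
    (hm : ∀ x ∈ polyhedron d, Covers (tight d x) → n ≤ (tight d x).card + (k + 1)) :
    3 ^ (k - 1) ≤ (coverFaces d (k + 1)).ncard := by
  obtain ⟨x, hx, σ, hσ, hσ'⟩ := hd.exists_tight_perm hfree (by omega)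
  have h1 := le_card_oddOrbits hfree (by omega) hm hx hσ hσ'
  obtain ⟨h2, h3⟩ := three_mul_card_oddOrbits_le hσ'
  have : Nonempty (Fin n) := ⟨⟨0, by omega⟩⟩
  obtain ⟨v₀, hv₀⟩ := exists_isTransversal σ
  have h4 := hv₀.card_cover hσ'
  rw [Fintype.card_fin] at h4
  -- The bounds leave `k - 1` and `k`; the second is excluded because `n` plus the number of odd
  -- orbits is even.
  have hc : (oddOrbits σ).card = k - 1 := by omega
  rw [← hc]
  exact (three_pow_le_prod_card hσ' subset_rfl).trans
    (prod_card_le_ncard hfree (by omega) hx hσ hσ' (by omega))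

theorem IsMetric.lower_bound_two (hd : IsMetric d)
    (hfree : ∀ x ∈ polyhedron d, Free pairSum (tight d x)) {k : ℕ} (hk : 1 ≤ k)
    (hn : n = 3 * k + 2)
    (hm : ∀ x ∈ polyhedron d, Covers (tight d x) → n ≤ (tight d x).card + (k + 1)) :
    5 * 3 ^ (k - 1) ≤ (coverFaces d (k + 1)).ncard := by
  classical
  obtain ⟨x, hx, σ, hσ, hσ'⟩ := hd.exists_tight_perm hfree (by omega)
  have h1 := le_card_oddOrbits hfree (by omega) hm hx hσ hσ'
  obtain ⟨h2, h3⟩ := three_mul_card_oddOrbits_le hσ'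
  have hc : (oddOrbits σ).card = k := by omega
  -- If all odd orbits are triangles, the two remaining points form a 2-cycle and contribute `2 *
  -- 3^(k-1)` exchanges beyond the `3^k` covers. Otherwise an odd orbit with at least five points
  -- makes the product large enough.
  by_cases hthree : ∀ o ∈ oddOrbits σ, o.card = 3
  · have hsum : ∑ o ∈ oddOrbits σ, o.card = 3 * k := by
      rw [Finset.sum_congr rfl hthree, Finset.sum_const, hc, smul_eq_mul, mul_comm]
    set U : Finset (Fin n) := Finset.univ.filter fun u => ¬ Odd (orb σ u).card with hU
    have hmemU : ∀ u, u ∈ U ↔ ¬ Odd (orb σ u).card := fun u => by simp [hU]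
    have hcardU : U.card = 2 := by
      have h4 := card_eq_sum_orb (σ := σ) Uᶜ
      have h5 : ∀ o ∈ Finset.univ.image (orb σ), (Uᶜ.filter (· ∈ o)).card =
          if Odd o.card then o.card else 0 := by
        intro o ho
        obtain ⟨u, -, rfl⟩ := Finset.mem_image.1 ho
        split_ifs with hodd
        · congr 1
          ext w
          simp only [Finset.mem_filter, Finset.mem_compl, hmemU, not_not]
          refine ⟨fun h => h.2, fun h => ⟨?_, h⟩⟩
          rwa [orb_eq_iff.2 h]
        · rw [Finset.card_eq_zero, Finset.eq_empty_iff_forall_notMem]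
          intro w hw
          simp only [Finset.mem_filter, Finset.mem_compl, hmemU, not_not] at hw
          rw [orb_eq_iff.2 hw.2] at hw
          exact hodd hw.1
      rw [Finset.sum_congr rfl h5, ← Finset.sum_filter] at h4
      change _ = ∑ o ∈ oddOrbits σ, o.card at h4
      have h6 := Finset.card_add_card_compl U
      rw [Fintype.card_fin] at h6
      omega
    have hUpair : ∀ u ∈ U, U = {u, σ u} := fun u hu => by
      have hsub : ({u, σ u} : Finset (Fin n)) ⊆ U := by
        intro w hw
        simp only [Finset.mem_insert, Finset.mem_singleton] at hw
        rcases hw with rfl | rfl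
        · exact hu
        · rw [hmemU] at hu ⊢; rwa [orb_apply]
      exact (Finset.eq_of_subset_of_card_le hsub
        (by rw [hcardU, Finset.card_pair (hσ' u).symm])).symm
    obtain ⟨f, hf, hN⟩ := hd.exchange_bound hfree (by omega) hm hx hσ hσ' (by omega) hthree
      (U := U) fun u hu => by
        have hpair := hUpair u hu
        have huo := (hmemU u).1 hu
        have horbU : U ⊆ orb σ u := by
          rw [hpair]
          intro w hw
          simp only [Finset.mem_insert, Finset.mem_singleton] at hw
          rcases hw with rfl | rfl
          · exact mem_orb_self _
          · exact apply_mem_orb.2 (mem_orb_self _)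
        refine ⟨Or.inl ?_, ?_, fun t ht => ?_⟩
        · have h5 : σ (σ u) ∈ U := by rw [hmemU, orb_apply, orb_apply]; exact huo
          rw [hpair] at h5
          simp only [Finset.mem_insert, Finset.mem_singleton] at h5
          rcases h5 with h5 | h5
          · exact h5
          · exact absurd (σ.injective h5) (hσ' u)
        · by_contra! hall
          have hpos : 0 < (oddOrbits σ).card := by omega
          obtain ⟨o, ho⟩ := Finset.card_pos.1 hpos
          obtain ⟨⟨t, rfl⟩, hodd⟩ := mem_oddOrbits.1 ho
          rw [orb_eq_iff.2 (hall t)] at hodd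
          exact huo hodd
        · by_contra h
          exact ht (horbU ((hmemU t).2 h))
    have hf' : ∀ u ∈ U, f u = 3 ^ (k - 1) := fun u hu => by
      have := hf u hu
      rw [if_neg ((hmemU u).1 hu), hc] at this
      obtain ⟨j, rfl⟩ := Nat.exists_eq_add_of_le' hk
      rw [pow_succ] at this
      simp only [Nat.add_sub_cancel]
      omega
    rw [Finset.sum_congr rfl hf', Finset.sum_const, hcardU, hc, smul_eq_mul] at hN
    obtain ⟨j, rfl⟩ := Nat.exists_eq_add_of_le' hk
    rw [pow_succ] at hN
    simp only [Nat.add_sub_cancel] at hN ⊢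
    omega
  · push Not at hthree
    obtain ⟨o, ho, ho3⟩ := hthree
    have ho5 : 5 ≤ o.card := by
      obtain ⟨⟨u, rfl⟩, hodd⟩ := mem_oddOrbits.1 ho
      have := three_le_card_orb hσ' hodd
      obtain ⟨j, hj⟩ := hodd
      omega
    have h4 := prod_card_le_ncard hfree (by omega) (m := k + 1) hx hσ hσ' (by omega)
    have h5 := three_pow_le_prod_card hσ' (Finset.erase_subset o (oddOrbits σ))
    rw [Finset.card_erase_of_mem ho, hc] at h5
    rw [← Finset.mul_prod_erase _ _ ho] at h4
    exact (Nat.mul_le_mul ho5 h5).trans h4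

end LowerBound

end TightSpan

/-! ### Inequalities for the perturbation in `d_min`, and the thrackle bound. -/

namespace TightSpan

/-- The perturbation `1 / (n² + a n + b)` for the labels `a < b` of two points. -/
noncomputable def eps (n i j : ℕ) : ℝ :=
  1 / ((n : ℝ) ^ 2 + ((min i j : ℕ) + 1 : ℝ) * n + ((max i j : ℕ) + 1 : ℝ))

/-- The number of the triangle of `graphMin n` containing a point; the points outside the
triangles get numbers of their own. -/
def lab {n : ℕ} (i : Fin n) : ℕ := if (i : ℕ) < 3 * (n / 3) then i / 3 else i - 2 * (n / 3)

section Perturbation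

variable {n : ℕ}

lemma eps_comm (i j : ℕ) : eps n i j = eps n j i := by
  rw [eps, eps, min_comm, max_comm]

lemma eps_of_lt {i j : ℕ} (h : i < j) :
    eps n i j = 1 / ((n : ℝ) ^ 2 + (i + 1) * n + (j + 1)) := by
  rw [eps, min_eq_left h.le, max_eq_right h.le]

lemma eps_pos (i j : ℕ) : 0 < eps n i j := by
  rw [eps]; positivity

lemma eps_lt (hn : 4 ≤ n) (i j : ℕ) : eps n i j < 1 / 16 := by
  rw [eps]
  have h : (4 : ℝ) ≤ n := by exact_mod_cast hn
  apply one_div_lt_one_div_of_lt (by norm_num)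
  have h1 : (0 : ℝ) ≤ (min i j : ℕ) := Nat.cast_nonneg _
  have h2 : (0 : ℝ) ≤ (max i j : ℕ) := Nat.cast_nonneg _
  nlinarith

lemma eps_anti (hn : 4 ≤ n) {z w w' : ℕ} (h : w < w') (hz : z ≠ w) (hz' : z ≠ w') :
    eps n z w' < eps n z w := by
  have hn' : (4 : ℝ) ≤ n := by exact_mod_cast hn
  have hw : (w : ℝ) < w' := by exact_mod_cast h
  rcases lt_or_gt_of_ne hz with h1 | h1
  · rw [eps_of_lt h1, eps_of_lt (h1.trans h)]
    apply one_div_lt_one_div_of_lt (by positivity)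
    linarith
  · have h1' : (w : ℝ) < z := by exact_mod_cast h1
    rw [eps_comm z w, eps_of_lt h1]
    rcases lt_or_gt_of_ne hz' with h2 | h2
    · have h2' : (z : ℝ) < w' := by exact_mod_cast h2
      rw [eps_of_lt h2]
      apply one_div_lt_one_div_of_lt (by positivity)
      nlinarith
    · rw [eps_comm z w', eps_of_lt h2]
      apply one_div_lt_one_div_of_lt (by positivity)
      nlinarith

lemma two_div_add_lt {a h : ℝ} (ha : 0 < a) (hh : 0 < h) :
    2 * (1 / (a + h)) < 1 / a + 1 / (a + 2 * h) := by
  rw [← sub_pos]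
  have : 1 / a + 1 / (a + 2 * h) - 2 * (1 / (a + h)) =
      2 * h ^ 2 / (a * (a + h) * (a + 2 * h)) := by
    field_simp
    ring
  rw [this]
  positivity

/-- The three denominators form an arithmetic progression, with step `1` or `n`, and `1/x` is
strictly convex. -/
lemma eps_convex (hn : 4 ≤ n) {z w : ℕ} (h : z < w ∨ w + 2 < z) :
    2 * eps n z (w + 1) < eps n z w + eps n z (w + 2) := by
  have hn' : (4 : ℝ) ≤ n := by exact_mod_cast hn
  rcases h with h | h
  · rw [eps_of_lt h, eps_of_lt (by omega : z < w + 1), eps_of_lt (by omega : z < w + 2)]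
    convert two_div_add_lt (a := (n : ℝ) ^ 2 + (z + 1) * n + (w + 1)) (h := 1) (by positivity)
      one_pos using 3 <;> push_cast <;> ring_nf
  · rw [eps_comm z w, eps_comm z (w + 1), eps_comm z (w + 2), eps_of_lt (by omega : w < z),
      eps_of_lt (by omega : w + 1 < z), eps_of_lt h]
    convert two_div_add_lt (a := (n : ℝ) ^ 2 + (w + 1) * n + (z + 1)) (h := n) (by positivity)
      (by linarith) using 3 <;> push_cast <;> ring_nf

/-- With `eps_nested`: among the three ways to split four points into two pairs, the crossing one
has the largest sum. Hence two tight non-edges cannot be separated or nested when the crossing pairs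
are non-edges too. -/
lemma eps_monge (hn : 4 ≤ n) {i j k l : ℕ} (hij : i < j) (hjk : j < k) (hkl : k < l)
    (hl : l < n) : eps n i j + eps n k l < eps n i k + eps n j l := by
  rw [eps_of_lt hij, eps_of_lt hkl, eps_of_lt (hij.trans hjk), eps_of_lt (hjk.trans hkl)]
  have hn' : (4 : ℝ) ≤ n := by exact_mod_cast hn
  have hi0 : (0 : ℝ) ≤ i := Nat.cast_nonneg _
  have hij' : (i : ℝ) + 1 ≤ j := by exact_mod_cast hij
  have hjk' : (j : ℝ) + 1 ≤ k := by exact_mod_cast hjk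
  have hkl' : (k : ℝ) + 1 ≤ l := by exact_mod_cast hkl
  have hl' : (l : ℝ) + 1 ≤ n := by exact_mod_cast hl
  set N : ℝ := (n : ℝ)
  have hA : 0 < N ^ 2 + (i + 1) * N + (j + 1) := by positivity
  have hB : 0 < N ^ 2 + (i + 1) * N + (k + 1) := by positivity
  have hC : 0 < N ^ 2 + (j + 1) * N + (l + 1) := by positivity
  have hD : 0 < N ^ 2 + (k + 1) * N + (l + 1) := by positivity
  have e1 : 1 / (N ^ 2 + (i + 1) * N + (j + 1)) - 1 / (N ^ 2 + (i + 1) * N + (k + 1)) =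
      (k - j) / ((N ^ 2 + (i + 1) * N + (j + 1)) * (N ^ 2 + (i + 1) * N + (k + 1))) := by
    field_simp; ring
  have e2 : 1 / (N ^ 2 + (j + 1) * N + (l + 1)) - 1 / (N ^ 2 + (k + 1) * N + (l + 1)) =
      ((k - j) * N) / ((N ^ 2 + (j + 1) * N + (l + 1)) * (N ^ 2 + (k + 1) * N + (l + 1))) := by
    field_simp; ring
  have hub1 : N ^ 2 + (j + 1) * N + (l + 1) ≤ 2 * N ^ 2 - N + N := by nlinarith
  have hub2 : N ^ 2 + (k + 1) * N + (l + 1) ≤ 2 * N ^ 2 := by nlinarith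
  have hlb1 : N ^ 2 < N ^ 2 + (i + 1) * N + (j + 1) := by nlinarith
  have hlb2 : N ^ 2 < N ^ 2 + (i + 1) * N + (k + 1) := by nlinarith
  have hN2 : 0 < N ^ 2 := by positivity
  have hprod1 : (N ^ 2 + (j + 1) * N + (l + 1)) * (N ^ 2 + (k + 1) * N + (l + 1)) ≤
      4 * (N ^ 2 * N ^ 2) := by nlinarith
  have hprod2 : N ^ 2 * N ^ 2 <
      (N ^ 2 + (i + 1) * N + (j + 1)) * (N ^ 2 + (i + 1) * N + (k + 1)) :=
    mul_lt_mul'' hlb1 hlb2 hN2.le hN2.le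
  -- All denominators lie between `n²` and `2n²`, so the two products differ by a factor less than
  -- 4, which the extra factor `n ≥ 4` compensates.
  have key : (k - j) / ((N ^ 2 + (i + 1) * N + (j + 1)) * (N ^ 2 + (i + 1) * N + (k + 1))) <
      ((k - j) * N) / ((N ^ 2 + (j + 1) * N + (l + 1)) * (N ^ 2 + (k + 1) * N + (l + 1))) := by
    rw [div_lt_div_iff₀ (by positivity) (by positivity), mul_assoc]
    refine mul_lt_mul_of_pos_left ?_ (by linarith)
    have h5 : 0 ≤ (N - 4) * (N ^ 2 * N ^ 2) := mul_nonneg (by linarith) (by positivity)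
    have h6 := mul_lt_mul_of_pos_left hprod2 (by linarith : 0 < N)
    linarith
  linarith

lemma eps_nested (hn : 4 ≤ n) {i j k l : ℕ} (hij : i < j) (hjk : j < k) (hkl : k < l) :
    eps n i l + eps n j k < eps n i k + eps n j l := by
  rw [eps_of_lt (hij.trans (hjk.trans hkl)), eps_of_lt hjk, eps_of_lt (hij.trans hjk),
    eps_of_lt (hjk.trans hkl)]
  have hn' : (4 : ℝ) ≤ n := by exact_mod_cast hn
  have hi0 : (0 : ℝ) ≤ i := Nat.cast_nonneg _
  have hij' : (i : ℝ) + 1 ≤ j := by exact_mod_cast hij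
  have hkl' : (k : ℝ) + 1 ≤ l := by exact_mod_cast hkl
  set N : ℝ := (n : ℝ)
  have e1 : 1 / (N ^ 2 + (i + 1) * N + (k + 1)) - 1 / (N ^ 2 + (i + 1) * N + (l + 1)) =
      (l - k) / ((N ^ 2 + (i + 1) * N + (k + 1)) * (N ^ 2 + (i + 1) * N + (l + 1))) := by
    field_simp; ring
  have e2 : 1 / (N ^ 2 + (j + 1) * N + (k + 1)) - 1 / (N ^ 2 + (j + 1) * N + (l + 1)) =
      (l - k) / ((N ^ 2 + (j + 1) * N + (k + 1)) * (N ^ 2 + (j + 1) * N + (l + 1))) := by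
    field_simp; ring
  have hp : 0 < (N ^ 2 + (i + 1) * N + (k + 1)) * (N ^ 2 + (i + 1) * N + (l + 1)) := by positivity
  have key : (l - k) / ((N ^ 2 + (j + 1) * N + (k + 1)) * (N ^ 2 + (j + 1) * N + (l + 1))) <
      (l - k) / ((N ^ 2 + (i + 1) * N + (k + 1)) * (N ^ 2 + (i + 1) * N + (l + 1))) := by
    refine div_lt_div_of_pos_left (by linarith) hp ?_
    refine mul_lt_mul'' ?_ ?_ (by positivity) (by positivity) <;> nlinarith
  linarith

lemma graphMin_adj {i j : Fin n} : (graphMin n).Adj i j ↔ i ≠ j ∧ lab i = lab j := by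
  simp only [graphMin, lab, Ne, Fin.ext_iff]
  constructor
  · rintro ⟨h1, h2, h3⟩
    refine ⟨h1, ?_⟩
    split_ifs <;> omega
  · rintro ⟨h1, h2⟩
    split_ifs at h2 <;> omega

lemma dMin_self (i : Fin n) : dMin n i i = 0 := by simp [dMin, graphMetric]

lemma dMin_of_eq {i j : Fin n} (hij : i ≠ j) (h : lab i = lab j) : dMin n i j = 2 := by
  rw [dMin, graphMetric, if_neg hij, if_pos (graphMin_adj.2 ⟨hij, h⟩)]

lemma dMin_of_ne {i j : Fin n} (h : lab i ≠ lab j) : dMin n i j = 1 + eps n i j := by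
  have hij : i ≠ j := by rintro rfl; exact h rfl
  rw [dMin, graphMetric, if_neg hij, if_neg (fun h' => h (graphMin_adj.1 h').2), eps]
  have h1 : ((min i j : Fin n) : ℕ) = min (i : ℕ) j := by
    rcases le_total i j with h | h <;> simp [h]
  have h2 : ((max i j : Fin n) : ℕ) = max (i : ℕ) j := by
    rcases le_total i j with h | h <;> simp [h]
  rw [h1, h2]

lemma dMin_symm (i j : Fin n) : dMin n i j = dMin n j i := by
  by_cases hij : i = j
  · rw [hij]
  · by_cases h : lab i = lab j
    · rw [dMin_of_eq hij h, dMin_of_eq (Ne.symm hij) h.symm]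
    · rw [dMin_of_ne h, dMin_of_ne (Ne.symm h), eps_comm]

lemma one_le_dMin {i j : Fin n} (hij : i ≠ j) : 1 ≤ dMin n i j := by
  by_cases h : lab i = lab j
  · rw [dMin_of_eq hij h]; norm_num
  · rw [dMin_of_ne h]; have := eps_pos (n := n) i j; linarith

lemma dMin_le_two (hn : 4 ≤ n) (i j : Fin n) : dMin n i j ≤ 2 := by
  by_cases hij : i = j
  · rw [hij, dMin_self]; norm_num
  · by_cases h : lab i = lab j
    · rw [dMin_of_eq hij h]
    · rw [dMin_of_ne h]; have := eps_lt hn i j; linarith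

/-- Distances between distinct points lie between 1 and 2, so the triangle inequality is automatic.
-/
theorem isMetric_dMin (hn : 4 ≤ n) : IsMetric (dMin n) where
  diag := dMin_self
  symm := dMin_symm
  nonneg i j := by
    by_cases hij : i = j
    · rw [hij, dMin_self]
    · exact zero_le_one.trans (one_le_dMin hij)
  triangle i j k := by
    by_cases hij : i = j
    · rw [hij, dMin_self, zero_add]
    · by_cases hjk : j = k
      · rw [hjk, dMin_self, add_zero]
      · have h1 := one_le_dMin hij
        have h2 := one_le_dMin hjk
        have h3 := dMin_le_two hn i k
        linarith

end Perturbation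

/-- In a geometric graph on points in convex position in which any two edges cross or share a
point there are at most as many edges as points. -/
lemma card_le_of_thrackle {n : ℕ} {A : Finset (Fin n)} {H : Finset (Sym2 (Fin n))}
    (hA : ∀ p ∈ H, ∀ i ∈ p, i ∈ A) (hloop : ∀ i, s(i, i) ∉ H)
    (hsep : ∀ i j k l, i < j → j < k → k < l → s(i, j) ∈ H → s(k, l) ∉ H)
    (hnest : ∀ i j k l, i < j → j < k → k < l → s(i, l) ∈ H → s(j, k) ∉ H) :
    H.card ≤ A.card := by
  -- Each edge is charged to an endpoint from which it is the first edge in cyclic order. If an edge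
  -- `v < w` is not first at `v`, because of an edge `vu` with `v < u < w`, it is first at `w`: any
  -- edge at `w` coming earlier would be separated from `vu` or enclose it.
  have key : ∀ p ∈ H, ∃ v ∈ A, ∃ w, p = s(v, w) ∧ v ≠ w ∧
      ((v < w ∧ ∀ w', v < w' → s(v, w') ∈ H → w ≤ w') ∨
        (w < v ∧ ∀ w', s(v, w') ∈ H → w' < v ∧ w ≤ w')) := by
    have hlt : ∀ v w, v < w → s(v, w) ∈ H → ∃ v' ∈ A, ∃ w', s(v, w) = s(v', w') ∧ v' ≠ w' ∧
        ((v' < w' ∧ ∀ u, v' < u → s(v', u) ∈ H → w' ≤ u) ∨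
          (w' < v' ∧ ∀ u, s(v', u) ∈ H → u < v' ∧ w' ≤ u)) := by
      intro v w hvw hp
      by_cases h1 : ∀ u, v < u → s(v, u) ∈ H → w ≤ u
      · exact ⟨v, hA _ hp v (Sym2.mem_mk_left _ _), w, rfl, hvw.ne, Or.inl ⟨hvw, h1⟩⟩
      · push Not at h1
        obtain ⟨u, hvu, huH, huw⟩ := h1
        refine ⟨w, hA _ hp w (Sym2.mem_mk_right _ _), v, Sym2.eq_swap, hvw.ne',
          Or.inr ⟨hvw, fun u' hu' => ?_⟩⟩
        have hne : u' ≠ w := by rintro rfl; exact hloop _ hu'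
        have h2 : u' < w := by
          rcases lt_or_gt_of_ne hne with h | h
          · exact h
          · exact absurd hu' (hsep v u w u' hvu huw h huH)
        refine ⟨h2, not_lt.1 fun h3 => ?_⟩
        rw [Sym2.eq_swap] at hu'
        exact hnest u' v u w h3 hvu huw hu' huH
    intro p hp
    induction p using Sym2.ind with
    | _ v w =>
      have hvw : v ≠ w := by rintro rfl; exact hloop _ hp
      rcases lt_or_gt_of_ne hvw with h | h
      · exact hlt v w h hp
      · rw [Sym2.eq_swap] at hp ⊢
        exact hlt w v h hp
  rcases H.eq_empty_or_nonempty with rfl | ⟨p₀, -⟩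
  · simp
  have : Nonempty (Fin n) := ⟨p₀.out.1⟩
  choose! f hfA g hfg hne hfirst using key
  refine Finset.card_le_card_of_injOn f hfA fun p hp q hq hpq => ?_
  have hp := Finset.mem_coe.1 hp
  have hq := Finset.mem_coe.1 hq
  have e1 := hfg p hp
  have e2 := hfg q hq
  rw [← hpq] at e2
  have m1 : s(f p, g p) ∈ H := e1 ▸ hp
  have m2 : s(f p, g q) ∈ H := e2 ▸ hq
  have h1 := hfirst p hp
  have h2 := hfirst q hq
  rw [← hpq] at h2
  have : g p = g q := by
    rcases h1 with ⟨h1, h1'⟩ | ⟨h1, h1'⟩ <;> rcases h2 with ⟨h2, h2'⟩ | ⟨h2, h2'⟩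
    · exact le_antisymm (h1' _ h2 m2) (h2' _ h1 m1)
    · exact absurd (h2' _ m1).1 h1.not_gt
    · exact absurd (h1' _ m2).1 h2.not_gt
    · exact le_antisymm (h1' _ m2).2 (h2' _ m1).2
  rw [e1, e2, this]

end TightSpan

/-! ### Genericity of `d_min`: at most `n` tight pairs at every point. -/

namespace TightSpan

section Generic

variable {n : ℕ}

/-- The vertices of the triangles of `graphMin n`. -/
def vtx (a : Fin (n / 3)) (c : Fin 3) : Fin n := ⟨3 * a + c, by omega⟩

lemma lab_vtx (a : Fin (n / 3)) (c : Fin 3) : lab (vtx a c) = a := by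
  have h : ((vtx a c : Fin n) : ℕ) = 3 * a + c := rfl
  rw [lab, h, if_pos (by omega)]
  omega

lemma exists_eq_vtx {i : Fin n} {a : Fin (n / 3)} (h : lab i = a) : ∃ c, i = vtx a c := by
  simp only [lab] at h
  split_ifs at h with h1
  · exact ⟨⟨i - 3 * a, by omega⟩, Fin.ext (by simp only [vtx]; omega)⟩
  · omega

lemma vtx_injective (a : Fin (n / 3)) : Function.Injective (vtx a) := by
  intro c c' h
  simp only [vtx, Fin.mk.injEq] at h
  exact Fin.ext (by omega)

lemma eq_of_lab_eq {i j : Fin n} (hi : n / 3 ≤ lab i) (h : lab i = lab j) : i = j := by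
  simp only [lab] at hi h
  refine Fin.ext ?_
  split_ifs at hi h <;> omega

/-- The points with a given label. -/
def labFiber (n a : ℕ) : Finset (Fin n) := Finset.univ.filter fun i => lab i = a

lemma mem_labFiber {a : ℕ} {i : Fin n} : i ∈ labFiber n a ↔ lab i = a := by simp [labFiber]

lemma labFiber_eq (a : Fin (n / 3)) : labFiber n a = {vtx a 0, vtx a 1, vtx a 2} := by
  ext i
  rw [mem_labFiber]
  constructor
  · intro h
    obtain ⟨c, rfl⟩ := exists_eq_vtx h
    fin_cases c <;> simp
  · intro h
    simp only [Finset.mem_insert, Finset.mem_singleton] at h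
    rcases h with rfl | rfl | rfl <;> exact lab_vtx _ _

lemma card_labFiber (a : Fin (n / 3)) : (labFiber n a).card = 3 := by
  rw [labFiber_eq, Finset.card_eq_three]
  exact ⟨_, _, _, (vtx_injective a).ne (by decide), (vtx_injective a).ne (by decide),
    (vtx_injective a).ne (by decide), rfl⟩

lemma lab_lt (i : Fin n) : lab i < n + 1 := by
  simp only [lab]
  split_ifs <;> omega

lemma sum_card_labFiber (A : Finset (Fin n)) :
    ∑ a ∈ Finset.range (n + 1), (A.filter (· ∈ labFiber n a)).card = A.card := by
  rw [Finset.card_eq_sum_card_fiberwise (f := lab) (t := Finset.range (n + 1))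
    (fun i _ => by simpa using lab_lt i)]
  refine Finset.sum_congr rfl fun a _ => ?_
  congr 1
  ext i
  simp [mem_labFiber]

lemma sum_card_labFiber_univ : ∑ a ∈ Finset.range (n + 1), (labFiber n a).card = n := by
  have h := sum_card_labFiber (Finset.univ : Finset (Fin n))
  rw [Finset.card_univ, Fintype.card_fin] at h
  refine Eq.trans (Finset.sum_congr rfl fun a _ => ?_) h
  simp

lemma tight_of_eq {x : Fin n → ℝ} (hn : 4 ≤ n) {i j : Fin n} (hij : i ≠ j) (h : lab i = lab j) :
    s(i, j) ∈ tight (dMin n) x ↔ x i + x j = 2 := by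
  rw [(isMetric_dMin hn).mem_tight, dMin_of_eq hij h]

lemma tight_of_ne {x : Fin n → ℝ} (hn : 4 ≤ n) {i j : Fin n} (h : lab i ≠ lab j) :
    s(i, j) ∈ tight (dMin n) x ↔ x i + x j = 1 + eps n i j := by
  rw [(isMetric_dMin hn).mem_tight, dMin_of_ne h]

lemma two_le_add {x : Fin n → ℝ} (hx : x ∈ polyhedron (dMin n)) {i j : Fin n} (hij : i ≠ j)
    (h : lab i = lab j) : 2 ≤ x i + x j := by
  have := hx i j
  rwa [dMin_of_eq hij h] at this

lemma one_add_eps_le_add {x : Fin n → ℝ} (hx : x ∈ polyhedron (dMin n)) {i j : Fin n}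
    (h : lab i ≠ lab j) : 1 + eps n i j ≤ x i + x j := by
  have := hx i j
  rwa [dMin_of_ne h] at this

lemma loop_tight_iff {x : Fin n → ℝ} (hn : 4 ≤ n) {i : Fin n} :
    s(i, i) ∈ tight (dMin n) x ↔ x i = 0 := by
  rw [(isMetric_dMin hn).mem_tight, dMin_self]
  constructor <;> intro h <;> linarith

lemma le_of_small {x : Fin n → ℝ} (hx : x ∈ polyhedron (dMin n)) {z : Fin n}
    (hz : x z ≤ 1 / 16) {w : Fin n} (hw : w ≠ z) :
    15 / 16 ≤ x w ∧ (lab w = lab z → 31 / 16 ≤ x w) := by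
  by_cases h : lab w = lab z
  · have := two_le_add hx hw h
    exact ⟨by linarith, fun _ => by linarith⟩
  · have := one_add_eps_le_add hx h
    have := eps_pos (n := n) w z
    exact ⟨by linarith, fun h' => absurd h' h⟩

/-- If one coordinate is small, the tight pairs contain it or lie in one of the other
triangles. -/
lemma tight_cases_of_small (hn : 4 ≤ n) {x : Fin n → ℝ} (hx : x ∈ polyhedron (dMin n)) {z : Fin n}
    (hz : x z ≤ 1 / 16) {i j : Fin n} (h : s(i, j) ∈ tight (dMin n) x) :
    i = z ∨ j = z ∨ i ≠ j ∧ lab i = lab j ∧ lab i ≠ lab z := by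
  by_contra! hc
  obtain ⟨hi, hj, hc⟩ := hc
  have h1 := le_of_small hx hz hi
  have h2 := le_of_small hx hz hj
  by_cases hij : i = j
  · subst hij
    rw [loop_tight_iff hn] at h
    linarith
  · by_cases hl : lab i = lab j
    · have h3 := hc hij hl
      rw [tight_of_eq hn hij hl] at h
      have := h1.2 h3
      have := h2.2 (hl ▸ h3)
      linarith
    · rw [tight_of_ne hn hl] at h
      have := eps_lt hn i j
      linarith

/-- If all coordinates are large, the tight pairs lie in a triangle or join two points with
coordinates less than one. -/
lemma tight_cases_of_large (hn : 4 ≤ n) {x : Fin n → ℝ}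
    (hx : ∀ w, 1 / 16 < x w) {i j : Fin n} (h : s(i, j) ∈ tight (dMin n) x) :
    i ≠ j ∧ (lab i = lab j ∨ lab i ≠ lab j ∧ x i < 1 ∧ x j < 1) := by
  have hi := hx i
  have hj := hx j
  have hij : i ≠ j := by
    rintro rfl
    rw [loop_tight_iff hn] at h
    linarith
  refine ⟨hij, ?_⟩
  by_cases hl : lab i = lab j
  · exact Or.inl hl
  · rw [tight_of_ne hn hl] at h
    have := eps_lt hn i j
    exact Or.inr ⟨hl, by linarith, by linarith⟩

lemma card_filter_insert_le {β : Type*} [DecidableEq β] (P : β → Prop) [DecidablePred P] (b : β)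
    (s : Finset β) : ((insert b s).filter P).card ≤ (if P b then 1 else 0) + (s.filter P).card := by
  rw [Finset.filter_insert]
  split_ifs
  · rw [add_comm]; exact Finset.card_insert_le _ _
  · omega

open Classical in
-- Here `δ` is the small coordinate and `p, q, r` belong to a triangle avoiding its point. If `δ <
-- e₂` no triangle edge is tight. If `δ > e₀`, a tight pair at `δ` has its other coordinate below 1,
-- so there is at most one, and it excludes the opposite edge. Only in between can a fourth tight
-- pair occur.
lemma triangle_count_of_small {p q r δ e₀ e₁ e₂ : ℝ} (h01 : e₁ < e₀) (h12 : e₂ < e₁)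
    (hpq : 2 ≤ p + q) (hpr : 2 ≤ p + r) (hqr : 2 ≤ q + r) (hp : 1 + e₀ ≤ δ + p)
    (hq : 1 + e₁ ≤ δ + q) (hr : 1 + e₂ ≤ δ + r) :
    (if p + q = 2 then 1 else 0) + ((if p + r = 2 then 1 else 0) + ((if q + r = 2 then 1 else 0) +
      ((if δ + p = 1 + e₀ then 1 else 0) + ((if δ + q = 1 + e₁ then 1 else 0) +
        (if δ + r = 1 + e₂ then 1 else 0))))) ≤ 3 + if e₂ ≤ δ ∧ δ ≤ e₀ then 1 else 0 := by
  by_cases h1 : e₂ ≤ δ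
  · by_cases h2 : δ ≤ e₀
    · rw [if_pos (c := e₂ ≤ δ ∧ δ ≤ e₀) ⟨h1, h2⟩]
      split_ifs <;> first | (norm_num; done) | (exfalso; linarith)
    · rw [if_neg (c := e₂ ≤ δ ∧ δ ≤ e₀) (fun h => h2 h.2)]
      rw [not_le] at h2
      split_ifs <;> first | (norm_num; done) | (exfalso; linarith)
  · rw [if_neg (c := e₂ ≤ δ ∧ δ ≤ e₀) (fun h => h1 h.1)]
    rw [not_le] at h1
    rw [if_neg (by linarith), if_neg (by linarith), if_neg (by linarith)]
    split_ifs <;> norm_num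

open Classical in
-- At most one vertex of a triangle lies below 1, and then the opposite edge is not tight.
lemma triangle_count_of_large {p q r : ℝ}
    (hpq : 2 ≤ p + q) (hpr : 2 ≤ p + r) (hqr : 2 ≤ q + r) :
    ((if p + q = 2 then 1 else 0) + ((if p + r = 2 then 1 else 0) +
      (if q + r = 2 then 1 else 0))) + ((if p < 1 then 1 else 0) + ((if q < 1 then 1 else 0) +
        (if r < 1 then 1 else 0))) ≤ 3 := by
  split_ifs <;> first | (norm_num; done) | (exfalso; linarith)

open Classical in
-- Each tight pair is charged to a label. The label of `z` has a deficit of one, unless the loop at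
-- `z` is tight, and any other label has an excess of at most one. An excess needs `x z` in the
-- window of that triangle; the windows are disjoint and positive, so the loop or one excess at most
-- cancels the deficit.
lemma card_tight_le_of_small (hn : 4 ≤ n) {x : Fin n → ℝ} (hx : x ∈ polyhedron (dMin n))
    {z : Fin n} (hz : x z ≤ 1 / 16) : (tight (dMin n) x).card ≤ n := by
  set T := tight (dMin n) x with hT
  set B : ℕ → Finset (Sym2 (Fin n)) := fun a =>
    T.filter fun p => ∃ i j, p = s(i, j) ∧ lab j = a ∧ (i = z ∨ lab i = a) with hB
  have hcover : T ⊆ (Finset.range (n + 1)).biUnion B := by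
    intro p hp
    induction p using Sym2.ind with
    | _ i j =>
      rw [Finset.mem_biUnion]
      rcases tight_cases_of_small hn hx hz hp with h | h | h
      · exact ⟨lab j, Finset.mem_range.2 (lab_lt j),
          Finset.mem_filter.2 ⟨hp, i, j, rfl, rfl, Or.inl h⟩⟩
      · exact ⟨lab i, Finset.mem_range.2 (lab_lt i),
          Finset.mem_filter.2 ⟨hp, j, i, Sym2.eq_swap, rfl, Or.inl h⟩⟩
      · exact ⟨lab j, Finset.mem_range.2 (lab_lt j),
          Finset.mem_filter.2 ⟨hp, i, j, rfl, rfl, Or.inr h.2.1⟩⟩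
  set P : ℕ → Prop := fun a => (a = lab z ∧ x z = 0) ∨ (a ≠ lab z ∧ ∃ h : a < n / 3,
    eps n z (vtx ⟨a, h⟩ 2) ≤ x z ∧ x z ≤ eps n z (vtx ⟨a, h⟩ 0)) with hP
  have hbound : ∀ a, (B a).card + (if a = lab z then 1 else 0) ≤
      (labFiber n a).card + if P a then 1 else 0 := by
    intro a
    by_cases ha : a = lab z
    · have hsub : B a ⊆ ((labFiber n a).erase z).image (fun w => s(z, w)) ∪
          if x z = 0 then {s(z, z)} else ∅ := by
        intro p hp
        obtain ⟨hpT, i, j, rfl, hj, hi⟩ := Finset.mem_filter.1 hp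
        have hi' : lab i = a := by rcases hi with rfl | hi; exacts [ha.symm, hi]
        have hmain : ∀ w, lab w = a → s(z, w) ∈ T → s(z, w) ∈
            ((labFiber n a).erase z).image (fun w => s(z, w)) ∪
            if x z = 0 then {s(z, z)} else ∅ := by
          intro w hw hwT
          by_cases hwz : w = z
          · subst hwz
            rw [hT, loop_tight_iff hn] at hwT
            simp [hwT]
          · exact Finset.mem_union_left _ (Finset.mem_image.2
              ⟨w, Finset.mem_erase.2 ⟨hwz, mem_labFiber.2 hw⟩, rfl⟩)
        rcases tight_cases_of_small hn hx hz hpT with rfl | rfl | h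
        · exact hmain j hj hpT
        · rw [Sym2.eq_swap (a := i) (b := j)] at hpT ⊢
          exact hmain i hi' hpT
        · exact absurd (hi'.trans ha) h.2.2
      have h1 := (Finset.card_le_card hsub).trans (Finset.card_union_le _ _)
      have h2 := Finset.card_image_le (s := (labFiber n a).erase z) (f := fun w => s(z, w))
      have hzm : z ∈ labFiber n a := mem_labFiber.2 ha.symm
      rw [Finset.card_erase_of_mem hzm] at h2
      have h3 := Finset.card_pos.2 ⟨z, hzm⟩
      have h4 : (if x z = 0 then ({s(z, z)} : Finset (Sym2 (Fin n))) else ∅).card =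
          if P a then 1 else 0 := by
        by_cases h0 : x z = 0
        · rw [if_pos h0, if_pos (Or.inl ⟨ha, h0⟩), Finset.card_singleton]
        · rw [if_neg h0, if_neg (by rintro (h | h); exacts [h0 h.2, h.1 ha]), Finset.card_empty]
      rw [if_pos ha]
      omega
    · rw [if_neg ha, add_zero]
      by_cases ha3 : a < n / 3
      · set A : Fin (n / 3) := ⟨a, ha3⟩ with hA
        have hsub : B a ⊆ ({s(vtx A 0, vtx A 1), s(vtx A 0, vtx A 2), s(vtx A 1, vtx A 2),
            s(z, vtx A 0), s(z, vtx A 1), s(z, vtx A 2)} : Finset (Sym2 (Fin n))).filter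
            (· ∈ T) := by
          intro p hp
          obtain ⟨hpT, i, j, rfl, hj, hi⟩ := Finset.mem_filter.1 hp
          rw [Finset.mem_filter]
          refine ⟨?_, hpT⟩
          obtain ⟨c, rfl⟩ := exists_eq_vtx (a := A) hj
          rcases hi with rfl | hi
          · fin_cases c <;> simp
          · have hne : i ≠ vtx A c := by
              rintro rfl
              rcases tight_cases_of_small hn hx hz hpT with h | h | h
              · exact ha (hi.symm.trans (by rw [h]))
              · exact ha (hi.symm.trans (by rw [h]))
              · exact h.1 rfl
            obtain ⟨c', rfl⟩ := exists_eq_vtx (a := A) hi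
            fin_cases c <;> fin_cases c' <;> first | exact absurd rfl hne | simp
        have hlab : ∀ c, lab z ≠ lab (vtx A c) := fun c => by
          rw [lab_vtx]; exact Ne.symm ha
        have hzne : ∀ c, (z : ℕ) ≠ vtx A c := fun c h => hlab c (by rw [Fin.ext h])
        have hvne : ∀ c c' : Fin 3, c ≠ c' → vtx A c ≠ vtx A c' := fun c c' h =>
          (vtx_injective A).ne h
        have hl2 : ∀ c c', lab (vtx A c) = lab (vtx A c') := fun c c' => by
          rw [lab_vtx, lab_vtx]
        have hcnt := triangle_count_of_small (p := x (vtx A 0)) (q := x (vtx A 1))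
          (r := x (vtx A 2)) (δ := x z) (e₀ := eps n z (vtx A 0)) (e₁ := eps n z (vtx A 1))
          (e₂ := eps n z (vtx A 2))
          (eps_anti hn (by simp [vtx]) (hzne 0) (hzne 1))
          (eps_anti hn (by simp [vtx]) (hzne 1) (hzne 2))
          (two_le_add hx (hvne 0 1 (by decide)) (hl2 _ _))
          (two_le_add hx (hvne 0 2 (by decide)) (hl2 _ _))
          (two_le_add hx (hvne 1 2 (by decide)) (hl2 _ _))
          (one_add_eps_le_add hx (hlab 0)) (one_add_eps_le_add hx (hlab 1))
          (one_add_eps_le_add hx (hlab 2))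
        have hPa : P a ↔ eps n z (vtx A 2) ≤ x z ∧ x z ≤ eps n z (vtx A 0) := by
          constructor
          · rintro (h | ⟨-, _, h⟩)
            · exact absurd h.1 ha
            · exact h
          · intro h
            exact Or.inr ⟨ha, ha3, h⟩
        rw [show (labFiber n a).card = 3 from card_labFiber A]
        simp only [hPa]
        refine le_trans ?_ hcnt
        refine (Finset.card_le_card hsub).trans ?_
        simp only [← tight_of_eq hn (hvne 0 1 (by decide)) (hl2 _ _),
          ← tight_of_eq hn (hvne 0 2 (by decide)) (hl2 _ _),
          ← tight_of_eq hn (hvne 1 2 (by decide)) (hl2 _ _), ← tight_of_ne hn (hlab 0),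
          ← tight_of_ne hn (hlab 1), ← tight_of_ne hn (hlab 2), ← hT]
        refine (card_filter_insert_le _ _ _).trans (Nat.add_le_add_left ?_ _)
        refine (card_filter_insert_le _ _ _).trans (Nat.add_le_add_left ?_ _)
        refine (card_filter_insert_le _ _ _).trans (Nat.add_le_add_left ?_ _)
        refine (card_filter_insert_le _ _ _).trans (Nat.add_le_add_left ?_ _)
        refine (card_filter_insert_le _ _ _).trans (Nat.add_le_add_left ?_ _)
        rw [Finset.filter_singleton]
        split_ifs <;> simp
      · have hsub : B a ⊆ (labFiber n a).image fun w => s(z, w) := by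
          intro p hp
          obtain ⟨hpT, i, j, rfl, hj, hi⟩ := Finset.mem_filter.1 hp
          refine Finset.mem_image.2 ⟨j, mem_labFiber.2 hj, ?_⟩
          rcases hi with rfl | hi
          · rfl
          · exfalso
            have hij : i = j := eq_of_lab_eq (by omega) (hi.trans hj.symm)
            rcases tight_cases_of_small hn hx hz hpT with h | h | h
            · exact ha (hi.symm.trans (by rw [h]))
            · exact ha (hj.symm.trans (by rw [h]))
            · exact h.1 hij
        have := (Finset.card_le_card hsub).trans Finset.card_image_le
        omega
  have hPone : ((Finset.range (n + 1)).filter P).card ≤ 1 := by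
    refine Finset.card_le_one.2 fun a ha b hb => ?_
    have ha := (Finset.mem_filter.1 ha).2
    have hb := (Finset.mem_filter.1 hb).2
    have hlt : ∀ a b, P a → P b → ¬ a < b := by
      rintro a b (⟨rfl, ha⟩ | ⟨ha, h3, ha1, ha2⟩) (⟨rfl, hb⟩ | ⟨hb, h3', hb1, hb2⟩) hab
      · exact lt_irrefl _ hab
      · have := eps_pos (n := n) z (vtx ⟨b, h3'⟩ 2)
        linarith
      · have := eps_pos (n := n) z (vtx ⟨a, h3⟩ 2)
        linarith
      · have := eps_anti hn (z := z) (w := vtx ⟨a, h3⟩ 2) (w' := vtx ⟨b, h3'⟩ 0)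
          (by simp [vtx]; omega)
          (fun h => ha (by rw [Fin.ext h, lab_vtx]))
          (fun h => hb (by rw [Fin.ext h, lab_vtx]))
        linarith
    exact le_antisymm (not_lt.1 (hlt b a hb ha)) (not_lt.1 (hlt a b ha hb))
  have hPsum : ∑ a ∈ Finset.range (n + 1), (if P a then 1 else 0) ≤ 1 :=
    (Finset.card_filter P _).symm.trans_le hPone
  have hsum := Finset.sum_le_sum fun a (_ : a ∈ Finset.range (n + 1)) => hbound a
  rw [Finset.sum_add_distrib, Finset.sum_add_distrib, sum_card_labFiber_univ,
    Finset.sum_ite_eq', if_pos (Finset.mem_range.2 (lab_lt z))] at hsum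
  have := (Finset.card_le_card hcover).trans Finset.card_biUnion_le
  omega

open Classical in
-- Tight pairs between different labels join points of `A`, at most one per triangle, and form a
-- thrackle, so there are at most `A.card` of them. In each triangle the tight edges and the points
-- of `A` together number at most three.
lemma card_tight_le_of_large (hn : 4 ≤ n) {x : Fin n → ℝ} (hx : x ∈ polyhedron (dMin n))
    (hlarge : ∀ w, 1 / 16 < x w) : (tight (dMin n) x).card ≤ n := by
  set T := tight (dMin n) x with hT
  set A : Finset (Fin n) := Finset.univ.filter fun i => x i < 1 with hA
  have hmemA : ∀ i, i ∈ A ↔ x i < 1 := fun i => by simp [hA]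
  have hAlab : ∀ i j, i ∈ A → j ∈ A → i ≠ j → lab i ≠ lab j := fun i j hi hj hij h => by
    have := two_le_add hx hij h
    rw [hmemA] at hi hj
    linarith
  set H := T.filter fun p => ∃ i j, p = s(i, j) ∧ lab i ≠ lab j with hH
  set B : ℕ → Finset (Sym2 (Fin n)) := fun a =>
    T.filter fun p => ∃ i j, p = s(i, j) ∧ lab i = a ∧ lab j = a with hB
  have hcover : T ⊆ (Finset.range (n + 1)).biUnion B ∪ H := by
    intro p hp
    induction p using Sym2.ind with
    | _ i j =>
      by_cases h : lab i = lab j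
      · exact Finset.mem_union_left _ (Finset.mem_biUnion.2 ⟨lab i, Finset.mem_range.2 (lab_lt i),
          Finset.mem_filter.2 ⟨hp, i, j, rfl, rfl, h.symm⟩⟩)
      · exact Finset.mem_union_right _ (Finset.mem_filter.2 ⟨hp, i, j, rfl, h⟩)
  have hHmem : ∀ i j, s(i, j) ∈ H → i ∈ A ∧ j ∈ A ∧ i ≠ j ∧ x i + x j = 1 + eps n i j := by
    intro i j h
    obtain ⟨hT', i', j', he, hl⟩ := Finset.mem_filter.1 h
    have hl' : lab i ≠ lab j := by
      rcases Sym2.eq_iff.1 he with ⟨rfl, rfl⟩ | ⟨rfl, rfl⟩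
      · exact hl
      · exact Ne.symm hl
    obtain ⟨h1, h2 | ⟨-, h2, h3⟩⟩ := tight_cases_of_large hn hlarge hT'
    · exact absurd h2 hl'
    · exact ⟨(hmemA i).2 h2, (hmemA j).2 h3, h1, (tight_of_ne hn hl').1 hT'⟩
  have hHcard : H.card ≤ A.card := by
    refine card_le_of_thrackle (fun p hp i hi => ?_) (fun i hi => (hHmem i i hi).2.2.1 rfl) ?_ ?_
    · obtain ⟨j, rfl⟩ := Sym2.mem_iff_exists.1 hi
      exact (hHmem i j hp).1
    · intro i j k l hij hjk hkl h1 h2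
      obtain ⟨hi, hj, -, e1⟩ := hHmem _ _ h1
      obtain ⟨hk, hl, -, e2⟩ := hHmem _ _ h2
      have e3 := one_add_eps_le_add hx (hAlab i k hi hk (hij.trans hjk).ne)
      have e4 := one_add_eps_le_add hx (hAlab j l hj hl (hjk.trans hkl).ne)
      have := eps_monge hn (i := i) (j := j) (k := k) (l := l) hij hjk hkl l.2
      linarith
    · intro i j k l hij hjk hkl h1 h2
      obtain ⟨hi, hl, -, e1⟩ := hHmem _ _ h1
      obtain ⟨hj, hk, -, e2⟩ := hHmem _ _ h2
      have e3 := one_add_eps_le_add hx (hAlab i k hi hk (hij.trans hjk).ne)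
      have e4 := one_add_eps_le_add hx (hAlab j l hj hl (hjk.trans hkl).ne)
      have := eps_nested hn (i := i) (j := j) (k := k) (l := l) hij hjk hkl
      linarith
  have hbound : ∀ a, (B a).card + (A.filter (· ∈ labFiber n a)).card ≤ (labFiber n a).card := by
    intro a
    by_cases ha3 : a < n / 3
    · set v : Fin (n / 3) := ⟨a, ha3⟩ with hv
      have hvne : ∀ c c' : Fin 3, c ≠ c' → vtx v c ≠ vtx v c' := fun c c' h =>
        (vtx_injective v).ne h
      have hl2 : ∀ c c', lab (vtx v c) = lab (vtx v c') := fun c c' => by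
        rw [lab_vtx, lab_vtx]
      have hsub : B a ⊆ ({s(vtx v 0, vtx v 1), s(vtx v 0, vtx v 2),
          s(vtx v 1, vtx v 2)} : Finset (Sym2 (Fin n))).filter (· ∈ T) := by
        intro p hp
        obtain ⟨hpT, i, j, rfl, hi, hj⟩ := Finset.mem_filter.1 hp
        rw [Finset.mem_filter]
        refine ⟨?_, hpT⟩
        have hne := (tight_cases_of_large hn hlarge hpT).1
        obtain ⟨c, rfl⟩ := exists_eq_vtx (a := v) hi
        obtain ⟨c', rfl⟩ := exists_eq_vtx (a := v) hj
        fin_cases c <;> fin_cases c' <;> first | exact absurd rfl hne | simp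
      have hfil : A.filter (· ∈ labFiber n a) =
          ({vtx v 0, vtx v 1, vtx v 2} : Finset (Fin n)).filter (x · < 1) := by
        rw [← labFiber_eq v]
        ext i
        simp only [Finset.mem_filter, hmemA]
        exact and_comm
      have hcnt := triangle_count_of_large
        (two_le_add hx (hvne 0 1 (by decide)) (hl2 _ _))
        (two_le_add hx (hvne 0 2 (by decide)) (hl2 _ _))
        (two_le_add hx (hvne 1 2 (by decide)) (hl2 _ _))
      rw [show (labFiber n a).card = 3 from card_labFiber v, hfil]
      refine le_trans (Nat.add_le_add (Finset.card_le_card hsub) le_rfl) (le_trans ?_ hcnt)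
      simp only [← tight_of_eq hn (hvne 0 1 (by decide)) (hl2 _ _),
        ← tight_of_eq hn (hvne 0 2 (by decide)) (hl2 _ _),
        ← tight_of_eq hn (hvne 1 2 (by decide)) (hl2 _ _), ← hT]
      refine Nat.add_le_add ?_ ?_
      · refine (card_filter_insert_le _ _ _).trans (Nat.add_le_add_left ?_ _)
        refine (card_filter_insert_le _ _ _).trans (Nat.add_le_add_left ?_ _)
        rw [Finset.filter_singleton]
        split_ifs <;> simp
      · refine (card_filter_insert_le _ _ _).trans (Nat.add_le_add_left ?_ _)
        refine (card_filter_insert_le _ _ _).trans (Nat.add_le_add_left ?_ _)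
        rw [Finset.filter_singleton]
        split_ifs <;> simp
    · have hB0 : B a = ∅ := by
        refine Finset.eq_empty_of_forall_notMem fun p hp => ?_
        obtain ⟨hpT, i, j, rfl, hi, hj⟩ := Finset.mem_filter.1 hp
        exact (tight_cases_of_large hn hlarge hpT).1
          (eq_of_lab_eq (by omega) (hi.trans hj.symm))
      rw [hB0, Finset.card_empty, zero_add]
      exact Finset.card_le_card fun i hi => (Finset.mem_filter.1 hi).2
  have hsum := Finset.sum_le_sum fun a (_ : a ∈ Finset.range (n + 1)) => hbound a
  rw [Finset.sum_add_distrib, sum_card_labFiber, sum_card_labFiber_univ] at hsum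
  have h1 := (Finset.card_le_card hcover).trans (Finset.card_union_le _ _)
  have h2 := Finset.card_biUnion_le (s := Finset.range (n + 1)) (t := B)
  omega

theorem isGeneric_dMin (hn : 4 ≤ n) : IsGeneric (dMin n) := by
  obtain ⟨x₀, hx₀, h₀⟩ := (isMetric_dMin hn).exists_tight_eq_empty
  rw [IsGeneric, polyhedron_eq_halfspaces]
  rw [polyhedron_eq_halfspaces] at hx₀
  refine isSimplePolyhedron_of_card_le hx₀ h₀ fun v hv _ => ?_
  rw [← polyhedron_eq_halfspaces] at hv
  -- The threshold exceeds every perturbation, as `eps < 1/n² ≤ 1/16`. A coordinate below it makes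
  -- all others at least `15/16`; with all coordinates above it, both ends of a tight non-edge are
  -- below 1.
  by_cases h : ∃ z, v z ≤ 1 / 16
  · obtain ⟨z, hz⟩ := h
    exact card_tight_le_of_small hn hv hz
  · push Not at h
    exact card_tight_le_of_large hn hv h

end Generic

end TightSpan

/-! ### Tight pairs of a covering set at a single triangle. -/

namespace TightSpan

section Pieces

variable {n : ℕ}

/-- The path with two edges in a triangle with a given centre. -/
def star (a : Fin (n / 3)) (c : Fin 3) : Finset (Sym2 (Fin n)) :=
  {s(vtx a c, vtx a (c + 1)), s(vtx a c, vtx a (c + 2))}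

/-- The edge from `z` to the first vertex of a triangle together with the opposite edge. -/
def cap (z : Fin n) (a : Fin (n / 3)) : Finset (Sym2 (Fin n)) :=
  {s(z, vtx a 0), s(vtx a 1, vtx a 2)}

/-- The edges from `z` to the vertices of a triangle. -/
def full (z : Fin n) (a : Fin (n / 3)) : Finset (Sym2 (Fin n)) :=
  {s(z, vtx a 0), s(z, vtx a 1), s(z, vtx a 2)}

lemma vtx_ne (a : Fin (n / 3)) {c c' : Fin 3} (h : c ≠ c') : vtx a c ≠ vtx a c' :=
  (vtx_injective a).ne h

lemma lab_vtx_eq (a : Fin (n / 3)) (c c' : Fin 3) : lab (vtx a c) = lab (vtx a c') := by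
  rw [lab_vtx, lab_vtx]

lemma card_star (a : Fin (n / 3)) (c : Fin 3) : (star a c).card = 2 := by
  refine Finset.card_pair fun h => ?_
  exact vtx_ne a (by fin_cases c <;> decide) (Sym2.congr_right.1 h)

lemma card_cap {z : Fin n} {a : Fin (n / 3)} (hz : lab z ≠ a) : (cap z a).card = 2 := by
  refine Finset.card_pair fun h => hz ?_
  rcases Sym2.eq_iff.1 h with ⟨rfl, -⟩ | ⟨rfl, -⟩ <;> exact lab_vtx _ _

lemma card_full (z : Fin n) (a : Fin (n / 3)) : (full z a).card = 3 := by
  refine Finset.card_eq_three.2 ⟨_, _, _, fun h => ?_, fun h => ?_, fun h => ?_, rfl⟩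
  all_goals exact vtx_ne a (by decide) (Sym2.congr_right.1 h)

/-- The pairs attached to a triangle: they meet it and do not contain other points than its
vertices and `z`. -/
def Attached (z : Fin n) (a : Fin (n / 3)) (p : Sym2 (Fin n)) : Prop :=
  (∃ i ∈ p, lab i = a) ∧ ∀ j ∈ p, lab j = a ∨ j = z

lemma lab_of_mem_star {a : Fin (n / 3)} {c : Fin 3} {p : Sym2 (Fin n)} (hp : p ∈ star a c)
    {j : Fin n} (hj : j ∈ p) : lab j = a := by
  simp only [star, Finset.mem_insert, Finset.mem_singleton] at hp
  rcases hp with rfl | rfl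
  all_goals
    rcases Sym2.mem_iff.1 hj with rfl | rfl <;> exact lab_vtx _ _

lemma attached_star (z : Fin n) {a : Fin (n / 3)} {c : Fin 3} {p : Sym2 (Fin n)}
    (hp : p ∈ star a c) : Attached z a p := by
  refine ⟨?_, fun j hj => Or.inl (lab_of_mem_star hp hj)⟩
  induction p using Sym2.ind with
  | _ i j => exact ⟨i, Sym2.mem_mk_left _ _, lab_of_mem_star hp (Sym2.mem_mk_left _ _)⟩

lemma attached_mk_vtx (z : Fin n) (a : Fin (n / 3)) (c : Fin 3) : Attached z a s(z, vtx a c) := by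
  refine ⟨⟨_, Sym2.mem_mk_right _ _, lab_vtx _ _⟩, fun j hj => ?_⟩
  rcases Sym2.mem_iff.1 hj with rfl | rfl
  · exact Or.inr rfl
  · exact Or.inl (lab_vtx _ _)

lemma attached_cap {z : Fin n} {a : Fin (n / 3)} {p : Sym2 (Fin n)}
    (hp : p ∈ cap z a) : Attached z a p := by
  simp only [cap, Finset.mem_insert, Finset.mem_singleton] at hp
  rcases hp with rfl | rfl
  · exact attached_mk_vtx z a 0
  · refine ⟨⟨_, Sym2.mem_mk_right _ _, lab_vtx _ _⟩, fun j hj => ?_⟩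
    rcases Sym2.mem_iff.1 hj with rfl | rfl <;> exact Or.inl (lab_vtx _ _)

lemma attached_full {z : Fin n} {a : Fin (n / 3)} {p : Sym2 (Fin n)}
    (hp : p ∈ full z a) : Attached z a p := by
  simp only [full, Finset.mem_insert, Finset.mem_singleton] at hp
  rcases hp with rfl | rfl | rfl <;> exact attached_mk_vtx z a _

/-- The pieces at different triangles are thus disjoint and their sizes add up. -/
lemma Attached.eq {z : Fin n} {a b : Fin (n / 3)} {p : Sym2 (Fin n)} (ha : Attached z a p)
    (hb : Attached z b p) : a = b := by
  obtain ⟨⟨i, hi, hia⟩, ha⟩ := ha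
  obtain ⟨⟨j, hj, hjb⟩, hb⟩ := hb
  by_contra hab
  have hab' : (a : ℕ) ≠ b := fun h => hab (Fin.ext h)
  have h1 : i = z := (hb i hi).resolve_left fun h => hab' (hia.symm.trans h)
  have h2 : j = z := (ha j hj).resolve_left fun h => hab' (h.symm.trans hjb)
  exact hab' (by rw [← hia, ← hjb, h1, h2])

lemma Covers.exists_mk {S : Finset (Sym2 (Fin n))} (h : Covers S) (i : Fin n) :
    ∃ j, s(i, j) ∈ S := by
  obtain ⟨p, hp, hip⟩ := h i
  obtain ⟨j, rfl⟩ := Sym2.mem_iff_exists.1 hip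
  exact ⟨j, hp⟩

lemma mem_mk_of_mem_fiber {a : Fin (n / 3)} {c : Fin 3} {j : Fin n} {T : Finset (Sym2 (Fin n))}
    (hT : s(vtx a c, j) ∈ T) (hj : lab j = a) (hne : vtx a c ≠ j) :
    s(vtx a c, vtx a (c + 1)) ∈ T ∨ s(vtx a c, vtx a (c + 2)) ∈ T := by
  obtain ⟨c', rfl⟩ := exists_eq_vtx hj
  have key : ∀ c c' : Fin 3, c ≠ c' → c' = c + 1 ∨ c' = c + 2 := by decide
  rcases key c c' fun h => hne (by rw [h]) with rfl | rfl
  · exact Or.inl hT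
  · exact Or.inr hT

/-- If all coordinates are large, the tight pairs contain a path in each triangle. -/
lemma exists_star_of_large (hn : 4 ≤ n) {x : Fin n → ℝ} (hx : x ∈ polyhedron (dMin n))
    (hc : Covers (tight (dMin n) x)) (hlarge : ∀ w, 1 / 16 < x w) (a : Fin (n / 3)) :
    ∃ c, star a c ⊆ tight (dMin n) x := by
  -- The centre is a vertex with least coordinate: the other two are at least 1, so they are covered
  -- inside the triangle, and minimality makes their edges to `c` tight.
  obtain ⟨c, -, hmin⟩ := Finset.exists_min_image Finset.univ (fun c => x (vtx a c))
    ⟨0, Finset.mem_univ _⟩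
  have hmin : ∀ c', x (vtx a c) ≤ x (vtx a c') := fun c' => hmin c' (Finset.mem_univ _)
  have htight : ∀ c c' : Fin 3, c ≠ c' → (s(vtx a c, vtx a c') ∈ tight (dMin n) x ↔
      x (vtx a c) + x (vtx a c') = 2) := fun c c' h =>
    tight_of_eq hn (vtx_ne a h) (lab_vtx_eq a c c')
  have hadd : ∀ c c' : Fin 3, c ≠ c' → 2 ≤ x (vtx a c) + x (vtx a c') := fun c c' h =>
    two_le_add hx (vtx_ne a h) (lab_vtx_eq a c c')
  have hin : ∀ c', 1 ≤ x (vtx a c') → x (vtx a c') + x (vtx a (c' + 1)) = 2 ∨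
      x (vtx a c') + x (vtx a (c' + 2)) = 2 := by
    intro c' h1
    obtain ⟨j, hj⟩ := hc.exists_mk (vtx a c')
    obtain ⟨hne, hl | ⟨-, hl, -⟩⟩ := tight_cases_of_large hn hlarge hj
    · rw [lab_vtx] at hl
      have := mem_mk_of_mem_fiber hj hl.symm hne
      rwa [htight _ _ (by fin_cases c' <;> decide),
        htight _ _ (by fin_cases c' <;> decide)] at this
    · linarith
  refine ⟨c, ?_⟩
  have n1 : c ≠ c + 1 := by fin_cases c <;> decide
  have n2 : c ≠ c + 2 := by fin_cases c <;> decide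
  have n3 : c + 1 ≠ c + 2 := by fin_cases c <;> decide
  have a1 := hadd _ _ n1
  have a2 := hadd _ _ n2
  have m1 := hmin (c + 1)
  have m2 := hmin (c + 2)
  have i1 := hin (c + 1) (by linarith)
  have i2 := hin (c + 2) (by linarith)
  have e1 : c + 1 + 1 = c + 2 := by fin_cases c <;> rfl
  have e2 : c + 1 + 2 = c := by fin_cases c <;> rfl
  have e3 : c + 2 + 1 = c := by fin_cases c <;> rfl
  have e4 : c + 2 + 2 = c + 1 := by fin_cases c <;> rfl
  rw [e1, e2] at i1
  rw [e3, e4] at i2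
  intro p hp
  simp only [star, Finset.mem_insert, Finset.mem_singleton] at hp
  rcases hp with rfl | rfl
  · rw [htight _ _ n1]
    rcases i1 with i1 | i1 <;> linarith
  · rw [htight _ _ n2]
    rcases i2 with i2 | i2 <;> linarith

/-- The tight pairs at a triangle not containing the point `z` with a small coordinate. -/
lemma pieces_of_small (hn : 4 ≤ n) {x : Fin n → ℝ} (hx : x ∈ polyhedron (dMin n))
    (hc : Covers (tight (dMin n) x)) {z : Fin n} (hz : x z ≤ 1 / 16) {a : Fin (n / 3)}
    (ha : lab z ≠ a) :
    (∃ c, star a c ⊆ tight (dMin n) x ∧ eps n z (vtx a c) ≤ x z) ∨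
      (cap z a ⊆ tight (dMin n) x ∧ x z ≤ eps n z (vtx a 0) ∧
        eps n z (vtx a 1) + eps n z (vtx a 2) ≤ 2 * x z) ∨ full z a ⊆ tight (dMin n) x := by
  set T := tight (dMin n) x with hT
  have hzne : ∀ c, (z : ℕ) ≠ vtx a c := fun c h => ha (by rw [Fin.ext h, lab_vtx])
  have hzlab : ∀ c, lab z ≠ lab (vtx a c) := fun c => by rwa [lab_vtx]
  have htight : ∀ c c' : Fin 3, c ≠ c' → s(vtx a c, vtx a c') ∈ T →
      x (vtx a c) + x (vtx a c') = 2 := fun c c' h =>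
    (tight_of_eq hn (vtx_ne a h) (lab_vtx_eq a c c')).1
  have hadd : ∀ c c' : Fin 3, c ≠ c' → 2 ≤ x (vtx a c) + x (vtx a c') := fun c c' h =>
    two_le_add hx (vtx_ne a h) (lab_vtx_eq a c c')
  have hztight : ∀ c, s(z, vtx a c) ∈ T → x z + x (vtx a c) = 1 + eps n z (vtx a c) := fun c =>
    (tight_of_ne hn (hzlab c)).1
  have hzadd : ∀ c, 1 + eps n z (vtx a c) ≤ x z + x (vtx a c) := fun c =>
    one_add_eps_le_add hx (hzlab c)
  have hcov : ∀ c, s(z, vtx a c) ∈ T ∨ s(vtx a c, vtx a (c + 1)) ∈ T ∨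
      s(vtx a c, vtx a (c + 2)) ∈ T := by
    intro c
    obtain ⟨j, hj⟩ := hc.exists_mk (vtx a c)
    rcases tight_cases_of_small hn hx hz hj with h | h | h
    · exact absurd (by rw [h]) (hzlab c)
    · left; rw [Sym2.eq_swap]; exact h ▸ hj
    · right
      exact mem_mk_of_mem_fiber hj (h.2.1.symm.trans (lab_vtx _ _)) h.1
  have hstar : ∀ c, s(vtx a c, vtx a (c + 1)) ∈ T → s(vtx a c, vtx a (c + 2)) ∈ T →
      star a c ⊆ T ∧ eps n z (vtx a c) ≤ x z := by
    intro c h1 h2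
    have e1 := htight _ _ (by fin_cases c <;> decide) h1
    have e2 := htight _ _ (by fin_cases c <;> decide) h2
    have e3 := hadd (c + 1) (c + 2) (by fin_cases c <;> decide)
    have e4 := hzadd c
    refine ⟨fun p hp => ?_, by linarith⟩
    simp only [star, Finset.mem_insert, Finset.mem_singleton] at hp
    rcases hp with rfl | rfl <;> assumption
  -- These two bounds are compatible only for `c = 0`: convexity of `eps` excludes `c = 1`,
  -- monotonicity excludes `c = 2`.
  have hcap : ∀ c, s(z, vtx a c) ∈ T → s(vtx a (c + 1), vtx a (c + 2)) ∈ T →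
      x z ≤ eps n z (vtx a c) ∧
        eps n z (vtx a (c + 1)) + eps n z (vtx a (c + 2)) ≤ 2 * x z := by
    intro c h1 h2
    have e1 := hztight _ h1
    have e2 := htight _ _ (by fin_cases c <;> decide) h2
    have e3 := hadd c (c + 1) (by fin_cases c <;> decide)
    have e4 := hadd c (c + 2) (by fin_cases c <;> decide)
    have e5 := hzadd (c + 1)
    have e6 := hzadd (c + 2)
    exact ⟨by linarith, by linarith⟩
  have h01 : eps n z (vtx a 1) < eps n z (vtx a 0) :=
    eps_anti hn (by simp [vtx]) (hzne 0) (hzne 1)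
  have h12 : eps n z (vtx a 2) < eps n z (vtx a 1) :=
    eps_anti hn (by simp [vtx]) (hzne 1) (hzne 2)
  have hconv : 2 * eps n z (vtx a 1) < eps n z (vtx a 0) + eps n z (vtx a 2) := by
    have v0 : ((vtx a 0 : Fin n) : ℕ) = 3 * a := rfl
    have v1 : ((vtx a 1 : Fin n) : ℕ) = 3 * a + 1 := rfl
    have v2 : ((vtx a 2 : Fin n) : ℕ) = 3 * a + 2 := rfl
    have z0 := hzne 0
    have z1 := hzne 1
    have z2 := hzne 2
    rw [v0] at z0
    rw [v1] at z1
    rw [v2] at z2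
    rw [v0, v1, v2]
    exact eps_convex hn (by omega)
  -- The cases are which triangle edges are tight: two or more give a path, exactly one forces the
  -- vertex it misses to be joined to `z`, and none joins all three to `z`.
  by_cases I0 : s(vtx a 1, vtx a 2) ∈ T
  · by_cases I1 : s(vtx a 2, vtx a 0) ∈ T
    · exact Or.inl ⟨2, hstar 2 I1 (by rw [Sym2.eq_swap]; exact I0)⟩
    · by_cases I2 : s(vtx a 0, vtx a 1) ∈ T
      · exact Or.inl ⟨1, hstar 1 I0 (by rw [Sym2.eq_swap]; exact I2)⟩
      · right; left
        have h1 : s(z, vtx a 0) ∈ T := by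
          rcases hcov 0 with h | h | h
          · exact h
          · exact absurd h I2
          · rw [Sym2.eq_swap] at h; exact absurd h I1
        refine ⟨fun p hp => ?_, hcap 0 h1 I0⟩
        simp only [cap, Finset.mem_insert, Finset.mem_singleton] at hp
        rcases hp with rfl | rfl <;> assumption
  · by_cases I1 : s(vtx a 2, vtx a 0) ∈ T
    · by_cases I2 : s(vtx a 0, vtx a 1) ∈ T
      · exact Or.inl ⟨0, hstar 0 I2 (by rw [Sym2.eq_swap]; exact I1)⟩
      · exfalso
        have h1 : s(z, vtx a 1) ∈ T := by
          rcases hcov 1 with h | h | h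
          · exact h
          · exact absurd h I0
          · rw [Sym2.eq_swap] at h; exact absurd h I2
        obtain ⟨c1, c2⟩ := hcap 1 h1 I1
        change eps n z (vtx a 2) + eps n z (vtx a 0) ≤ _ at c2
        linarith
    · by_cases I2 : s(vtx a 0, vtx a 1) ∈ T
      · exfalso
        have h1 : s(z, vtx a 2) ∈ T := by
          rcases hcov 2 with h | h | h
          · exact h
          · exact absurd h I1
          · rw [Sym2.eq_swap] at h; exact absurd h I0
        obtain ⟨c1, c2⟩ := hcap 2 h1 I2
        change eps n z (vtx a 0) + eps n z (vtx a 1) ≤ _ at c2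
        linarith
      · right; right
        have hz0 : s(z, vtx a 0) ∈ T := by
          rcases hcov 0 with h | h | h
          · exact h
          · exact absurd h I2
          · rw [Sym2.eq_swap] at h; exact absurd h I1
        have hz1 : s(z, vtx a 1) ∈ T := by
          rcases hcov 1 with h | h | h
          · exact h
          · exact absurd h I0
          · rw [Sym2.eq_swap] at h; exact absurd h I2
        have hz2 : s(z, vtx a 2) ∈ T := by
          rcases hcov 2 with h | h | h
          · exact h
          · exact absurd h I1
          · rw [Sym2.eq_swap] at h; exact absurd h I0
        intro p hp
        simp only [full, Finset.mem_insert, Finset.mem_singleton] at hp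
        rcases hp with rfl | rfl | rfl <;> assumption

/-- The tight pairs at the triangle of the point `z` with a small coordinate. -/
lemma star_of_small (hn : 4 ≤ n) {x : Fin n → ℝ} (hx : x ∈ polyhedron (dMin n))
    (hc : Covers (tight (dMin n) x)) {a : Fin (n / 3)} {c : Fin 3} (hz : x (vtx a c) ≤ 1 / 16) :
    star a c ⊆ tight (dMin n) x := by
  have key : ∀ c', c' ≠ c → s(vtx a c, vtx a c') ∈ tight (dMin n) x := by
    intro c' hne
    obtain ⟨j, hj⟩ := hc.exists_mk (vtx a c')
    rcases tight_cases_of_small hn hx hz hj with h | h | h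
    · exact absurd h (vtx_ne a hne)
    · rw [Sym2.eq_swap]; exact h ▸ hj
    · exact absurd (lab_vtx_eq a c' c) h.2.2
  intro p hp
  simp only [star, Finset.mem_insert, Finset.mem_singleton] at hp
  rcases hp with rfl | rfl
  · exact key _ (by fin_cases c <;> decide)
  · exact key _ (by fin_cases c <;> decide)

/-- The points outside the triangles are joined to the point `z` with a small coordinate. -/
lemma single_of_small (hn : 4 ≤ n) {x : Fin n → ℝ} (hx : x ∈ polyhedron (dMin n))
    (hc : Covers (tight (dMin n) x)) {z : Fin n} (hz : x z ≤ 1 / 16) {w : Fin n}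
    (hw : n / 3 ≤ lab w) (hwz : w ≠ z) : s(z, w) ∈ tight (dMin n) x := by
  obtain ⟨j, hj⟩ := hc.exists_mk w
  rcases tight_cases_of_small hn hx hz hj with h | h | h
  · exact absurd h hwz
  · rw [Sym2.eq_swap]; exact h ▸ hj
  · exact absurd (eq_of_lab_eq hw h.2.1) h.1

end Pieces

end TightSpan

/-! ### Classification of the smallest covering tight sets of `d_min`. -/

namespace TightSpan

section Structure

variable {n : ℕ}

/-- The first triangle which does not contain `z`. -/
def firstAvoiding (z : Fin n) : ℕ := if lab z = 0 then 1 else 0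

/-- The pair of the two points outside the triangles in case there are two of them. -/
def lastPair (n : ℕ) : Finset (Sym2 (Fin n)) :=
  Finset.univ.filter fun p => n % 3 = 2 ∧ ∃ i j : Fin n, i ≠ j ∧ p = s(i, j) ∧
    n / 3 ≤ lab i ∧ n / 3 ≤ lab j

/-- The union of a path in each triangle. -/
def starUnion (c : Fin (n / 3) → Fin 3) : Finset (Sym2 (Fin n)) :=
  Finset.univ.biUnion fun a => star a (c a)

/-- The union of a path in each triangle, except for the first one not containing `z`. -/
def capUnion (z : Fin n) (c : Fin (n / 3) → Fin 3) : Finset (Sym2 (Fin n)) :=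
  Finset.univ.biUnion fun a : Fin (n / 3) =>
    if (a : ℕ) = firstAvoiding z then cap z a else star a (c a)

lemma le_lab_iff {i : Fin n} : n / 3 ≤ lab i ↔ 3 * (n / 3) ≤ (i : ℕ) := by
  simp only [lab]
  split_ifs <;> omega

lemma card_biUnion_attached {z : Fin n} {pc : Fin (n / 3) → Finset (Sym2 (Fin n))}
    (h : ∀ a, ∀ p ∈ pc a, Attached z a p) :
    (Finset.univ.biUnion pc).card = ∑ a, (pc a).card := by
  refine Finset.card_biUnion fun a _ b _ hab => Finset.disjoint_left.2 fun p hp hq => hab ?_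
  exact (h a p hp).eq (h b p hq)

lemma card_starUnion (c : Fin (n / 3) → Fin 3) (hn : 0 < n) :
    (starUnion c).card = 2 * (n / 3) := by
  rw [starUnion, card_biUnion_attached (z := ⟨0, hn⟩) fun a p hp => attached_star _ hp]
  simp [card_star, mul_comm]

lemma notMem_of_mem_starUnion {c : Fin (n / 3) → Fin 3} {p : Sym2 (Fin n)}
    (hp : p ∈ starUnion c) {i : Fin n} (hi : i ∈ p) : lab i < n / 3 := by
  obtain ⟨a, -, ha⟩ := Finset.mem_biUnion.1 hp
  rw [lab_of_mem_star ha hi]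
  exact a.2

/-- A single point outside the triangles if `n % 3 = 1`, two of them if `n % 3 = 2`. -/
lemma exists_single (h : n % 3 ≠ 0) : ∃ s : Fin n, n / 3 ≤ lab s :=
  ⟨⟨n - 1, by omega⟩, le_lab_iff.2 (by simp only; omega)⟩

lemma exists_singles (h : n % 3 = 2) : ∃ s t : Fin n, s ≠ t ∧ n / 3 ≤ lab s ∧ n / 3 ≤ lab t :=
  ⟨⟨n - 1, by omega⟩, ⟨n - 2, by omega⟩, by simp only [Ne, Fin.mk.injEq]; omega,
    le_lab_iff.2 (by simp only; omega), le_lab_iff.2 (by simp only; omega)⟩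

lemma eq_or_eq_of_single (h : n % 3 = 2) {s t u : Fin n} (hs : n / 3 ≤ lab s)
    (ht : n / 3 ≤ lab t) (hst : s ≠ t) (hu : n / 3 ≤ lab u) : u = s ∨ u = t := by
  rw [le_lab_iff] at hs ht hu
  have : (s : ℕ) ≠ t := fun h => hst (Fin.ext h)
  have : (u : ℕ) = s ∨ (u : ℕ) = t := by omega
  exact this.imp Fin.ext Fin.ext

lemma not_single (h : n % 3 = 0) (s : Fin n) : ¬ n / 3 ≤ lab s := by
  rw [le_lab_iff]
  omega

lemma lastPair_of_ne (h : n % 3 ≠ 2) : lastPair n = ∅ := by simp [lastPair, h]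

lemma lastPair_eq (h : n % 3 = 2) {s t : Fin n} (hs : n / 3 ≤ lab s)
    (ht : n / 3 ≤ lab t) (hst : s ≠ t) : lastPair n = {s(s, t)} := by
  ext p
  simp only [lastPair, Finset.mem_filter, Finset.mem_univ, true_and, Finset.mem_singleton, h]
  constructor
  · rintro ⟨i, j, hij, rfl, hi, hj⟩
    rcases eq_or_eq_of_single h hs ht hst hi with rfl | rfl <;>
      rcases eq_or_eq_of_single h hs ht hst hj with rfl | rfl
    · exact absurd rfl hij
    · rfl
    · exact Sym2.eq_swap
    · exact absurd rfl hij
  · rintro rfl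
    exact ⟨s, t, hst, rfl, hs, ht⟩

/-- Adding the pairs at the points outside the triangles to a collection of pairs containing
at most `z` among these points. -/
lemma two_mul_add_le_card {T W : Finset (Sym2 (Fin n))} (hWT : W ⊆ T)
    (hW : 2 * (n / 3) ≤ W.card)
    (hE : n % 3 = 2 → (T \ W).Nonempty) :
    2 * (n / 3) + (if n % 3 = 2 then 1 else 0) ≤ T.card := by
  have h1 := Finset.card_sdiff_add_card_eq_card hWT
  split_ifs with h
  · have := (hE h).card_pos
    omega
  · omega

/-- The size leaves no room outside `W`, except for one pair if `n % 3 = 2`. -/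
lemma eq_union_of_card {T W : Finset (Sym2 (Fin n))} (hWT : W ⊆ T)
    (hT : T.card = 2 * (n / 3) + if n % 3 = 2 then 1 else 0)
    (hW : 2 * (n / 3) ≤ W.card)
    (hE : n % 3 = 2 → ∃ p ∈ T \ W, p ∈ lastPair n) : T = W ∪ lastPair n := by
  have h1 := Finset.card_sdiff_add_card_eq_card hWT
  rw [← Finset.union_sdiff_of_subset hWT]
  congr 1
  by_cases h : n % 3 = 2
  · obtain ⟨s, t, hst, hs, ht⟩ := exists_singles h
    obtain ⟨p, hp, hpl⟩ := hE h
    rw [lastPair_eq h hs ht hst] at hpl ⊢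
    rw [Finset.mem_singleton] at hpl
    subst hpl
    have := Finset.card_pos.2 ⟨_, hp⟩
    rw [if_pos h] at hT
    obtain ⟨q, hq⟩ := Finset.card_eq_one.1 (show (T \ W).card = 1 by omega)
    rw [hq] at hp ⊢
    rw [Finset.mem_singleton.1 hp]
  · rw [if_neg h] at hT
    rw [lastPair_of_ne h]
    exact Finset.card_eq_zero.1 (by omega)

/-- The tight sets at a point all of whose coordinates are large, or which contain a path in each
triangle. -/
lemma structure_of_stars {T : Finset (Sym2 (Fin n))} (hn : 0 < n) (hc : Covers T)
    {c : Fin (n / 3) → Fin 3} (h : ∀ a, star a (c a) ⊆ T) :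
    2 * (n / 3) + (if n % 3 = 2 then 1 else 0) ≤ T.card ∧
      (T.card = 2 * (n / 3) + (if n % 3 = 2 then 1 else 0) →
        n % 3 ≠ 1 ∧ T = starUnion c ∪ lastPair n) := by
  have hWT : starUnion c ⊆ T := Finset.biUnion_subset.2 fun a _ => h a
  have hW := card_starUnion c hn
  have hcov : ∀ s : Fin n, n / 3 ≤ lab s → ∃ p ∈ T \ starUnion c, s ∈ p := fun s hs => by
    obtain ⟨p, hp, hsp⟩ := hc s
    exact ⟨p, Finset.mem_sdiff.2 ⟨hp, fun hpW =>
      absurd (notMem_of_mem_starUnion hpW hsp) (not_lt.2 hs)⟩, hsp⟩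
  have h1 := Finset.card_sdiff_add_card_eq_card hWT
  refine ⟨two_mul_add_le_card hWT hW.ge fun h2 => ?_, fun hT => ?_⟩
  · obtain ⟨s, hs⟩ := exists_single (n := n) (by omega)
    obtain ⟨p, hp, -⟩ := hcov s hs
    exact ⟨p, hp⟩
  · have hne : n % 3 ≠ 1 := fun h1' => by
      obtain ⟨s, hs⟩ := exists_single (n := n) (by omega)
      obtain ⟨p, hp, -⟩ := hcov s hs
      have := Finset.card_pos.2 ⟨p, hp⟩
      rw [if_neg (by omega)] at hT
      omega
    refine ⟨hne, eq_union_of_card hWT hT hW.ge fun h2 => ?_⟩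
    obtain ⟨s, t, hst, hs, ht⟩ := exists_singles h2
    obtain ⟨p, hp, hsp⟩ := hcov s hs
    obtain ⟨q, hq, htq⟩ := hcov t ht
    rw [if_pos h2] at hT
    have hpq : p = q := by
      refine Finset.card_le_one.1 ?_ p hp q hq
      omega
    subst hpq
    refine ⟨p, hp, ?_⟩
    rw [lastPair_eq h2 hs ht hst, Finset.mem_singleton]
    exact (Sym2.mem_and_mem_iff hst).1 ⟨hsp, htq⟩

/-- The tight sets at a point with a small coordinate. -/
lemma structure_of_small (hn : 4 ≤ n) {x : Fin n → ℝ} (hx : x ∈ polyhedron (dMin n))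
    (hc : Covers (tight (dMin n) x)) {z : Fin n} (hz : x z ≤ 1 / 16)
    (hns : ¬ ∃ c : Fin (n / 3) → Fin 3, ∀ a, star a (c a) ⊆ tight (dMin n) x) :
    2 * (n / 3) + (if n % 3 = 2 then 1 else 0) ≤ (tight (dMin n) x).card ∧
      ((tight (dMin n) x).card = 2 * (n / 3) + (if n % 3 = 2 then 1 else 0) →
        (n % 3 ≠ 0 → n / 3 ≤ lab z) ∧ ∃ c : Fin (n / 3) → Fin 3,
          (∀ a : Fin (n / 3), lab z = a → vtx a (c a) = z) ∧
          tight (dMin n) x = capUnion z c ∪ lastPair n) := by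
  classical
  set T := tight (dMin n) x with hT
  -- Every triangle contributes at least two pairs, and the triangle of `z` a path centred at `z`.
  -- Where no path is found, `c` is set to `0`.
  have hpiece : ∀ a : Fin (n / 3), ∃ Q ⊆ T, ∃ c : Fin 3, (∀ p ∈ Q, Attached z a p) ∧
      (lab z = a → vtx a c = z) ∧
      ((Q = star a c ∧ (lab z ≠ a → eps n z (vtx a c) ≤ x z)) ∨
        (lab z ≠ a ∧ Q = cap z a ∧ x z ≤ eps n z (vtx a 0) ∧
          eps n z (vtx a 1) + eps n z (vtx a 2) ≤ 2 * x z) ∨ Q = full z a) := by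
    intro a
    by_cases ha : lab z = a
    · obtain ⟨c, rfl⟩ := exists_eq_vtx ha
      exact ⟨star a c, star_of_small hn hx hc hz, c, fun p hp => attached_star _ hp, fun _ => rfl,
        Or.inl ⟨rfl, fun h => absurd ha h⟩⟩
    · rcases pieces_of_small hn hx hc hz ha with ⟨c, h1, h2⟩ | ⟨h1, h2⟩ | h1
      · exact ⟨star a c, h1, c, fun p hp => attached_star _ hp, fun h => absurd h ha,
          Or.inl ⟨rfl, fun _ => h2⟩⟩
      · exact ⟨cap z a, h1, 0, fun p hp => attached_cap hp, fun h => absurd h ha,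
          Or.inr (Or.inl ⟨ha, rfl, h2⟩)⟩
      · exact ⟨full z a, h1, 0, fun p hp => attached_full hp, fun h => absurd h ha,
          Or.inr (Or.inr rfl)⟩
  choose pc hpcT c hatt hcz hcases using hpiece
  set W := Finset.univ.biUnion pc with hWdef
  have hWT : W ⊆ T := Finset.biUnion_subset.2 fun a _ => hpcT a
  have hWcard : W.card = ∑ a, (pc a).card := card_biUnion_attached hatt
  have htwo : ∀ a ∈ Finset.univ, 2 ≤ (pc a).card := fun a _ => by
    rcases hcases a with ⟨h, -⟩ | ⟨h, h', -⟩ | h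
    · rw [h, card_star]
    · rw [h', card_cap h]
    · rw [h, card_full]; norm_num
  have hsum2 : ∑ _a : Fin (n / 3), 2 = 2 * (n / 3) := by simp [mul_comm]
  have hW : 2 * (n / 3) ≤ W.card := by
    rw [hWcard, ← hsum2]
    exact Finset.sum_le_sum htwo
  have hsingle : ∀ s : Fin n, n / 3 ≤ lab s → s ≠ z → s(z, s) ∈ T \ W := fun s hs hsz => by
    refine Finset.mem_sdiff.2 ⟨single_of_small hn hx hc hz hs hsz, fun hW => ?_⟩
    obtain ⟨a, -, ha⟩ := Finset.mem_biUnion.1 hW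
    rcases (hatt a _ ha).2 s (Sym2.mem_mk_right _ _) with h | h
    · omega
    · exact hsz h
  have h1 := Finset.card_sdiff_add_card_eq_card hWT
  refine ⟨two_mul_add_le_card hWT hW fun h2 => ?_, fun hcard => ?_⟩
  · obtain ⟨s, t, hst, hs, ht⟩ := exists_singles h2
    by_cases hsz : s = z
    · exact ⟨_, hsingle t ht (hsz ▸ hst.symm)⟩
    · exact ⟨_, hsingle s hs hsz⟩
  -- If `z` were in a triangle, every point outside the triangles would need its own pair with `z`,
  -- one pair too many.
  · have hzsingle : n % 3 ≠ 0 → n / 3 ≤ lab z := by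
      intro h0
      by_contra hlt
      have hne : ∀ s : Fin n, n / 3 ≤ lab s → s ≠ z := fun s hs h => hlt (h ▸ hs)
      by_cases h2 : n % 3 = 2
      · obtain ⟨s, t, hst, hs, ht⟩ := exists_singles h2
        have : 1 < (T \ W).card := Finset.one_lt_card.2 ⟨_, hsingle s hs (hne s hs), _,
          hsingle t ht (hne t ht), fun h => hst (Sym2.congr_right.1 h)⟩
        rw [if_pos h2] at hcard
        omega
      · obtain ⟨s, hs⟩ := exists_single h0
        have := Finset.card_pos.2 ⟨_, hsingle s hs (hne s hs)⟩
        rw [if_neg h2] at hcard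
        omega
    have hTW : T = W ∪ lastPair n := by
      refine eq_union_of_card hWT hcard hW fun h2 => ?_
      have hz1 := hzsingle (by omega)
      obtain ⟨s, t, hst, hs, ht⟩ := exists_singles h2
      obtain ⟨u, hu, huz⟩ : ∃ u : Fin n, n / 3 ≤ lab u ∧ u ≠ z := by
        by_cases hsz : s = z
        · exact ⟨t, ht, hsz ▸ hst.symm⟩
        · exact ⟨s, hs, hsz⟩
      exact ⟨_, hsingle u hu huz, by
        rw [lastPair_eq h2 hz1 hu huz.symm, Finset.mem_singleton]⟩
    have hWle : W.card = 2 * (n / 3) := by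
      refine le_antisymm ?_ hW
      by_cases h2 : n % 3 = 2
      · rw [if_pos h2] at hcard
        have hz1 := hzsingle (by omega)
        obtain ⟨s, t, hst, hs, ht⟩ := exists_singles h2
        have : 0 < (T \ W).card := by
          by_cases hsz : s = z
          · exact Finset.card_pos.2 ⟨_, hsingle t ht (hsz ▸ hst.symm)⟩
          · exact Finset.card_pos.2 ⟨_, hsingle s hs hsz⟩
        omega
      · rw [if_neg h2] at hcard
        omega
    have hpc2 : ∀ a, (pc a).card = 2 := fun a =>
      ((Finset.sum_eq_sum_iff_of_le htwo).1 (by rw [hsum2, ← hWcard, hWle]) a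
        (Finset.mem_univ a)).symm
    have hcases' : ∀ a, (pc a = star a (c a) ∧ (lab z ≠ a → eps n z (vtx a (c a)) ≤ x z)) ∨
        (lab z ≠ a ∧ pc a = cap z a ∧ x z ≤ eps n z (vtx a 0) ∧
          eps n z (vtx a 1) + eps n z (vtx a 2) ≤ 2 * x z) := fun a => by
      rcases hcases a with h | h | h
      · exact Or.inl h
      · exact Or.inr h
      · have := hpc2 a
        rw [h, card_full] at this
        omega
    obtain ⟨b, hb⟩ : ∃ b, ¬ pc b = star b (c b) := by
      by_contra! hall
      exact hns ⟨c, fun a => hall a ▸ hpcT a⟩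
    have hcapb : ∀ b, ¬ pc b = star b (c b) → lab z ≠ b ∧ pc b = cap z b ∧
        x z ≤ eps n z (vtx b 0) := fun b hb => by
      rcases hcases' b with h | h
      · exact absurd h.1 hb
      · exact ⟨h.1, h.2.1, h.2.2.1⟩
    -- A cap at `b` makes `x z` smaller than every `eps` at an earlier triangle, whereas a path or a
    -- cap at `a` bounds `x z` from below by one such value or a mean of two. So only the triangle
    -- of `z` can precede `b`.
    have hbefore : ∀ a b : Fin (n / 3), a < b → ¬ pc b = star b (c b) → lab z = a := by
      intro a b hab hb
      by_contra ha
      obtain ⟨hzb, -, hle⟩ := hcapb b hb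
      have hlt : ∀ c', x z < eps n z (vtx a c') := fun c' => by
        refine lt_of_le_of_lt hle (eps_anti hn ?_ ?_ ?_)
        · have : (a : ℕ) < b := hab
          simp only [vtx]
          have := c'.2
          simp
          omega
        · exact fun h => ha (by rw [Fin.ext h, lab_vtx])
        · exact fun h => hzb (by rw [Fin.ext h, lab_vtx])
      rcases hcases' a with ⟨-, h⟩ | ⟨-, -, -, h⟩
      · exact absurd (h ha) (not_le.2 (hlt _))
      · have := hlt 1
        have := hlt 2
        linarith
    have hbfirst : (b : ℕ) = firstAvoiding z := by
      have hzb := (hcapb b hb).1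
      rw [firstAvoiding]
      split_ifs with h0
      · rw [h0] at hzb
        by_contra hb1
        have := hbefore ⟨1, by omega⟩ b (Fin.lt_def.2 (by simp only; omega)) hb
        simp only at this
        omega
      · by_contra hb1
        have := hbefore ⟨0, by omega⟩ b (Fin.lt_def.2 (by simp only; omega)) hb
        simp only at this
        omega
    refine ⟨hzsingle, c, hcz, ?_⟩
    have hWcap : W = capUnion z c := by
      rw [hWdef, capUnion]
      congr 1
      funext a
      split_ifs with ha
      · have : a = b := Fin.ext (ha.trans hbfirst.symm)
        rw [this]
        exact (hcapb b hb).2.1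
      · by_contra hns'
        have hab : a ≠ b := fun h => ha (h ▸ hbfirst)
        rcases lt_or_gt_of_ne hab with h | h
        · exact (hcapb a hns').1 (hbefore a b h hb)
        · exact (hcapb b hb).1 (hbefore b a h hns')
    rw [hTW, hWcap]

/-- The possible covering tight sets of `dMin n`. -/
theorem structure_dMin (hn : 4 ≤ n) {x : Fin n → ℝ} (hx : x ∈ polyhedron (dMin n))
    (hc : Covers (tight (dMin n) x)) :
    2 * (n / 3) + (if n % 3 = 2 then 1 else 0) ≤ (tight (dMin n) x).card ∧
      ((tight (dMin n) x).card = 2 * (n / 3) + (if n % 3 = 2 then 1 else 0) →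
        (n % 3 ≠ 1 ∧ ∃ c, tight (dMin n) x = starUnion c ∪ lastPair n) ∨
        ∃ z : Fin n, (n % 3 ≠ 0 → n / 3 ≤ lab z) ∧ ∃ c : Fin (n / 3) → Fin 3,
          (∀ a : Fin (n / 3), lab z = a → vtx a (c a) = z) ∧
          tight (dMin n) x = capUnion z c ∪ lastPair n) := by
  by_cases hstar : ∃ c : Fin (n / 3) → Fin 3, ∀ a, star a (c a) ⊆ tight (dMin n) x
  · obtain ⟨c, h⟩ := hstar
    obtain ⟨h1, h2⟩ := structure_of_stars (by omega) hc h
    exact ⟨h1, fun hcard => Or.inl ⟨(h2 hcard).1, c, (h2 hcard).2⟩⟩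
  · by_cases hz : ∃ z, x z ≤ 1 / 16
    · obtain ⟨z, hz⟩ := hz
      obtain ⟨h1, h2⟩ := structure_of_small hn hx hc hz hstar
      exact ⟨h1, fun hcard => Or.inr ⟨z, h2 hcard⟩⟩
    · push Not at hz
      choose c h using exists_star_of_large hn hx hc hz
      exact absurd ⟨c, h⟩ hstar

end Structure

end TightSpan

/-! ### Counting the smallest covering tight sets of `d_min`. -/

namespace TightSpan

section Count

variable {n : ℕ}

/-- The choices of the centres of the paths in `capUnion`, normalized at the triangle whose path
is omitted. -/
def capChoices (z : Fin n) : Finset (Fin (n / 3) → Fin 3) :=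
  Fintype.piFinset fun a => if (a : ℕ) = firstAvoiding z then {0} else
    if lab z = a then Finset.univ.filter fun c => vtx a c = z else Finset.univ

lemma firstAvoiding_ne (z : Fin n) : firstAvoiding z ≠ lab z := by
  rw [firstAvoiding]
  split_ifs with h <;> omega

lemma card_capChoices (z : Fin n) (hf : firstAvoiding z < n / 3) :
    (capChoices z).card * 3 * (if lab z < n / 3 then 3 else 1) = 3 ^ (n / 3) := by
  classical
  -- The two constants, for the capped triangle and for the triangle of `z`, are written as products
  -- over all triangles so that the identity holds factor by factor.
  have h1 : ∏ a : Fin (n / 3), (if (a : ℕ) = firstAvoiding z then 3 else 1) = 3 := by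
    have : ∀ a : Fin (n / 3), ((a : ℕ) = firstAvoiding z) = (a = ⟨firstAvoiding z, hf⟩) :=
      fun a => by rw [Fin.ext_iff]
    simp only [this, Finset.prod_ite_eq', Finset.mem_univ, if_true]
  have h2 : ∏ a : Fin (n / 3), (if lab z = a then 3 else 1) = if lab z < n / 3 then 3 else 1 := by
    split_ifs with h
    · have : ∀ a : Fin (n / 3), (lab z = (a : ℕ)) = (⟨lab z, h⟩ = a) :=
        fun a => by rw [Fin.ext_iff]
      simp only [this, Finset.prod_ite_eq, Finset.mem_univ, if_true]
    · exact Finset.prod_eq_one fun a _ => if_neg (by omega)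
  have h3 : (3 : ℕ) ^ (n / 3) = ∏ _a : Fin (n / 3), 3 := by simp
  rw [capChoices, Fintype.card_piFinset, h3, ← h2]
  conv_lhs => enter [1, 2]; rw [← h1]
  rw [← Finset.prod_mul_distrib, ← Finset.prod_mul_distrib]
  refine Finset.prod_congr rfl fun a _ => ?_
  by_cases ha : (a : ℕ) = firstAvoiding z
  · have := firstAvoiding_ne z
    rw [if_pos ha, if_pos ha, if_neg (by omega)]
    rfl
  · rw [if_neg ha, if_neg ha]
    split_ifs with hz
    · obtain ⟨c, rfl⟩ := exists_eq_vtx hz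
      simp only [(vtx_injective a).eq_iff, Finset.filter_eq', Finset.mem_univ, if_true,
        Finset.card_singleton]
      rfl
    · simp

lemma exists_mem_capChoices {z : Fin n} {c : Fin (n / 3) → Fin 3}
    (hc : ∀ a : Fin (n / 3), lab z = a → vtx a (c a) = z) :
    ∃ c' ∈ capChoices z, capUnion z c' = capUnion z c := by
  refine ⟨fun a => if (a : ℕ) = firstAvoiding z then 0 else c a, ?_, ?_⟩
  · rw [capChoices, Fintype.mem_piFinset]
    intro a
    by_cases ha : (a : ℕ) = firstAvoiding z
    · simp [ha]
    · by_cases hz : lab z = a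
      · simp [ha, hz, hc a hz]
      · simp [ha, hz]
  · rw [capUnion, capUnion]
    congr 1
    funext a
    by_cases ha : (a : ℕ) = firstAvoiding z
    · rw [if_pos ha, if_pos ha]
    · simp only [if_neg ha]

/-- The covering tight sets of `dMin n` of minimal size. -/
lemma coverFaces_dMin_subset (hn : 4 ≤ n) {m : ℕ}
    (hm : n = 2 * (n / 3) + (if n % 3 = 2 then 1 else 0) + m) :
    coverFaces (dMin n) m ⊆
      (((if n % 3 = 1 then ∅ else
        (Finset.univ : Finset (Fin (n / 3) → Fin 3)).image fun c => starUnion c ∪ lastPair n) ∪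
      (Finset.univ.filter fun z : Fin n => n % 3 ≠ 0 → n / 3 ≤ lab z).biUnion fun z =>
        (capChoices z).image fun c => capUnion z c ∪ lastPair n : Finset _) : Set _) := by
  rintro S ⟨hc, hcard, x, hx, rfl⟩
  rw [Finset.mem_coe, Finset.mem_union]
  rcases (structure_dMin hn hx hc).2 (by omega) with ⟨h1, c, h⟩ | ⟨z, hz, c, hcz, h⟩
  · left
    rw [if_neg h1, h]
    exact Finset.mem_image_of_mem _ (Finset.mem_univ _)
  · right
    obtain ⟨c', hc', h'⟩ := exists_mem_capChoices hcz
    refine Finset.mem_biUnion.2 ⟨z, Finset.mem_filter.2 ⟨Finset.mem_univ _, hz⟩, ?_⟩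
    rw [h, ← h']
    exact Finset.mem_image_of_mem _ hc'

/-- A union bound suffices, because the general lower bound turns out to be the same number. -/
lemma ncard_coverFaces_dMin_le (hn : 4 ≤ n) {m : ℕ}
    (hm : n = 2 * (n / 3) + (if n % 3 = 2 then 1 else 0) + m) :
    (coverFaces (dMin n) m).ncard ≤ (if n % 3 = 1 then 0 else 3 ^ (n / 3)) +
      ∑ z ∈ Finset.univ.filter fun z : Fin n => n % 3 ≠ 0 → n / 3 ≤ lab z,
        (capChoices z).card := by
  refine (Set.ncard_le_ncard (coverFaces_dMin_subset hn hm) (Finset.finite_toSet _)).trans ?_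
  rw [Set.ncard_coe_finset]
  refine (Finset.card_union_le _ _).trans (add_le_add ?_ ?_)
  · split_ifs
    · simp
    · refine Finset.card_image_le.trans ?_
      simp
  · exact Finset.card_biUnion_le.trans (Finset.sum_le_sum fun z _ => Finset.card_image_le)

/-- With only one triangle, for `n = 4, 5`, the point `z` lies outside it; otherwise there are at
least two triangles. -/
lemma firstAvoiding_lt (hn : 4 ≤ n) (z : Fin n) (hz : n % 3 ≠ 0 → n / 3 ≤ lab z) :
    firstAvoiding z < n / 3 := by
  rw [firstAvoiding]
  split_ifs with h
  · by_cases h0 : n % 3 = 0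
    · omega
    · have := hz h0
      omega
  · omega

lemma card_capChoices_single (hn : 4 ≤ n) {z : Fin n} (hz : n / 3 ≤ lab z) :
    (capChoices z).card = 3 ^ (n / 3 - 1) := by
  have h := card_capChoices z (firstAvoiding_lt hn z fun _ => hz)
  have h' : 3 ^ (n / 3) = 3 ^ (n / 3 - 1) * 3 := by
    rw [← pow_succ, Nat.sub_add_cancel (by omega)]
  rw [if_neg (by omega)] at h
  omega

lemma card_filter_single (n : ℕ) :
    (Finset.univ.filter fun z : Fin n => n / 3 ≤ lab z).card = n % 3 := by
  have h := Finset.card_filter_add_card_filter_not (s := (Finset.univ : Finset (Fin n)))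
    (fun z => (z : ℕ) < 3 * (n / 3))
  rw [Fin.card_filter_val_lt, Finset.card_univ, Fintype.card_fin, min_eq_right (by omega)] at h
  simp only [le_lab_iff]
  simp only [← not_lt]
  omega

lemma ncard_coverFaces_dMin_zero {k : ℕ} (hk : 2 ≤ k) (hn : n = 3 * k) :
    (coverFaces (dMin n) k).ncard ≤ n * 3 ^ (k - 2) + 3 ^ k := by
  have h4 : 4 ≤ n := by omega
  refine (ncard_coverFaces_dMin_le h4 (by rw [if_neg (by omega)]; omega)).trans ?_
  have hk3 : (3 : ℕ) ^ (n / 3) = 3 ^ k := by congr 1; omega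
  rw [if_neg (by omega), hk3, add_comm]
  refine Nat.add_le_add_right (((Finset.sum_le_card_nsmul _ _ (3 ^ (k - 2)) fun z _ => ?_)).trans ?_) _
  · have h := card_capChoices z (firstAvoiding_lt h4 z fun h => absurd (by omega) h)
    rw [if_pos (not_le.1 (not_single (by omega) z)), hk3] at h
    have h' : 3 ^ k = 3 ^ (k - 2) * 3 * 3 := by
      rw [← pow_succ, ← pow_succ]
      congr 1
      omega
    omega
  · rw [smul_eq_mul]
    exact Nat.mul_le_mul_right _ ((Finset.card_le_univ _).trans (by simp))

lemma ncard_coverFaces_dMin_le_single (hn : 4 ≤ n) (h0 : n % 3 ≠ 0) {m : ℕ}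
    (hm : n = 2 * (n / 3) + (if n % 3 = 2 then 1 else 0) + m) :
    (coverFaces (dMin n) m).ncard ≤
      (if n % 3 = 1 then 0 else 3 ^ (n / 3)) + n % 3 * 3 ^ (n / 3 - 1) := by
  refine (ncard_coverFaces_dMin_le hn hm).trans (Nat.add_le_add_left ?_ _)
  simp only [h0, Ne, not_false_eq_true, forall_const]
  rw [Finset.sum_congr rfl fun z hz => card_capChoices_single hn (Finset.mem_filter.1 hz).2,
    Finset.sum_const, card_filter_single, smul_eq_mul]

lemma ncard_coverFaces_dMin_one {k : ℕ} (hk : 1 ≤ k) (hn : n = 3 * k + 1) :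
    (coverFaces (dMin n) (k + 1)).ncard ≤ 3 ^ (k - 1) := by
  refine (ncard_coverFaces_dMin_le_single (by omega) (by omega)
    (by rw [if_neg (by omega)]; omega)).trans ?_
  rw [if_pos (by omega), show n % 3 = 1 by omega, show n / 3 = k by omega]
  omega

lemma ncard_coverFaces_dMin_two {k : ℕ} (hk : 1 ≤ k) (hn : n = 3 * k + 2) :
    (coverFaces (dMin n) (k + 1)).ncard ≤ 5 * 3 ^ (k - 1) := by
  refine (ncard_coverFaces_dMin_le_single (by omega) (by omega)
    (by rw [if_pos (by omega)]; omega)).trans ?_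
  rw [if_neg (by omega), show n % 3 = 2 by omega, show n / 3 = k - 1 + 1 by omega, pow_succ,
    Nat.add_sub_cancel]
  omega

end Count

end TightSpan

/-! ### The dimension of the tight span of `d_min`, and the theorem. -/

namespace TightSpan

section Final

variable {n : ℕ}

lemma free_tight_dMin (hn : 4 ≤ n) : ∀ x ∈ polyhedron (dMin n), Free pairSum (tight (dMin n) x) :=
  fun _ hx => (isMetric_dMin hn).free_tight (by omega) (isGeneric_dMin hn)
    (fun _ _ hij => one_pos.trans_le (one_le_dMin hij)) hx

lemma le_card_tight_dMin (hn : 4 ≤ n) {m : ℕ}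
    (hm : n = 2 * (n / 3) + (if n % 3 = 2 then 1 else 0) + m) {x : Fin n → ℝ}
    (hx : x ∈ polyhedron (dMin n)) (hc : Covers (tight (dMin n) x)) :
    n ≤ (tight (dMin n) x).card + m := by
  have := (structure_dMin hn hx hc).1
  omega

lemma hasDim_tightSpan_dMin (hn : 4 ≤ n) {m : ℕ}
    (hm : n = 2 * (n / 3) + (if n % 3 = 2 then 1 else 0) + m) :
    HasDim (tightSpan (dMin n)) m := by
  have hd := isMetric_dMin hn
  have hfree := free_tight_dMin hn
  constructor
  -- The cover of a permutation has `(n + #odd orbits) / 2` pairs. As there are at most `n / 3` odd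
  -- orbits, this meets the lower bound of the classification, so the dimension is attained.
  · obtain ⟨x, hx, σ, hσ, hσ'⟩ := hd.exists_tight_perm hfree (by omega)
    have : Nonempty (Fin n) := ⟨⟨0, by omega⟩⟩
    obtain ⟨v, hv⟩ := exists_isTransversal σ
    obtain ⟨y, hy, hyS⟩ := exists_tight_eq hfree hx (cover_subset (v := v) hσ)
    have hc : Covers (tight (dMin n) y) := by rw [hyS]; exact hv.exists_mem_cover
    have h1 := le_card_tight_dMin hn hm hy hc
    have h2 := hv.card_cover hσ'
    obtain ⟨h3, h4⟩ := three_mul_card_oddOrbits_le hσ'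
    have h5 := faceDim_tight hfree hy
    rw [hyS] at h1
    rw [Fintype.card_fin] at h2
    refine ⟨_, hd.mem_tightSpan hy hc, ?_⟩
    rw [hyS] at h5 ⊢
    split_ifs at hm <;> omega
  · rintro _ ⟨F, hF, rfl⟩
    obtain ⟨x, hx, rfl⟩ := tightSpan_eq_minFace hF
    have h1 := le_card_tight_dMin hn hm hx ((hd.covers_iff hx).1 hF.2)
    have h2 := faceDim_tight hfree hx
    omega

lemma ceil_div_three (n : ℕ) : ⌈(n : ℚ) / 3⌉₊ = (n + 2) / 3 := by
  have h1 : (n + 2) / 3 * 3 ≤ n + 2 := Nat.div_mul_le_self _ _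
  have h2 : n ≤ (n + 2) / 3 * 3 := by omega
  refine le_antisymm (Nat.ceil_le.2 ?_) ?_
  · rw [div_le_iff₀ (by norm_num)]
    exact_mod_cast h2
  · have h3 := (div_le_iff₀ (by norm_num : (0 : ℚ) < 3)).1 (Nat.le_ceil ((n : ℚ) / 3))
    have h4 : n ≤ ⌈(n : ℚ) / 3⌉₊ * 3 := by exact_mod_cast h3
    omega

lemma floor_two_mul_div_three (n : ℕ) : ⌊2 * (n : ℚ) / 3⌋₊ = 2 * n / 3 := by
  have := Nat.floor_div_eq_div (K := ℚ) (2 * n) 3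
  push_cast at this
  exact this

end Final

end TightSpan

theorem mainTheorem3 (n : ℕ) (hn : 4 ≤ n) :
    (∀ d : Fin n → Fin n → ℝ, TightSpan.IsMetric d → TightSpan.IsGeneric d →
      TightSpan.HasDim (TightSpan.tightSpan d) ⌈(n : ℚ) / 3⌉₊ →
        TightSpan.fVec (TightSpan.tightSpan d) ⌈(n : ℚ) / 3⌉₊
            = TightSpan.fVec (TightSpan.interiorCells d) (⌊2 * (n : ℚ) / 3⌋₊ - 1) ∧
        (∀ k : ℕ, n = 3 * k →
          n * 3 ^ (k - 2) + 3 ^ k ≤ TightSpan.fVec (TightSpan.tightSpan d) ⌈(n : ℚ) / 3⌉₊) ∧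
        (∀ k : ℕ, n = 3 * k + 1 →
          3 ^ (k - 1) ≤ TightSpan.fVec (TightSpan.tightSpan d) ⌈(n : ℚ) / 3⌉₊) ∧
        (∀ k : ℕ, n = 3 * k + 2 →
          5 * 3 ^ (k - 1) ≤ TightSpan.fVec (TightSpan.tightSpan d) ⌈(n : ℚ) / 3⌉₊)) ∧
    (TightSpan.IsMetric (TightSpan.dMin n) ∧ TightSpan.IsGeneric (TightSpan.dMin n) ∧
      TightSpan.HasDim (TightSpan.tightSpan (TightSpan.dMin n)) ⌈(n : ℚ) / 3⌉₊ ∧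
      (∀ k : ℕ, n = 3 * k →
        TightSpan.fVec (TightSpan.tightSpan (TightSpan.dMin n)) ⌈(n : ℚ) / 3⌉₊
          = n * 3 ^ (k - 2) + 3 ^ k) ∧
      (∀ k : ℕ, n = 3 * k + 1 →
        TightSpan.fVec (TightSpan.tightSpan (TightSpan.dMin n)) ⌈(n : ℚ) / 3⌉₊
          = 3 ^ (k - 1)) ∧
      (∀ k : ℕ, n = 3 * k + 2 →
        TightSpan.fVec (TightSpan.tightSpan (TightSpan.dMin n)) ⌈(n : ℚ) / 3⌉₊
          = 5 * 3 ^ (k - 1))) := by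
  -- The least size of a covering tight set, `n - ⌈n/3⌉`, in the form used by the classification.
  have hm : n = 2 * (n / 3) + (if n % 3 = 2 then 1 else 0) + (n + 2) / 3 := by
    split_ifs <;> omega
  rw [TightSpan.ceil_div_three, TightSpan.floor_two_mul_div_three]
  constructor
  · intro d hd hg hdim
    have hpos : ∀ i j, i ≠ j → 0 < d i j := fun i j hij =>
      hd.pos_of_generic (by omega) hg (by omega) hdim hij
    have hfree : ∀ x ∈ TightSpan.polyhedron d,
        TightSpan.Free TightSpan.pairSum (TightSpan.tight d x) :=
      fun x hx => hd.free_tight (by omega) hg hpos hx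
    have hcard : ∀ x ∈ TightSpan.polyhedron d, TightSpan.Covers (TightSpan.tight d x) →
        n ≤ (TightSpan.tight d x).card + (n + 2) / 3 :=
      fun x hx hc => hd.card_of_hasDim hfree hdim hx hc
    rw [hd.fVec_tightSpan hfree]
    refine ⟨?_, fun k hk => ?_, fun k hk => ?_, fun k hk => ?_⟩
    · rw [← hd.fVec_interiorCells hfree (by omega) (by omega)]
      congr 1
      omega
    · rw [show (n + 2) / 3 = k by omega] at hcard ⊢
      exact hd.lower_bound_zero hfree (by omega) hk hcard
    · rw [show (n + 2) / 3 = k + 1 by omega] at hcard ⊢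
      exact hd.lower_bound_one hfree (by omega) hk hcard
    · rw [show (n + 2) / 3 = k + 1 by omega] at hcard ⊢
      exact hd.lower_bound_two hfree (by omega) hk hcard
  · have hd := TightSpan.isMetric_dMin hn
    have hfree := TightSpan.free_tight_dMin hn
    have hcard : ∀ x ∈ TightSpan.polyhedron (TightSpan.dMin n),
        TightSpan.Covers (TightSpan.tight (TightSpan.dMin n) x) →
        n ≤ (TightSpan.tight (TightSpan.dMin n) x).card + (n + 2) / 3 :=
      fun x hx hc => TightSpan.le_card_tight_dMin hn hm hx hc
    refine ⟨hd, TightSpan.isGeneric_dMin hn, TightSpan.hasDim_tightSpan_dMin hn hm, ?_⟩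
    rw [hd.fVec_tightSpan hfree]
    -- The upper bounds come from the classification, the lower ones from the general argument
    -- applied to `d_min`.
    refine ⟨fun k hk => le_antisymm ?_ ?_, fun k hk => le_antisymm ?_ ?_,
      fun k hk => le_antisymm ?_ ?_⟩
    · rw [show (n + 2) / 3 = k by omega]
      exact TightSpan.ncard_coverFaces_dMin_zero (by omega) hk
    · rw [show (n + 2) / 3 = k by omega] at hcard ⊢
      exact hd.lower_bound_zero hfree (by omega) hk hcard
    · rw [show (n + 2) / 3 = k + 1 by omega]
      exact TightSpan.ncard_coverFaces_dMin_one (by omega) hk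
    · rw [show (n + 2) / 3 = k + 1 by omega] at hcard ⊢
      exact hd.lower_bound_one hfree (by omega) hk hcard
    · rw [show (n + 2) / 3 = k + 1 by omega]
      exact TightSpan.ncard_coverFaces_dMin_two (by omega) hk
    · rw [show (n + 2) / 3 = k + 1 by omega] at hcard ⊢
      exact hd.lower_bound_two hfree (by omega) hk hcard
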